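/- Let $K$ be a commutative ring, $\mathsf A$ a $K$-linear abelian category and $(\mathcal T,\mathcal F)$ a torsion pair in $\mathsf A$, that is, a pair of full subcategories, closed under isomorphism, such that $\operatorname{Hom}(T,F)=0$ for all $T\in\mathcal T$, $F\in\mathcal F$, and every $X\in\mathsf A$ sits in a short exact sequence $0\to T\to X\to F\to 0$ with $T\in\mathcal T$, $F\in\mathcal F$. \textbf{The DG category $\mathfrak{Ch}(\mathsf B)$.} Let $\mathsf B$ be the tilted category: its objects are the morphisms $\mathbb X=[X^{-1}\xrightarrow{d}X^0]$ of $\mathsf A$ with $\ker d\in\mathcal F$ and $\operatorname{coker} d\in\mathcal T$. A morphism $\mathbb X\to\mathbb Y$ is an isomorphism class of butterflies $(E,\kappa,\iota,\sigma,\rho)$, where $\kappa\colon X^{-1}\to E$, $\iota\colon Y^{-1}\to E$, $\sigma\colon E\to X^0$, $\rho\colon E\to Y^0$ satisfy $\sigma\kappa=d_X$, $\rho\iota=d_Y$, $\rho\kappa=0$, $\sigma\iota=0$, and $0\to Y^{-1}\xrightarrow{\iota}E\xrightarrow{\sigma}X^0\to0$ is exact. The composition of $E$ (from $\mathbb X$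 to $\mathbb Y$) and $F$ (from $\mathbb Y$ to $\mathbb Z$) has middle object $\operatorname{coker}\big((\iota,\kappa')\colon Y^{-1}\to E\times_{Y^0}F\big)$ and arrows $(\kappa,0)$, $(0,\iota')$, $\sigma$, $\rho'$; the sum of $E,E'\colon\mathbb X\to\mathbb Y$ has middle object $\operatorname{coker}\big((\iota,-\iota')\colon Y^{-1}\to E\times_{X^0}E'\big)$ and arrows $(\kappa,\kappa')$, $(0,\iota')$, $\sigma=\sigma'$, $\rho+\rho'$; a scalar $r\in K$ acts by composition with the strict morphism $(r,r)$. A commutative square $(f^{-1},f^0)\colon \mathbb X\to\mathbb Y$ defines the strict morphism with middle object $X^0\oplus Y^{-1}$, $\kappa=(d_X,-f^{-1})$, $\iota=(0,\mathrm{id})$, $\sigma=\mathrm{pr}_1$, $\rho=f^0+d_Y$. Let $\mathfrak{Ch}(\mathsf B)$ be the DG category of unbounded cochain complexes in the $K$-linear category $\mathsf B$, with the usual Hom complexes and $d(g)=\delta\circ g-(-1)^{|g|}g\circ\delta$. \textbf{The DG category $\mathfrak{Ch}(\mathsf A,\mathcal T,\mathcal F)$.} A decorated complex $(E^\bullet,M^\bullet)$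 is a cochain complex $E^\bullet$ in $\mathsf A$ with a subobject $M^n\subseteq E^n$ for every $n\in\mathbb Z$ (not necessarily a subcomplex). Let $H^{-1,n}$ and $H^{0,n}$ be the kernel and the cokernel of the map $M^n\to E^{n+1}/M^{n+1}$ induced by the differential. The objects of $\mathfrak{Ch}(\mathsf A,\mathcal T,\mathcal F)$ are the decorated complexes with $H^{-1,n}\in\mathcal F$ and $H^{0,n}\in\mathcal T$ for all $n$. Given two of them, $(E^\bullet,M^\bullet)$ and $(F^\bullet,N^\bullet)$, let $\mathfrak{hom}^k$ be the $K$-module of families $g=(g_n\colon E^n\to F^{n+k})_n$ such that both $g$ and $dg$ map $M^\bullet$ into $N^\bullet$, and let $\mathcal M^k\subseteq\mathfrak{hom}^k$ consist of the $g$ with $g_n(M^n)=0$ and $g_n(E^n)\subseteq N^{n+k}$ for all $n$. The Hom complex in $\mathfrak{Ch}(\mathsf A,\mathcal T,\mathcal F)$ is, in degree $k$, $\mathfrak{hom}^k/(\mathcal M^k+d\mathcal M^{k-1})$, with the induced differential and composition. Let $\mathcal S_{sis}$ be the class of (the degree $0$ classes of) chain maps that respect the decorations and induce isomorphisms on all $H^{-1,n}$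 and $H^{0,n}$. \textbf{The functor.} Every object $(E^\bullet,M^\bullet)$ of $\mathfrak{Ch}(\mathsf A,\mathcal T,\mathcal F)$ defines a complex $\mathfrak G(E^\bullet,M^\bullet)$ in $\mathsf B$ with terms $[M^n\to E^{n+1}/M^{n+1}]$, whose $n$-th differential is the butterfly with middle object $E^{n+1}$ and arrows $\kappa=\delta|_{M^n}$, $\iota=(M^{n+1}\subseteq E^{n+1})$, $\sigma=(E^{n+1}\to E^{n+1}/M^{n+1})$ and $\rho=(E^{n+1}\xrightarrow{\delta}E^{n+2}\to E^{n+2}/M^{n+2})$. The object is called semi-projective (resp. semi-injective) if all $E^n/M^n$ are projective (resp. all $M^n$ are injective) in $\mathsf A$, that is, if the terms $[X^{-1}\to X^0]$ of $\mathfrak G(E^\bullet,M^\bullet)$ have projective $X^0$ (resp. injective $X^{-1}$). \textbf{Proposition.} There is a DG functor $\mathfrak G\colon\mathfrak{Ch}(\mathsf A,\mathcal T,\mathcal F)\to\mathfrak{Ch}(\mathsf B)$, given on objects as above and sending the class of $g\in\mathfrak{hom}^k$ to the family of strict morphisms $\big((-1)^kg_n|_{M^n},\,\overline{g_{n+1}}\big)\colon[M^n\to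 E^{n+1}/M^{n+1}]\to[N^{n+k}\to F^{n+k+1}/N^{n+k+1}]$. If $\mathsf A$ has enough projectives or enough injectives, then $\mathfrak G$ is a derived equivalence of DG categories with respect to $\mathcal S_{sis}$, in the following sense. Suppose that $\mathsf A$ has enough projectives. Then: \begin{enumerate} \item a closed morphism $s$ of degree $0$ of $\mathfrak{Ch}(\mathsf A,\mathcal T,\mathcal F)$ belongs to $\mathcal S_{sis}$ if and only if $\mathfrak G(s)$ is an isomorphism; \item every object $X$ of $\mathfrak{Ch}(\mathsf A,\mathcal T,\mathcal F)$ has a semi-projective resolution, that is, a morphism $p\colon P\to X$ in $\mathcal S_{sis}$ with $P$ semi-projective; given two such resolutions $P,P'$ of $X$, there is exactly one degree $0$ morphism $P'\to P$ over $X$, and it is a (closed) isomorphism; \item if $P$ is semi-projective, then $\mathfrak{Hom}(P,-)$ sends every morphism in $\mathcal S_{sis}$ to an isomorphism of complexes; so $\mathfrak{RHom}(X,Y):=\mathfrak{Hom}(P,Y)$ is well defined; \item for every semi-projective resolution $p\colon P\to X$ and every $Y$ there is an isomorphism of complexes of $K$-modules $e\colon\mathfrak{RHom}(X,Y)=\mathfrak{Hom}(P,Y)\to\mathfrak{Hom}_{\mathfrak{Ch}(\mathsf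 B)}(\mathfrak G X,\mathfrak G Y)$ with $e(f)\circ\mathfrak G(p)=\mathfrak G(f)$; \item every object of $\mathfrak{Ch}(\mathsf B)$ is isomorphic, through a closed morphism of degree $0$, to some $\mathfrak G X$; and $\mathfrak G$ restricts to a DG equivalence (bijective on Hom complexes, essentially surjective up to closed isomorphisms of degree $0$) from the full DG subcategory of the semi-projective objects to $\mathfrak{Ch}(\mathsf B)$. \end{enumerate} Suppose that $\mathsf A$ has enough injectives. Then the dual statements hold, with semi-injective resolutions $q\colon Y\to I$ in $\mathcal S_{sis}$, with $\mathfrak{RHom}(X,Y):=\mathfrak{Hom}(X,I)$ and $\mathfrak G(q)\circ e(f)=\mathfrak G(f)$ in item 4. -/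

import Mathlib

open CategoryTheory CategoryTheory.Limits

universe w v u

namespace Tilting

set_option linter.unusedSectionVars false
set_option linter.unusedSimpArgs false
set_option linter.checkUnivs false

variable {A : Type u} [Category.{v} A] [Abelian A]

/-- A two-term complex `[left → right]`, with `left` in degree `-1` and `right` in degree `0`. -/
structure TwoTerm (A : Type u) [Category.{v} A] where
  left : A
  right : A
  d : left ⟶ right

/-- A morphism of two-term complexes (a commutative square). -/
@[ext]
structure StrictHom (X Y : TwoTerm A) where
  left : X.left ⟶ Y.left
  right : X.right ⟶ Y.right
  comm : left ≫ Y.d = X.d ≫ right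

/-- The identity, the composition, the zero, the sum and the multiplication by a scalar, for strict
morphisms. -/
def StrictHom.id (X : TwoTerm A) : StrictHom X X := ⟨𝟙 _, 𝟙 _, by simp⟩

def StrictHom.comp {X Y Z : TwoTerm A} (f : StrictHom X Y) (g : StrictHom Y Z) : StrictHom X Z :=
  ⟨f.left ≫ g.left, f.right ≫ g.right, by
    rw [Category.assoc, g.comm, ← Category.assoc, f.comm, Category.assoc]⟩

def StrictHom.zero (X Y : TwoTerm A) : StrictHom X Y := ⟨0, 0, by simp⟩

def StrictHom.add {X Y : TwoTerm A} (f g : StrictHom X Y) : StrictHom X Y :=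
  ⟨f.left + g.left, f.right + g.right, by simp [f.comm, g.comm]⟩

def StrictHom.smulId {K : Type w} [CommRing K] [Linear K A] (r : K) (X : TwoTerm A) :
    StrictHom X X :=
  ⟨r • 𝟙 _, r • 𝟙 _, by simp⟩

section

variable {X Y Z : TwoTerm A} (f g : StrictHom X Y) (h : StrictHom Y Z)

@[simp] theorem StrictHom.id_left : (StrictHom.id X).left = 𝟙 _ := rfl
@[simp] theorem StrictHom.id_right : (StrictHom.id X).right = 𝟙 _ := rfl
@[simp] theorem StrictHom.comp_left : (f.comp h).left = f.left ≫ h.left := rfl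
@[simp] theorem StrictHom.comp_right : (f.comp h).right = f.right ≫ h.right := rfl
@[simp] theorem StrictHom.zero_left : (StrictHom.zero X Y).left = 0 := rfl
@[simp] theorem StrictHom.zero_right : (StrictHom.zero X Y).right = 0 := rfl
@[simp] theorem StrictHom.add_left : (f.add g).left = f.left + g.left := rfl
@[simp] theorem StrictHom.add_right : (f.add g).right = f.right + g.right := rfl
@[simp] theorem StrictHom.smulId_left {K : Type w} [CommRing K] [Linear K A] (r : K) :
    (StrictHom.smulId r X).left = r • 𝟙 _ := rfl
@[simp] theorem StrictHom.smulId_right {K : Type w} [CommRing K] [Linear K A] (r : K) :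
    (StrictHom.smulId r X).right = r • 𝟙 _ := rfl

end

/-- A butterfly from `X` to `Y`: a diagram
`X⁻¹ --κ--> E <--ι-- Y⁻¹`, `X⁰ <--σ-- E --ρ--> Y⁰` such that the two triangles with the
differentials of `X` and `Y` commute, both diagonals compose to zero, and the diagonal
`Y⁻¹ → E → X⁰` is short exact. -/
structure Butterfly (X Y : TwoTerm A) where
  E : A
  κ : X.left ⟶ E
  ι : Y.left ⟶ E
  σ : E ⟶ X.right
  ρ : E ⟶ Y.right
  κσ : κ ≫ σ = X.d
  ιρ : ι ≫ ρ = Y.d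
  κρ : κ ≫ ρ = 0
  ισ : ι ≫ σ = 0
  exact : (ShortComplex.mk ι σ ισ).ShortExact

namespace Butterfly

attribute [simp] κσ ιρ κρ ισ
attribute [local simp] pullback.lift_fst pullback.lift_snd pullback.lift_fst_assoc
  pullback.lift_snd_assoc

section

variable {X Y Z W : TwoTerm A}

@[simp] theorem κσ_assoc (P : Butterfly X Y) {T : A} (h : X.right ⟶ T) :
    P.κ ≫ P.σ ≫ h = X.d ≫ h := by rw [← Category.assoc, P.κσ]

@[simp] theorem ιρ_assoc (P : Butterfly X Y) {T : A} (h : Y.right ⟶ T) :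
    P.ι ≫ P.ρ ≫ h = Y.d ≫ h := by rw [← Category.assoc, P.ιρ]

@[simp] theorem κρ_assoc (P : Butterfly X Y) {T : A} (h : Y.right ⟶ T) :
    P.κ ≫ P.ρ ≫ h = 0 := by rw [← Category.assoc, P.κρ, zero_comp]

@[simp] theorem ισ_assoc (P : Butterfly X Y) {T : A} (h : X.right ⟶ T) :
    P.ι ≫ P.σ ≫ h = 0 := by rw [← Category.assoc, P.ισ, zero_comp]

instance (P : Butterfly X Y) : Mono P.ι := P.exact.mono_f
instance (P : Butterfly X Y) : Epi P.σ := P.exact.epi_g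

theorem exists_ι (P : Butterfly X Y) {T : A} (x : T ⟶ P.E) (hx : x ≫ P.σ = 0) :
    ∃ y : T ⟶ Y.left, y ≫ P.ι = x :=
  ⟨P.exact.exact.lift x hx, P.exact.exact.lift_f x hx⟩

/-- Isomorphism of butterflies: an isomorphism of the middle objects commuting with the four
arrows. -/
def Iso (P P' : Butterfly X Y) : Prop :=
  ∃ e : P.E ≅ P'.E, P.κ ≫ e.hom = P'.κ ∧ P.ι ≫ e.hom = P'.ι ∧
    e.hom ≫ P'.σ = P.σ ∧ e.hom ≫ P'.ρ = P.ρ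

theorem Iso.of_hom {P P' : Butterfly X Y} (f : P.E ⟶ P'.E) (hκ : P.κ ≫ f = P'.κ)
    (hι : P.ι ≫ f = P'.ι) (hσ : f ≫ P'.σ = P.σ) (hρ : f ≫ P'.ρ = P.ρ) : Iso P P' := by
  let φ : ShortComplex.mk P.ι P.σ P.ισ ⟶ ShortComplex.mk P'.ι P'.σ P'.ισ :=
    { τ₁ := 𝟙 _, τ₂ := f, τ₃ := 𝟙 _
      comm₁₂ := by simp [hι]
      comm₂₃ := by simp [hσ] }
  have : IsIso φ.τ₁ := inferInstanceAs (IsIso (𝟙 _))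
  have : IsIso φ.τ₃ := inferInstanceAs (IsIso (𝟙 _))
  have : IsIso f := ShortComplex.isIso₂_of_shortExact_of_isIso₁₃ φ P.exact P'.exact
  exact ⟨asIso f, hκ, hι, hσ, hρ⟩

theorem Iso.refl (P : Butterfly X Y) : Iso P P := ⟨CategoryTheory.Iso.refl _, by simp⟩

theorem Iso.symm {P P' : Butterfly X Y} : Iso P P' → Iso P' P := by
  rintro ⟨e, h₁, h₂, h₃, h₄⟩
  exact ⟨e.symm, by simp [← h₁], by simp [← h₂], by simp [← h₃], by simp [← h₄]⟩

theorem Iso.trans {P P' P'' : Butterfly X Y} : Iso P P' → Iso P' P'' → Iso P P'' := by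
  rintro ⟨e, h₁, h₂, h₃, h₄⟩ ⟨e', h₁', h₂', h₃', h₄'⟩
  refine ⟨e ≪≫ e', ?_, ?_, ?_, ?_⟩
  · simp [← h₁', ← h₁]
  · simp [← h₂', ← h₂]
  · simp [← h₃, ← h₃']
  · simp [← h₄, ← h₄']

/-- A way to show that two butterflies are isomorphic: an object `L` that maps onto the first
middle object and to the second one, compatibly with everything. -/
theorem Iso.of_span {P P' : Butterfly X Y} {L : A} (a : L ⟶ P.E) (b : L ⟶ P'.E) (ha : Epi a)
    (hker : ∀ {T : A} (x : T ⟶ L), x ≫ a = 0 →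
      ∃ (T' : A) (π : T' ⟶ T), Epi π ∧ π ≫ x ≫ b = 0)
    (k : X.left ⟶ L) (i : Y.left ⟶ L) (hκ : k ≫ a = P.κ) (hκ' : k ≫ b = P'.κ)
    (hι : i ≫ a = P.ι) (hι' : i ≫ b = P'.ι)
    (hσ : a ≫ P.σ = b ≫ P'.σ) (hρ : a ≫ P.ρ = b ≫ P'.ρ) : Iso P P' := by
  have h0 : kernel.ι a ≫ b = 0 := by
    obtain ⟨T', π, hπ, h⟩ := hker (kernel.ι a) (kernel.condition a)
    rw [← cancel_epi π, h, comp_zero]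
  have hf : a ≫ Abelian.epiDesc a b h0 = b := Abelian.comp_epiDesc a b h0
  refine Iso.of_hom (Abelian.epiDesc a b h0) ?_ ?_ ?_ ?_
  · rw [← hκ, Category.assoc, hf, hκ']
  · rw [← hι, Category.assoc, hf, hι']
  · rw [← cancel_epi a, ← Category.assoc, hf, hσ]
  · rw [← cancel_epi a, ← Category.assoc, hf, hρ]

/-- The butterfly of a strict morphism, with middle object `X⁰ ⊕ Y⁻¹`. -/
noncomputable def ofStrict (f : StrictHom X Y) : Butterfly X Y where
  E := X.right ⊞ Y.left
  κ := biprod.lift X.d (-f.left)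
  ι := biprod.inr
  σ := biprod.fst
  ρ := biprod.desc f.right Y.d
  κσ := by simp
  ιρ := by simp
  κρ := by simp [f.comm]
  ισ := by simp
  exact := ShortComplex.Splitting.shortExact
    { r := biprod.snd, s := biprod.inl, f_r := by simp, s_g := by simp
      id := by rw [add_comm]; exact biprod.total }

/-! ### Composition -/

/-- `Y⁻¹ → E ×_{Y⁰} F`, the diagonal map. -/
noncomputable def compDiag (P : Butterfly X Y) (Q : Butterfly Y Z) : Y.left ⟶ pullback P.ρ Q.σ :=
  pullback.lift P.ι Q.κ (by simp)

@[simp] theorem compDiag_fst (P : Butterfly X Y) (Q : Butterfly Y Z) :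
    compDiag P Q ≫ pullback.fst _ _ = P.ι := pullback.lift_fst _ _ _
@[simp] theorem compDiag_snd (P : Butterfly X Y) (Q : Butterfly Y Z) :
    compDiag P Q ≫ pullback.snd _ _ = Q.κ := pullback.lift_snd _ _ _

/-- The middle object of the composition. -/
noncomputable abbrev compE (P : Butterfly X Y) (Q : Butterfly Y Z) : A := cokernel (compDiag P Q)

noncomputable abbrev compπ (P : Butterfly X Y) (Q : Butterfly Y Z) :
    pullback P.ρ Q.σ ⟶ compE P Q := cokernel.π _

/-- Elements that vanish in a cokernel come locally from the source. -/
theorem cokernel_zero {U V T : A} (f : U ⟶ V) (x : T ⟶ V) (hx : x ≫ cokernel.π f = 0) :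
    ∃ (T' : A) (π : T' ⟶ T) (_ : Epi π) (y : T' ⟶ U), π ≫ x = y ≫ f :=
  (ShortComplex.exact_cokernel f).exact_up_to_refinements x hx

theorem comp_exact (P : Butterfly X Y) (Q : Butterfly Y Z)
    (w : (pullback.lift 0 Q.ι (by simp) ≫ compπ P Q : Z.left ⟶ _) ≫
      cokernel.desc (compDiag P Q) (pullback.fst _ _ ≫ P.σ) (by
        rw [← Category.assoc, compDiag_fst, P.ισ]) = 0) :
    (ShortComplex.mk _ _ w).ShortExact := by
  refine { exact := ?_, mono_f := ?_, epi_g := ?_ }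
  · rw [ShortComplex.exact_iff_exact_up_to_refinements]
    intro T x hx
    dsimp at x hx ⊢
    obtain ⟨T₁, π₁, _, l, hl⟩ := surjective_up_to_refinements_of_epi (compπ P Q) x
    have h₁ : (l ≫ pullback.fst _ _) ≫ P.σ = 0 := by
      have := π₁ ≫= hx
      rw [← Category.assoc, hl] at this
      simpa using this
    obtain ⟨y, hy⟩ := P.exists_ι _ h₁
    have h₂ : (l ≫ pullback.snd _ _ - y ≫ Q.κ) ≫ Q.σ = 0 := by
      rw [Preadditive.sub_comp, Category.assoc, ← pullback.condition, ← Category.assoc, ← hy]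
      simp
    obtain ⟨z, hz⟩ := Q.exists_ι _ h₂
    refine ⟨T₁, π₁, inferInstance, z, ?_⟩
    rw [hl, ← Category.assoc, ← sub_eq_zero, ← Preadditive.sub_comp]
    have : l - z ≫ pullback.lift 0 Q.ι (by simp) = y ≫ compDiag P Q := by
      apply pullback.hom_ext
      · simp [hy]
      · simp [hz]
    rw [this, Category.assoc, cokernel.condition, comp_zero]
  · rw [Preadditive.mono_iff_cancel_zero]
    intro T z hz
    dsimp at z hz
    rw [← Category.assoc] at hz
    obtain ⟨T₁, π₁, _, y, hy⟩ := cokernel_zero _ _ hz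
    have h₁ := hy =≫ pullback.fst _ _
    have h₂ := hy =≫ pullback.snd _ _
    simp only [Category.assoc, pullback.lift_fst, comp_zero, compDiag_fst] at h₁
    simp only [Category.assoc, pullback.lift_snd, compDiag_snd] at h₂
    rw [eq_comm, ← zero_comp (X := T₁) (f := P.ι), cancel_mono] at h₁
    rw [h₁, zero_comp, ← Category.assoc, ← zero_comp (X := T₁) (f := Q.ι), cancel_mono] at h₂
    rwa [← cancel_epi π₁, comp_zero]
  · dsimp
    have : Epi (compπ P Q ≫ cokernel.desc (compDiag P Q) (pullback.fst _ _ ≫ P.σ) (by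
        rw [← Category.assoc, compDiag_fst, P.ισ])) := by
      rw [cokernel.π_desc]; infer_instance
    exact epi_of_epi (compπ P Q) _

/-- The composition of two butterflies, with middle object
`coker (Y⁻¹ → E ×_{Y⁰} F)`. -/
noncomputable def comp (P : Butterfly X Y) (Q : Butterfly Y Z) : Butterfly X Z where
  E := compE P Q
  κ := pullback.lift P.κ 0 (by simp) ≫ compπ P Q
  ι := pullback.lift 0 Q.ι (by simp) ≫ compπ P Q
  σ := cokernel.desc _ (pullback.fst _ _ ≫ P.σ) (by rw [← Category.assoc, compDiag_fst, P.ισ])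
  ρ := cokernel.desc _ (pullback.snd _ _ ≫ Q.ρ) (by rw [← Category.assoc, compDiag_snd, Q.κρ])
  κσ := by simp
  ιρ := by simp
  κρ := by simp
  ισ := by simp
  exact := comp_exact P Q _

/-! ### Addition -/

/-- `Y⁻¹ → E ×_{X⁰} E'`, the antidiagonal map. -/
noncomputable def addDiag (P P' : Butterfly X Y) : Y.left ⟶ pullback P.σ P'.σ :=
  pullback.lift P.ι (-P'.ι) (by simp)

@[simp] theorem addDiag_fst (P P' : Butterfly X Y) :
    addDiag P P' ≫ pullback.fst _ _ = P.ι := pullback.lift_fst _ _ _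
@[simp] theorem addDiag_snd (P P' : Butterfly X Y) :
    addDiag P P' ≫ pullback.snd _ _ = -P'.ι := pullback.lift_snd _ _ _

noncomputable abbrev addE (P P' : Butterfly X Y) : A := cokernel (addDiag P P')

noncomputable abbrev addπ (P P' : Butterfly X Y) :
    pullback P.σ P'.σ ⟶ addE P P' := cokernel.π _

theorem add_exact (P P' : Butterfly X Y)
    (w : (pullback.lift 0 P'.ι (by simp) ≫ addπ P P' : Y.left ⟶ _) ≫
      cokernel.desc (addDiag P P') (pullback.fst _ _ ≫ P.σ) (by
        rw [← Category.assoc, addDiag_fst, P.ισ]) = 0) :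
    (ShortComplex.mk _ _ w).ShortExact := by
  refine { exact := ?_, mono_f := ?_, epi_g := ?_ }
  · rw [ShortComplex.exact_iff_exact_up_to_refinements]
    intro T x hx
    dsimp at x hx ⊢
    obtain ⟨T₁, π₁, _, l, hl⟩ := surjective_up_to_refinements_of_epi (addπ P P') x
    have h₁ : (l ≫ pullback.fst _ _) ≫ P.σ = 0 := by
      have := π₁ ≫= hx
      rw [← Category.assoc, hl] at this
      simpa using this
    obtain ⟨y, hy⟩ := P.exists_ι _ h₁
    have h₂ : (l ≫ pullback.snd _ _ + y ≫ P'.ι) ≫ P'.σ = 0 := by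
      rw [Preadditive.add_comp, Category.assoc, ← pullback.condition, ← Category.assoc, ← hy]
      simp
    obtain ⟨z, hz⟩ := P'.exists_ι _ h₂
    refine ⟨T₁, π₁, inferInstance, z, ?_⟩
    rw [hl, ← Category.assoc, ← sub_eq_zero, ← Preadditive.sub_comp]
    have : l - z ≫ pullback.lift 0 P'.ι (by simp) = y ≫ addDiag P P' := by
      apply pullback.hom_ext
      · simp [hy]
      · simp [hz]
    rw [this, Category.assoc, cokernel.condition, comp_zero]
  · rw [Preadditive.mono_iff_cancel_zero]
    intro T z hz
    dsimp at z hz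
    rw [← Category.assoc] at hz
    obtain ⟨T₁, π₁, _, y, hy⟩ := cokernel_zero _ _ hz
    have h₁ := hy =≫ pullback.fst _ _
    have h₂ := hy =≫ pullback.snd _ _
    simp only [Category.assoc, pullback.lift_fst, comp_zero, addDiag_fst] at h₁
    simp only [Category.assoc, pullback.lift_snd, addDiag_snd] at h₂
    rw [eq_comm, ← zero_comp (X := T₁) (f := P.ι), cancel_mono] at h₁
    rw [h₁, zero_comp, ← Category.assoc, ← zero_comp (X := T₁) (f := P'.ι), cancel_mono] at h₂
    rwa [← cancel_epi π₁, comp_zero]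
  · dsimp
    have : Epi (addπ P P' ≫ cokernel.desc (addDiag P P') (pullback.fst _ _ ≫ P.σ) (by
        rw [← Category.assoc, addDiag_fst, P.ισ])) := by
      rw [cokernel.π_desc]; infer_instance
    exact epi_of_epi (addπ P P') _

/-- The sum of two butterflies, with middle object the cokernel of the antidiagonal map
`Y⁻¹ → E ×_{X⁰} E'`. -/
noncomputable def add (P P' : Butterfly X Y) : Butterfly X Y where
  E := addE P P'
  κ := pullback.lift P.κ P'.κ (by simp) ≫ addπ P P'
  ι := pullback.lift 0 P'.ι (by simp) ≫ addπ P P'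
  σ := cokernel.desc _ (pullback.fst _ _ ≫ P.σ) (by rw [← Category.assoc, addDiag_fst, P.ισ])
  ρ := cokernel.desc _ (pullback.fst _ _ ≫ P.ρ + pullback.snd _ _ ≫ P'.ρ) (by
    rw [Preadditive.comp_add, ← Category.assoc, ← Category.assoc, addDiag_fst, addDiag_snd]
    simp)
  κσ := by simp
  ιρ := by simp
  κρ := by simp
  ισ := by simp
  exact := add_exact P P' _

/-- The opposite of a butterfly: change the signs of `ι` and `ρ`. -/
def neg (P : Butterfly X Y) : Butterfly X Y where
  E := P.E
  κ := P.κ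
  ι := -P.ι
  σ := P.σ
  ρ := -P.ρ
  κσ := by simp
  ιρ := by simp
  κρ := by simp
  ισ := by simp
  exact := ShortComplex.shortExact_of_iso (ShortComplex.isoMk (S₁ := ShortComplex.mk P.ι P.σ P.ισ)
    (S₂ := ShortComplex.mk (-P.ι) P.σ (by simp))
    ⟨-𝟙 _, -𝟙 _, by simp, by simp⟩ (CategoryTheory.Iso.refl _) (CategoryTheory.Iso.refl _)
    (by simp) (by simp)) P.exact

/-! ### Generalized elements of the middle objects -/

/-- The projection to the middle object. -/
noncomputable def compq (P : Butterfly X Y) (Q : Butterfly Y Z) : pullback P.ρ Q.σ ⟶ (comp P Q).E :=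
  cokernel.π (compDiag P Q)

instance (P : Butterfly X Y) (Q : Butterfly Y Z) : Epi (compq P Q) := inferInstanceAs (Epi (cokernel.π (compDiag P Q)))

@[simp] theorem compDiag_compq (P : Butterfly X Y) (Q : Butterfly Y Z) : compDiag P Q ≫ compq P Q = 0 :=
  cokernel.condition _

@[simp] theorem compq_σ (P : Butterfly X Y) (Q : Butterfly Y Z) :
    compq P Q ≫ (comp P Q).σ = pullback.fst _ _ ≫ P.σ := cokernel.π_desc _ _ _

@[simp] theorem compq_ρ (P : Butterfly X Y) (Q : Butterfly Y Z) :
    compq P Q ≫ (comp P Q).ρ = pullback.snd _ _ ≫ Q.ρ := cokernel.π_desc _ _ _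

@[simp] theorem compq_σ_assoc (P : Butterfly X Y) (Q : Butterfly Y Z) {T : A} (h : X.right ⟶ T) :
    compq P Q ≫ (comp P Q).σ ≫ h = pullback.fst _ _ ≫ P.σ ≫ h := by
  rw [← Category.assoc, compq_σ, Category.assoc]

/-- The class in the middle object of a composition of a pair of generalized elements. -/
noncomputable def compMk {P : Butterfly X Y} {Q : Butterfly Y Z} {T : A} (x : T ⟶ P.E) (y : T ⟶ Q.E)
    (h : x ≫ P.ρ = y ≫ Q.σ) : T ⟶ (comp P Q).E :=
  pullback.lift x y h ≫ compq P Q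

theorem comp_κ (P : Butterfly X Y) (Q : Butterfly Y Z) :
    (comp P Q).κ = compMk P.κ 0 (by simp) := rfl

theorem comp_ι (P : Butterfly X Y) (Q : Butterfly Y Z) :
    (comp P Q).ι = compMk 0 Q.ι (by simp) := rfl

section

variable {P : Butterfly X Y} {Q : Butterfly Y Z} {T T' : A}

@[simp] theorem compMk_σ (x : T ⟶ P.E) (y : T ⟶ Q.E) (h : x ≫ P.ρ = y ≫ Q.σ) :
    compMk x y h ≫ (comp P Q).σ = x ≫ P.σ := by
  simp [compMk]

@[simp] theorem compMk_ρ (x : T ⟶ P.E) (y : T ⟶ Q.E) (h : x ≫ P.ρ = y ≫ Q.σ) :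
    compMk x y h ≫ (comp P Q).ρ = y ≫ Q.ρ := by
  simp [compMk]

@[simp] theorem precomp_compMk (f : T' ⟶ T) (x : T ⟶ P.E) (y : T ⟶ Q.E)
    (h : x ≫ P.ρ = y ≫ Q.σ) :
    f ≫ compMk x y h = compMk (f ≫ x) (f ≫ y) (by simp [h]) := by
  simp only [compMk]
  rw [← Category.assoc f]
  exact congrArg (· ≫ compq P Q) (pullback.hom_ext (by simp) (by simp))

theorem compMk_add (x x' : T ⟶ P.E) (y y' : T ⟶ Q.E)
    (h : x ≫ P.ρ = y ≫ Q.σ) (h' : x' ≫ P.ρ = y' ≫ Q.σ) :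
    compMk x y h + compMk x' y' h' = compMk (x + x') (y + y') (by simp [h, h']) := by
  simp only [compMk]
  rw [← Preadditive.add_comp]
  exact congrArg (· ≫ compq P Q) (pullback.hom_ext (by simp) (by simp))

theorem compMk_neg (x : T ⟶ P.E) (y : T ⟶ Q.E) (h : x ≫ P.ρ = y ≫ Q.σ) :
    -compMk x y h = compMk (-x) (-y) (by simp [h]) := by
  simp only [compMk]
  rw [← Preadditive.neg_comp]
  exact congrArg (· ≫ compq P Q) (pullback.hom_ext (by simp) (by simp))

theorem comp_surj (t : T ⟶ (comp P Q).E) :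
    ∃ (T' : A) (π : T' ⟶ T) (_ : Epi π) (x : T' ⟶ P.E) (y : T' ⟶ Q.E) (h : x ≫ P.ρ = y ≫ Q.σ),
      π ≫ t = compMk x y h := by
  obtain ⟨T', π, hπ, l, hl⟩ := surjective_up_to_refinements_of_epi (compq P Q) t
  refine ⟨T', π, hπ, l ≫ pullback.fst _ _, l ≫ pullback.snd _ _, by simp [pullback.condition], ?_⟩
  rw [hl]
  exact congrArg (· ≫ compq P Q) (pullback.hom_ext (by simp) (by simp))

theorem compMk_eq_zero_iff (x : T ⟶ P.E) (y : T ⟶ Q.E) (h : x ≫ P.ρ = y ≫ Q.σ) :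
    compMk x y h = 0 ↔ ∃ t : T ⟶ Y.left, t ≫ P.ι = x ∧ t ≫ Q.κ = y := by
  constructor
  · intro h₀
    have hσ : x ≫ P.σ = 0 := by rw [← compMk_σ x y h, h₀, zero_comp]
    obtain ⟨t, ht⟩ := P.exists_ι _ hσ
    refine ⟨t, ht, ?_⟩
    obtain ⟨T', π, hπ, t', ht'⟩ := cokernel_zero _ _ h₀
    have h₁ := ht' =≫ pullback.fst _ _
    have h₂ := ht' =≫ pullback.snd _ _
    simp only [Category.assoc, compDiag_fst, compDiag_snd, pullback.lift_fst,
      pullback.lift_snd] at h₁ h₂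
    have : π ≫ t = t' := by rw [← cancel_mono P.ι, ← h₁, Category.assoc, ht]
    rw [← cancel_epi π, h₂, ← this, Category.assoc]
  · rintro ⟨t, rfl, rfl⟩
    have : pullback.lift (t ≫ P.ι) (t ≫ Q.κ) h = t ≫ compDiag P Q :=
      pullback.hom_ext (by simp) (by simp)
    unfold compMk
    rw [this, Category.assoc, compDiag_compq, comp_zero]

@[simp] theorem compMk_zero (h : (0 : T ⟶ P.E) ≫ P.ρ = (0 : T ⟶ Q.E) ≫ Q.σ) :
    compMk (0 : T ⟶ P.E) (0 : T ⟶ Q.E) h = 0 :=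
  (compMk_eq_zero_iff _ _ _).2 ⟨0, by simp, by simp⟩

end

/-- The projection to the middle object. -/
noncomputable def addq (P P' : Butterfly X Y) : pullback P.σ P'.σ ⟶ (add P P').E :=
  cokernel.π (addDiag P P')

instance (P P' : Butterfly X Y) : Epi (addq P P') := inferInstanceAs (Epi (cokernel.π (addDiag P P')))

@[simp] theorem addDiag_addq (P P' : Butterfly X Y) : addDiag P P' ≫ addq P P' = 0 :=
  cokernel.condition _

@[simp] theorem addq_σ (P P' : Butterfly X Y) :
    addq P P' ≫ (add P P').σ = pullback.fst _ _ ≫ P.σ := cokernel.π_desc _ _ _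

@[simp] theorem addq_ρ (P P' : Butterfly X Y) :
    addq P P' ≫ (add P P').ρ = pullback.fst _ _ ≫ P.ρ + pullback.snd _ _ ≫ P'.ρ := cokernel.π_desc _ _ _

@[simp] theorem addq_σ_assoc (P P' : Butterfly X Y) {T : A} (h : X.right ⟶ T) :
    addq P P' ≫ (add P P').σ ≫ h = pullback.fst _ _ ≫ P.σ ≫ h := by
  rw [← Category.assoc, addq_σ, Category.assoc]

/-- The class in the middle object of a sum of a pair of generalized elements. -/
noncomputable def addMk {P P' : Butterfly X Y} {T : A} (x : T ⟶ P.E) (y : T ⟶ P'.E)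
    (h : x ≫ P.σ = y ≫ P'.σ) : T ⟶ (add P P').E :=
  pullback.lift x y h ≫ addq P P'

theorem add_κ (P P' : Butterfly X Y) :
    (add P P').κ = addMk P.κ P'.κ (by simp) := rfl

theorem add_ι (P P' : Butterfly X Y) :
    (add P P').ι = addMk 0 P'.ι (by simp) := rfl

section

variable {P P' : Butterfly X Y} {T T' : A}

@[simp] theorem addMk_σ (x : T ⟶ P.E) (y : T ⟶ P'.E) (h : x ≫ P.σ = y ≫ P'.σ) :
    addMk x y h ≫ (add P P').σ = x ≫ P.σ := by
  simp [addMk]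

@[simp] theorem addMk_ρ (x : T ⟶ P.E) (y : T ⟶ P'.E) (h : x ≫ P.σ = y ≫ P'.σ) :
    addMk x y h ≫ (add P P').ρ = x ≫ P.ρ + y ≫ P'.ρ := by
  simp [addMk]

@[simp] theorem precomp_addMk (f : T' ⟶ T) (x : T ⟶ P.E) (y : T ⟶ P'.E)
    (h : x ≫ P.σ = y ≫ P'.σ) :
    f ≫ addMk x y h = addMk (f ≫ x) (f ≫ y) (by simp [h]) := by
  simp only [addMk]
  rw [← Category.assoc f]
  exact congrArg (· ≫ addq P P') (pullback.hom_ext (by simp) (by simp))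

theorem addMk_add (x x' : T ⟶ P.E) (y y' : T ⟶ P'.E)
    (h : x ≫ P.σ = y ≫ P'.σ) (h' : x' ≫ P.σ = y' ≫ P'.σ) :
    addMk x y h + addMk x' y' h' = addMk (x + x') (y + y') (by simp [h, h']) := by
  simp only [addMk]
  rw [← Preadditive.add_comp]
  exact congrArg (· ≫ addq P P') (pullback.hom_ext (by simp) (by simp))

theorem addMk_neg (x : T ⟶ P.E) (y : T ⟶ P'.E) (h : x ≫ P.σ = y ≫ P'.σ) :
    -addMk x y h = addMk (-x) (-y) (by simp [h]) := by
  simp only [addMk]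
  rw [← Preadditive.neg_comp]
  exact congrArg (· ≫ addq P P') (pullback.hom_ext (by simp) (by simp))

theorem add_surj (t : T ⟶ (add P P').E) :
    ∃ (T' : A) (π : T' ⟶ T) (_ : Epi π) (x : T' ⟶ P.E) (y : T' ⟶ P'.E) (h : x ≫ P.σ = y ≫ P'.σ),
      π ≫ t = addMk x y h := by
  obtain ⟨T', π, hπ, l, hl⟩ := surjective_up_to_refinements_of_epi (addq P P') t
  refine ⟨T', π, hπ, l ≫ pullback.fst _ _, l ≫ pullback.snd _ _, by simp [pullback.condition], ?_⟩
  rw [hl]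
  exact congrArg (· ≫ addq P P') (pullback.hom_ext (by simp) (by simp))

theorem addMk_eq_zero_iff (x : T ⟶ P.E) (y : T ⟶ P'.E) (h : x ≫ P.σ = y ≫ P'.σ) :
    addMk x y h = 0 ↔ ∃ t : T ⟶ Y.left, t ≫ P.ι = x ∧ -(t ≫ P'.ι) = y := by
  constructor
  · intro h₀
    have hσ : x ≫ P.σ = 0 := by rw [← addMk_σ x y h, h₀, zero_comp]
    obtain ⟨t, ht⟩ := P.exists_ι _ hσ
    refine ⟨t, ht, ?_⟩
    obtain ⟨T', π, hπ, t', ht'⟩ := cokernel_zero _ _ h₀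
    have h₁ := ht' =≫ pullback.fst _ _
    have h₂ := ht' =≫ pullback.snd _ _
    simp only [Category.assoc, addDiag_fst, addDiag_snd, pullback.lift_fst,
      pullback.lift_snd] at h₁ h₂
    have : π ≫ t = t' := by rw [← cancel_mono P.ι, ← h₁, Category.assoc, ht]
    rw [← cancel_epi π, h₂, ← this]
    simp
  · rintro ⟨t, rfl, rfl⟩
    have : pullback.lift (t ≫ P.ι) (-(t ≫ P'.ι)) h = t ≫ addDiag P P' :=
      pullback.hom_ext (by simp) (by simp)
    unfold addMk
    rw [this, Category.assoc, addDiag_addq, comp_zero]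

@[simp] theorem addMk_zero (h : (0 : T ⟶ P.E) ≫ P.σ = (0 : T ⟶ P'.E) ≫ P'.σ) :
    addMk (0 : T ⟶ P.E) (0 : T ⟶ P'.E) h = 0 :=
  (addMk_eq_zero_iff _ _ _).2 ⟨0, by simp, by simp⟩

end

section

variable (f : StrictHom X Y)

noncomputable def inS : X.right ⟶ (ofStrict f).E := biprod.inl

noncomputable def prS : (ofStrict f).E ⟶ Y.left := biprod.snd

@[simp] theorem inS_σ : inS f ≫ (ofStrict f).σ = 𝟙 _ := by simp [inS, ofStrict]
@[simp] theorem inS_ρ : inS f ≫ (ofStrict f).ρ = f.right := by simp [inS, ofStrict]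
@[simp] theorem ι_prS : (ofStrict f).ι ≫ prS f = 𝟙 _ := by simp [prS, ofStrict]
@[simp] theorem κ_prS : (ofStrict f).κ ≫ prS f = -f.left := by simp [prS, ofStrict]
@[simp] theorem ι_prS_assoc {T : A} (h : Y.left ⟶ T) : (ofStrict f).ι ≫ prS f ≫ h = h := by
  rw [← Category.assoc, ι_prS, Category.id_comp]
@[simp] theorem κ_prS_assoc {T : A} (h : Y.left ⟶ T) :
    (ofStrict f).κ ≫ prS f ≫ h = -f.left ≫ h := by
  rw [← Category.assoc, κ_prS, Preadditive.neg_comp]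
theorem totS : (ofStrict f).σ ≫ inS f + prS f ≫ (ofStrict f).ι = 𝟙 _ := biprod.total

theorem κ_eq : (ofStrict f).κ = X.d ≫ inS f - f.left ≫ (ofStrict f).ι := by
  rw [← Category.comp_id (ofStrict f).κ, ← totS, Preadditive.comp_add, ← Category.assoc,
    ← Category.assoc, κ_prS, κσ]
  simp [sub_eq_add_neg]

theorem ρ_eq : (ofStrict f).ρ = (ofStrict f).σ ≫ f.right + prS f ≫ Y.d := by
  rw [← Category.id_comp (ofStrict f).ρ, ← totS, Preadditive.add_comp]
  simp

end

theorem epi_of_surj {U V : A} (a : U ⟶ V) (h : ∀ {T : A} (t : T ⟶ V),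
    ∃ (T' : A) (π : T' ⟶ T) (_ : Epi π) (x : T' ⟶ U), π ≫ t = x ≫ a) : Epi a :=
  (epi_iff_surjective_up_to_refinements a).2 fun _ t => h t

/-- To show that a composition is isomorphic to a given butterfly. -/
theorem comp_iso_of {P : Butterfly X Y} {Q : Butterfly Y Z} {R : Butterfly X Z}
    (φ : pullback P.ρ Q.σ ⟶ R.E) (h₀ : compDiag P Q ≫ φ = 0)
    (hκ : pullback.lift P.κ 0 (by simp) ≫ φ = R.κ)
    (hι : pullback.lift 0 Q.ι (by simp) ≫ φ = R.ι)
    (hσ : φ ≫ R.σ = pullback.fst _ _ ≫ P.σ) (hρ : φ ≫ R.ρ = pullback.snd _ _ ≫ Q.ρ) :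
    Iso (comp P Q) R := by
  refine Iso.of_span (compMk (pullback.fst _ _) (pullback.snd _ _) pullback.condition) φ
    (epi_of_surj _ fun t => ?_) (fun x hx => ?_) (pullback.lift P.κ 0 (by simp))
    (pullback.lift 0 Q.ι (by simp)) ?_ hκ ?_ hι ?_ ?_
  · obtain ⟨T', π, hπ, x, y, h, e⟩ := comp_surj t
    exact ⟨T', π, hπ, pullback.lift x y h, by simp [e]⟩
  · rw [precomp_compMk, compMk_eq_zero_iff] at hx
    obtain ⟨t, h₁, h₂⟩ := hx
    refine ⟨_, 𝟙 _, inferInstance, ?_⟩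
    have : x = t ≫ compDiag P Q := pullback.hom_ext (by simp [h₁]) (by simp [h₂])
    rw [Category.id_comp, this, Category.assoc, h₀, comp_zero]
  · simp [comp_κ]
  · simp [comp_ι]
  · simp [hσ]
  · simp [hρ]

theorem add_iso_of {P P' R : Butterfly X Y}
    (φ : pullback P.σ P'.σ ⟶ R.E) (h₀ : addDiag P P' ≫ φ = 0)
    (hκ : pullback.lift P.κ P'.κ (by simp) ≫ φ = R.κ)
    (hι : pullback.lift 0 P'.ι (by simp) ≫ φ = R.ι)
    (hσ : φ ≫ R.σ = pullback.fst _ _ ≫ P.σ)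
    (hρ : φ ≫ R.ρ = pullback.fst _ _ ≫ P.ρ + pullback.snd _ _ ≫ P'.ρ) :
    Iso (add P P') R := by
  refine Iso.of_span (addMk (pullback.fst _ _) (pullback.snd _ _) pullback.condition) φ
    (epi_of_surj _ fun t => ?_) (fun x hx => ?_) (pullback.lift P.κ P'.κ (by simp))
    (pullback.lift 0 P'.ι (by simp)) ?_ hκ ?_ hι ?_ ?_
  · obtain ⟨T', π, hπ, x, y, h, e⟩ := add_surj t
    exact ⟨T', π, hπ, pullback.lift x y h, by simp [e]⟩
  · rw [precomp_addMk, addMk_eq_zero_iff] at hx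
    obtain ⟨t, h₁, h₂⟩ := hx
    refine ⟨_, 𝟙 _, inferInstance, ?_⟩
    have : x = t ≫ addDiag P P' := pullback.hom_ext (by simp [h₁]) (by simp [← h₂])
    rw [Category.id_comp, this, Category.assoc, h₀, comp_zero]
  · simp [add_κ]
  · simp [add_ι]
  · simp [hσ]
  · simp [hρ]

/-! ### The axioms, up to isomorphism of butterflies -/

theorem Iso.comp {P P' : Butterfly X Y} {Q Q' : Butterfly Y Z} (h : Iso P P') (h' : Iso Q Q') :
    Iso (P.comp Q) (P'.comp Q') := by
  obtain ⟨e, h₁, h₂, h₃, h₄⟩ := h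
  obtain ⟨e', h₁', h₂', h₃', h₄'⟩ := h'
  refine comp_iso_of (compMk (pullback.fst _ _ ≫ e.hom) (pullback.snd _ _ ≫ e'.hom)
    (by simp [h₄, h₃', pullback.condition])) ?_ ?_ ?_ ?_ ?_
  · rw [precomp_compMk, compMk_eq_zero_iff]
    exact ⟨𝟙 _, by simp [← h₂, ← Category.assoc], by simp [← h₁', ← Category.assoc]⟩
  · simp [comp_κ, h₁]
  · simp [comp_ι, h₂']
  · simp [h₃]
  · simp [h₄']

theorem Iso.add {P P' Q Q' : Butterfly X Y} (h : Iso P P') (h' : Iso Q Q') :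
    Iso (P.add Q) (P'.add Q') := by
  obtain ⟨e, h₁, h₂, h₃, h₄⟩ := h
  obtain ⟨e', h₁', h₂', h₃', h₄'⟩ := h'
  refine add_iso_of (addMk (pullback.fst _ _ ≫ e.hom) (pullback.snd _ _ ≫ e'.hom)
    (by simp [h₃, h₃', pullback.condition])) ?_ ?_ ?_ ?_ ?_
  · rw [precomp_addMk, addMk_eq_zero_iff]
    exact ⟨𝟙 _, by simp [← h₂, ← Category.assoc], by simp [← h₂', ← Category.assoc]⟩
  · simp [add_κ, h₁, h₁']
  · simp [add_ι, h₂']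
  · simp [h₃]
  · simp [h₄, h₄']

theorem Iso.neg {P P' : Butterfly X Y} (h : Iso P P') : Iso P.neg P'.neg := by
  obtain ⟨e, h₁, h₂, h₃, h₄⟩ := h
  exact ⟨e, by simp [Butterfly.neg, h₁], by simp [Butterfly.neg, h₂],
    by simp [Butterfly.neg, h₃], by simp [Butterfly.neg, h₄]⟩

/-- A square with two opposite strict sides. -/
theorem comp_strict_iso {X' Y' : TwoTerm A} {P : Butterfly X Y} {P' : Butterfly X' Y'}
    (u : StrictHom X X') (v : StrictHom Y Y') (φ : P.E ⟶ P'.E)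
    (hκ : P.κ ≫ φ = u.left ≫ P'.κ) (hι : P.ι ≫ φ = v.left ≫ P'.ι)
    (hσ : φ ≫ P'.σ = P.σ ≫ u.right) (hρ : φ ≫ P'.ρ = P.ρ ≫ v.right) :
    Iso (P.comp (ofStrict v)) ((ofStrict u).comp P') := by
  refine comp_iso_of (compMk (pullback.fst _ _ ≫ P.σ ≫ inS u)
    (pullback.fst _ _ ≫ φ + pullback.snd _ _ ≫ prS v ≫ P'.ι) ?_) ?_ ?_ ?_ ?_ ?_
  · simp [hσ]
  · rw [precomp_compMk, compMk_eq_zero_iff]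
    refine ⟨0, ?_, ?_⟩
    · rw [← Category.assoc, compDiag_fst]; simp
    · rw [Preadditive.comp_add, ← Category.assoc, ← Category.assoc, compDiag_fst, compDiag_snd,
        ← Category.assoc, κ_prS]
      simp [hι]
  · rw [← sub_eq_zero, precomp_compMk, comp_κ, sub_eq_add_neg, compMk_neg, compMk_add,
      compMk_eq_zero_iff]
    refine ⟨u.left, ?_, ?_⟩
    · rw [κ_eq]; simp
    · simp [hκ]
  · have : (ofStrict v).ι ≫ prS v ≫ P'.ι = P'.ι := by rw [← Category.assoc]; simp
    simp [comp_ι, this]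
  · simp
  · rw [compMk_ρ, ρ_eq, Preadditive.comp_add, ← Category.assoc, ← Category.assoc,
      ← pullback.condition]
    simp [hρ]

theorem id_comp (P : Butterfly X Y) : Iso ((ofStrict (StrictHom.id X)).comp P) P := by
  have hc : pullback.fst (ofStrict (StrictHom.id X)).ρ P.σ ≫ (ofStrict (StrictHom.id X)).σ +
      pullback.fst (ofStrict (StrictHom.id X)).ρ P.σ ≫ prS _ ≫ X.d =
    pullback.snd (ofStrict (StrictHom.id X)).ρ P.σ ≫ P.σ := by
    rw [← pullback.condition]
    refine Eq.trans ?_ (congrArg (pullback.fst _ _ ≫ ·) (ρ_eq _).symm)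
    simp
  refine comp_iso_of (pullback.snd _ _ - pullback.fst _ _ ≫ prS _ ≫ P.κ) ?_ ?_ ?_ ?_ ?_
  · rw [Preadditive.comp_sub, compDiag_snd, ← Category.assoc, compDiag_fst, ← Category.assoc]
    simp
  · rw [Preadditive.comp_sub, pullback.lift_snd, pullback.lift_fst_assoc, ← Category.assoc]
    simp
  · rw [Preadditive.comp_sub, pullback.lift_snd, pullback.lift_fst_assoc]
    simp
  · rw [Preadditive.sub_comp, ← hc]
    simp
  · simp

theorem comp_id (P : Butterfly X Y) : Iso (P.comp (ofStrict (StrictHom.id Y))) P :=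
  (comp_strict_iso (StrictHom.id X) (StrictHom.id Y) (𝟙 P.E) (by simp)
    (by simp) (by simp) (by simp)).trans (id_comp P)

theorem ofStrict_comp (f : StrictHom X Y) (g : StrictHom Y Z) :
    Iso ((ofStrict f).comp (ofStrict g)) (ofStrict (f.comp g)) := by
  refine (comp_strict_iso (StrictHom.id X) g (P' := ofStrict (f.comp g))
    ((ofStrict f).σ ≫ inS _ + prS f ≫ g.left ≫ (ofStrict (f.comp g)).ι) ?_ ?_ ?_ ?_).trans
    (id_comp _)
  · rw [Preadditive.comp_add, ← Category.assoc, ← Category.assoc, κ_prS, κσ]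
    simp [κ_eq (f.comp g), sub_eq_add_neg]
  · rw [Preadditive.comp_add, ← Category.assoc, ← Category.assoc, ι_prS, ισ]
    simp
  · simp
  · rw [ρ_eq f]
    simp [g.comm]

theorem ofStrict_add (f g : StrictHom X Y) :
    Iso ((ofStrict f).add (ofStrict g)) (ofStrict (f.add g)) := by
  refine add_iso_of (pullback.fst _ _ ≫ (ofStrict f).σ ≫ inS _ +
    (pullback.fst _ _ ≫ prS f + pullback.snd _ _ ≫ prS g) ≫ (ofStrict (f.add g)).ι) ?_ ?_ ?_ ?_ ?_
  · have h₁ : addDiag (ofStrict f) (ofStrict g) ≫ pullback.fst _ _ ≫ prS f = 𝟙 _ := by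
      rw [← Category.assoc, addDiag_fst, ι_prS]
    have h₂ : addDiag (ofStrict f) (ofStrict g) ≫ pullback.snd _ _ ≫ prS g = -𝟙 _ := by
      rw [← Category.assoc, addDiag_snd, Preadditive.neg_comp, ι_prS]
    have h₃ : addDiag (ofStrict f) (ofStrict g) ≫ pullback.fst _ _ ≫ (ofStrict f).σ = 0 := by
      rw [← Category.assoc, addDiag_fst, ισ]
    simp only [Preadditive.comp_add, ← Category.assoc] at h₁ h₂ h₃ ⊢
    rw [h₃]
    simp only [Preadditive.add_comp, h₁, h₂]
    simp
  · simp [κ_eq (f.add g), sub_eq_add_neg]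
    abel
  · simp
  · simp
  · rw [ρ_eq f, ρ_eq g]
    have := pullback.condition (f := (ofStrict f).σ) (g := (ofStrict g).σ)
    simp only [Preadditive.comp_add, ← Category.assoc, ← this]
    simp
    abel

theorem neg_add (P : Butterfly X Y) :
    Iso (P.neg.add P) (ofStrict (StrictHom.zero X Y)) := by
  let a : pullback P.neg.σ P.σ ⟶ P.E := pullback.fst _ _
  let b : pullback P.neg.σ P.σ ⟶ P.E := pullback.snd _ _
  have w : (b - a) ≫ P.σ = 0 := by
    rw [Preadditive.sub_comp, sub_eq_zero]
    exact (pullback.condition (f := P.neg.σ) (g := P.σ)).symm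
  let l := P.exact.exact.lift _ w
  have hl : l ≫ P.ι = b - a := P.exact.exact.lift_f _ w
  have d₁ : addDiag P.neg P ≫ a = -P.ι := addDiag_fst _ _
  have d₂ : addDiag P.neg P ≫ b = -P.ι := addDiag_snd _ _
  have k₁ : pullback.lift P.neg.κ P.κ (by simp) ≫ a = P.κ := pullback.lift_fst _ _ _
  have k₂ : pullback.lift P.neg.κ P.κ (by simp) ≫ b = P.κ := pullback.lift_snd _ _ _
  have i₁ : pullback.lift (0 : _ ⟶ P.neg.E) P.ι (by simp) ≫ a = 0 := pullback.lift_fst _ _ _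
  have i₂ : pullback.lift (0 : _ ⟶ P.neg.E) P.ι (by simp) ≫ b = P.ι := pullback.lift_snd _ _ _
  refine add_iso_of (a ≫ P.σ ≫ inS _ + l ≫ (ofStrict _).ι) ?_ ?_ ?_ ?_ ?_
  · have h : addDiag P.neg P ≫ l = 0 := by
      rw [← cancel_mono P.ι, Category.assoc, hl, Preadditive.comp_sub, d₁, d₂]
      simp
    rw [Preadditive.comp_add, ← Category.assoc, ← Category.assoc _ l, d₁, h]
    simp
  · have h : pullback.lift P.neg.κ P.κ (by simp) ≫ l = 0 := by
      rw [← cancel_mono P.ι, Category.assoc, hl, Preadditive.comp_sub, k₁, k₂]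
      simp
    rw [Preadditive.comp_add, ← Category.assoc, ← Category.assoc _ l, k₁, h, κ_eq]
    simp
  · have h : pullback.lift (0 : _ ⟶ P.neg.E) P.ι (by simp) ≫ l = 𝟙 _ := by
      rw [← cancel_mono P.ι, Category.assoc, hl, Preadditive.comp_sub, i₁, i₂]
      simp
    rw [Preadditive.comp_add, ← Category.assoc, ← Category.assoc _ l, i₁, h]
    simp
  · rw [Preadditive.add_comp, Category.assoc, Category.assoc, inS_σ, Category.comp_id,
      Category.assoc, ισ, comp_zero, _root_.add_zero]
    rfl
  · simp only [Preadditive.add_comp, Category.assoc, inS_ρ, ιρ, StrictHom.zero_right, comp_zero,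
      _root_.zero_add]
    rw [← P.ιρ, ← Category.assoc, hl, sub_eq_neg_add, Preadditive.add_comp]
    change _ = a ≫ (-P.ρ) + b ≫ P.ρ
    simp

theorem zero_add (P : Butterfly X Y) : Iso ((ofStrict (StrictHom.zero X Y)).add P) P := by
  refine add_iso_of (pullback.snd _ _ + pullback.fst _ _ ≫ prS _ ≫ P.ι) ?_ ?_ ?_ ?_ ?_
  · rw [Preadditive.comp_add, addDiag_snd, ← Category.assoc, addDiag_fst]
    simp
  · simp
  · simp
  · simp [pullback.condition]
  · rw [ρ_eq]
    simp [add_comm]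

theorem add_comm' (P P' : Butterfly X Y) : Iso (P.add P') (P'.add P) := by
  refine add_iso_of (addMk (pullback.snd _ _) (pullback.fst _ _) pullback.condition.symm)
    ?_ ?_ ?_ ?_ ?_
  · rw [precomp_addMk, addMk_eq_zero_iff]
    exact ⟨-𝟙 _, by simp, by simp⟩
  · simp [add_κ]
  · rw [← sub_eq_zero, precomp_addMk, add_ι, sub_eq_add_neg, addMk_neg, addMk_add,
      addMk_eq_zero_iff]
    exact ⟨𝟙 _, by simp, by simp⟩
  · simp [pullback.condition]
  · simp [add_comm]

theorem add_assoc' (P P' P'' : Butterfly X Y) :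
    Iso ((P.add P').add P'') (P.add (P'.add P'')) := by
  let Q := pullback P.σ P'.σ
  let s : Q ⟶ X.right := pullback.fst _ _ ≫ P.σ
  let L := pullback s P''.σ
  let e : L ⟶ P.E := pullback.fst s P''.σ ≫ pullback.fst _ _
  let e' : L ⟶ P'.E := pullback.fst s P''.σ ≫ pullback.snd _ _
  let e'' : L ⟶ P''.E := pullback.snd s P''.σ
  have h₁ : e ≫ P.σ = e' ≫ P'.σ := by simp [e, e', pullback.condition]
  have h₂ : e ≫ P.σ = e'' ≫ P''.σ := by simp [e, e'', s, ← pullback.condition]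
  have hL : ∀ {T : A} (x : T ⟶ P.E) (x' : T ⟶ P'.E) (x'' : T ⟶ P''.E) (_ : x ≫ P.σ = x' ≫ P'.σ)
      (_ : x ≫ P.σ = x'' ≫ P''.σ), ∃ l : T ⟶ L, l ≫ e = x ∧ l ≫ e' = x' ∧ l ≫ e'' = x'' := by
    intro T x x' x'' h h'
    exact ⟨pullback.lift (pullback.lift x x' h) x'' (by simp [s, h']), by simp [e], by simp [e'],
      by simp [e'']⟩
  obtain ⟨k, k₁, k₂, k₃⟩ := hL P.κ P'.κ P''.κ (by simp) (by simp)
  obtain ⟨i, i₁, i₂, i₃⟩ := hL (0 : Y.left ⟶ _) (0 : Y.left ⟶ _) P''.ι (by simp) (by simp)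
  refine Iso.of_span (addMk (addMk e e' h₁) e'' (by simp [h₂]))
    (addMk e (addMk e' e'' (by rw [← h₁, h₂])) (by simp [h₁])) (epi_of_surj _ fun t => ?_)
    (fun x hx => ?_) k i ?_ ?_ ?_ ?_ ?_ ?_
  · obtain ⟨T₁, π₁, _, u, x'', hu, et⟩ := add_surj t
    obtain ⟨T₂, π₂, _, x, x', hx, eu⟩ := add_surj u
    obtain ⟨l, l₁, l₂, l₃⟩ := hL x x' (π₂ ≫ x'') hx (by
      rw [Category.assoc, ← hu, ← Category.assoc, eu, addMk_σ])
    refine ⟨T₂, π₂ ≫ π₁, inferInstance, l, ?_⟩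
    simp [et, eu, l₁, l₂, l₃]
  · rw [precomp_addMk, addMk_eq_zero_iff] at hx
    obtain ⟨t, ht₁, ht₂⟩ := hx
    rw [add_ι, precomp_addMk, precomp_addMk, ← sub_eq_zero, sub_eq_add_neg, addMk_neg, addMk_add,
      addMk_eq_zero_iff] at ht₁
    obtain ⟨t', h₁', h₂'⟩ := ht₁
    refine ⟨_, 𝟙 _, inferInstance, ?_⟩
    rw [Category.id_comp, precomp_addMk, addMk_eq_zero_iff]
    refine ⟨-t', by simp [h₁'], ?_⟩
    rw [add_ι, precomp_addMk, addMk_neg, precomp_addMk, ← sub_eq_zero, sub_eq_add_neg, addMk_neg,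
      addMk_add, addMk_eq_zero_iff]
    refine ⟨-(t + t'), ?_, ?_⟩
    · have h₃ : t' ≫ P'.ι = -(t ≫ P'.ι + -x ≫ e') := by rw [← h₂', neg_neg]
      simp only [comp_zero, neg_zero, _root_.zero_add, Preadditive.neg_comp, Preadditive.add_comp,
        h₃]
      abel
    · simp only [Preadditive.neg_comp, Preadditive.add_comp, ← ht₂]
      abel
  · simp [add_κ, k₁, k₂, k₃]
  · simp [add_κ, k₁, k₂, k₃]
  · simp [add_ι, i₁, i₂, i₃]
  · simp [add_ι, i₁, i₂, i₃]
  · simp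
  · simp [add_assoc]

theorem assoc (P : Butterfly X Y) (Q : Butterfly Y Z) (R : Butterfly Z W) :
    Iso ((P.comp Q).comp R) (P.comp (Q.comp R)) := by
  let s : pullback P.ρ Q.σ ⟶ Z.right := pullback.snd _ _ ≫ Q.ρ
  let L := pullback s R.σ
  let e : L ⟶ P.E := pullback.fst s R.σ ≫ pullback.fst _ _
  let e' : L ⟶ Q.E := pullback.fst s R.σ ≫ pullback.snd _ _
  let e'' : L ⟶ R.E := pullback.snd s R.σ
  have h₁ : e ≫ P.ρ = e' ≫ Q.σ := by simp [e, e', pullback.condition]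
  have h₂ : e' ≫ Q.ρ = e'' ≫ R.σ := by simp [e', e'', s, ← pullback.condition]
  have hL : ∀ {T : A} (x : T ⟶ P.E) (x' : T ⟶ Q.E) (x'' : T ⟶ R.E) (_ : x ≫ P.ρ = x' ≫ Q.σ)
      (_ : x' ≫ Q.ρ = x'' ≫ R.σ), ∃ l : T ⟶ L, l ≫ e = x ∧ l ≫ e' = x' ∧ l ≫ e'' = x'' := by
    intro T x x' x'' h h'
    exact ⟨pullback.lift (pullback.lift x x' h) x'' (by simp [s, h']), by simp [e], by simp [e'],
      by simp [e'']⟩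
  obtain ⟨k, k₁, k₂, k₃⟩ := hL P.κ (0 : X.left ⟶ _) (0 : X.left ⟶ _) (by simp) (by simp)
  obtain ⟨i, i₁, i₂, i₃⟩ := hL (0 : W.left ⟶ _) (0 : W.left ⟶ _) R.ι (by simp) (by simp)
  refine Iso.of_span (compMk (compMk e e' h₁) e'' (by simp [h₂]))
    (compMk e (compMk e' e'' h₂) (by simp [h₁])) (epi_of_surj _ fun t => ?_)
    (fun x hx => ?_) k i ?_ ?_ ?_ ?_ ?_ ?_
  · obtain ⟨T₁, π₁, _, u, x'', hu, et⟩ := comp_surj t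
    obtain ⟨T₂, π₂, _, x, x', hx, eu⟩ := comp_surj u
    obtain ⟨l, l₁, l₂, l₃⟩ := hL x x' (π₂ ≫ x'') hx (by
      rw [Category.assoc, ← hu, ← Category.assoc, eu, compMk_ρ])
    refine ⟨T₂, π₂ ≫ π₁, inferInstance, l, ?_⟩
    simp [et, eu, l₁, l₂, l₃]
  · rw [precomp_compMk, compMk_eq_zero_iff] at hx
    obtain ⟨z, hz₁, hz₂⟩ := hx
    rw [comp_ι, precomp_compMk, precomp_compMk, ← sub_eq_zero, sub_eq_add_neg, compMk_neg,
      compMk_add, compMk_eq_zero_iff] at hz₁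
    obtain ⟨y, h₁', h₂'⟩ := hz₁
    refine ⟨_, 𝟙 _, inferInstance, ?_⟩
    rw [Category.id_comp, precomp_compMk, compMk_eq_zero_iff]
    refine ⟨-y, by simp [h₁'], ?_⟩
    rw [comp_κ, precomp_compMk, precomp_compMk, ← sub_eq_zero, sub_eq_add_neg, compMk_neg,
      compMk_add, compMk_eq_zero_iff]
    refine ⟨-z, ?_, ?_⟩
    · simp only [Preadditive.neg_comp, h₂']
      abel
    · simp [hz₂]
  · simp [comp_κ, k₁, k₂, k₃]
  · simp [comp_κ, k₁, k₂, k₃]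
  · simp [comp_ι, i₁, i₂, i₃]
  · simp [comp_ι, i₁, i₂, i₃]
  · simp
  · simp

theorem comp_add (P : Butterfly X Y) (Q Q' : Butterfly Y Z) :
    Iso (P.comp (Q.add Q')) ((P.comp Q).add (P.comp Q')) := by
  let s : pullback P.ρ Q.σ ⟶ Y.right := pullback.snd _ _ ≫ Q.σ
  let L := pullback s Q'.σ
  let e : L ⟶ P.E := pullback.fst s Q'.σ ≫ pullback.fst _ _
  let e' : L ⟶ Q.E := pullback.fst s Q'.σ ≫ pullback.snd _ _
  let e'' : L ⟶ Q'.E := pullback.snd s Q'.σ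
  have h₁ : e ≫ P.ρ = e' ≫ Q.σ := by simp [e, e', pullback.condition]
  have h₂ : e' ≫ Q.σ = e'' ≫ Q'.σ := by simp [e', e'', s, ← pullback.condition]
  have hL : ∀ {T : A} (x : T ⟶ P.E) (x' : T ⟶ Q.E) (x'' : T ⟶ Q'.E) (_ : x ≫ P.ρ = x' ≫ Q.σ)
      (_ : x' ≫ Q.σ = x'' ≫ Q'.σ), ∃ l : T ⟶ L, l ≫ e = x ∧ l ≫ e' = x' ∧ l ≫ e'' = x'' := by
    intro T x x' x'' h h'
    exact ⟨pullback.lift (pullback.lift x x' h) x'' (by simp [s, h']), by simp [e], by simp [e'],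
      by simp [e'']⟩
  obtain ⟨k, k₁, k₂, k₃⟩ := hL P.κ (0 : X.left ⟶ _) (0 : X.left ⟶ _) (by simp) (by simp)
  obtain ⟨i, i₁, i₂, i₃⟩ := hL (0 : Z.left ⟶ _) (0 : Z.left ⟶ _) Q'.ι (by simp) (by simp)
  refine Iso.of_span (compMk e (addMk e' e'' h₂) (by simp [h₁]))
    (addMk (compMk e e' h₁) (compMk e e'' (h₁.trans h₂)) (by simp)) (epi_of_surj _ fun t => ?_)
    (fun x hx => ?_) k i ?_ ?_ ?_ ?_ ?_ ?_
  · obtain ⟨T₁, π₁, _, x, u, hu, et⟩ := comp_surj t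
    obtain ⟨T₂, π₂, _, x', x'', hx, eu⟩ := add_surj u
    obtain ⟨l, l₁, l₂, l₃⟩ := hL (π₂ ≫ x) x' x'' (by
      rw [Category.assoc, hu, ← Category.assoc, eu, addMk_σ]) hx
    refine ⟨T₂, π₂ ≫ π₁, inferInstance, l, ?_⟩
    simp [et, eu, l₁, l₂, l₃]
  · rw [precomp_compMk, compMk_eq_zero_iff] at hx
    obtain ⟨y, hy₁, hy₂⟩ := hx
    rw [add_κ, precomp_addMk, precomp_addMk, ← sub_eq_zero, sub_eq_add_neg, addMk_neg,
      addMk_add, addMk_eq_zero_iff] at hy₂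
    obtain ⟨z, h₁', h₂'⟩ := hy₂
    refine ⟨_, 𝟙 _, inferInstance, ?_⟩
    rw [Category.id_comp, precomp_addMk, addMk_eq_zero_iff]
    refine ⟨-z, ?_, ?_⟩
    · rw [comp_ι, precomp_compMk, precomp_compMk, ← sub_eq_zero, sub_eq_add_neg, compMk_neg,
        compMk_add, compMk_eq_zero_iff]
      refine ⟨-y, ?_, ?_⟩
      · simp [hy₁]
      · simp only [Preadditive.neg_comp, h₁']
        abel
    · rw [comp_ι, precomp_compMk, precomp_compMk, compMk_neg, ← sub_eq_zero, sub_eq_add_neg,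
        compMk_neg, compMk_add, compMk_eq_zero_iff]
      refine ⟨-y, ?_, ?_⟩
      · simp [hy₁]
      · have : z ≫ Q'.ι = -(y ≫ Q'.κ + -x ≫ e'') := by rw [← h₂']; simp
        simp only [Preadditive.neg_comp, this]
        abel
  · simp [comp_κ, k₁, k₂, k₃]
  · simp [comp_κ, add_κ, k₁, k₂, k₃]
  · simp [comp_ι, add_ι, i₁, i₂, i₃]
  · simp [comp_ι, add_ι, i₁, i₂, i₃]
  · simp
  · simp

theorem add_comp (P P' : Butterfly X Y) (Q : Butterfly Y Z) :
    Iso ((P.add P').comp Q) ((P.comp Q).add (P'.comp Q)) := by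
  let s : pullback P.ρ Q.σ ⟶ X.right := pullback.fst _ _ ≫ P.σ
  let s' : pullback P'.ρ Q.σ ⟶ X.right := pullback.fst _ _ ≫ P'.σ
  let L := pullback s s'
  let e : L ⟶ P.E := pullback.fst s s' ≫ pullback.fst _ _
  let q : L ⟶ Q.E := pullback.fst s s' ≫ pullback.snd _ _
  let e' : L ⟶ P'.E := pullback.snd s s' ≫ pullback.fst _ _
  let q' : L ⟶ Q.E := pullback.snd s s' ≫ pullback.snd _ _
  have h₁ : e ≫ P.ρ = q ≫ Q.σ := by simp [e, q, pullback.condition]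
  have h₁' : e' ≫ P'.ρ = q' ≫ Q.σ := by simp [e', q', pullback.condition]
  have h₂ : e ≫ P.σ = e' ≫ P'.σ := by
    have this : pullback.fst s s' ≫ s = pullback.snd s s' ≫ s' := pullback.condition
    simp only [e, e', Category.assoc]
    exact this
  have hL : ∀ {T : A} (x : T ⟶ P.E) (y : T ⟶ Q.E) (x' : T ⟶ P'.E) (y' : T ⟶ Q.E)
      (_ : x ≫ P.ρ = y ≫ Q.σ) (_ : x' ≫ P'.ρ = y' ≫ Q.σ) (_ : x ≫ P.σ = x' ≫ P'.σ),
      ∃ l : T ⟶ L, l ≫ e = x ∧ l ≫ q = y ∧ l ≫ e' = x' ∧ l ≫ q' = y' := by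
    intro T x y x' y' h h' h''
    exact ⟨pullback.lift (pullback.lift x y h) (pullback.lift x' y' h') (by simp [s, s', h'']),
      by simp [e], by simp [q], by simp [e'], by simp [q']⟩
  obtain ⟨k, k₁, k₂, k₃, k₄⟩ := hL P.κ (0 : X.left ⟶ _) P'.κ (0 : X.left ⟶ _) (by simp) (by simp)
    (by simp)
  obtain ⟨i, i₁, i₂, i₃, i₄⟩ := hL (0 : Z.left ⟶ _) (0 : Z.left ⟶ _) (0 : Z.left ⟶ _) Q.ι
    (by simp) (by simp) (by simp)
  refine Iso.symm (Iso.of_span (addMk (compMk e q h₁) (compMk e' q' h₁') (by simp [h₂]))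
    (compMk (addMk e e' h₂) (q + q') (by simp [h₁, h₁'])) (epi_of_surj _ fun t => ?_)
    (fun x hx => ?_) k i ?_ ?_ ?_ ?_ ?_ ?_)
  · obtain ⟨T₁, π₁, _, u, u', hu, et⟩ := add_surj t
    obtain ⟨T₂, π₂, _, x, y, hx, eu⟩ := comp_surj u
    obtain ⟨T₃, π₃, _, x', y', hx', eu'⟩ := comp_surj (π₂ ≫ u')
    obtain ⟨l, l₁, l₂, l₃, l₄⟩ := hL (π₃ ≫ x) (π₃ ≫ y) x' y' (by simp [hx]) hx' (by
      have h := π₃ ≫= π₂ ≫= hu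
      simp only [← Category.assoc] at h eu'
      rw [eu', Category.assoc π₃, eu] at h
      simpa using h)
    refine ⟨T₃, π₃ ≫ π₂ ≫ π₁, inferInstance, l, ?_⟩
    simp [et, eu, eu', l₁, l₂, l₃, l₄]
  · rw [precomp_addMk, addMk_eq_zero_iff] at hx
    obtain ⟨z, hz₁, hz₂⟩ := hx
    rw [comp_ι, precomp_compMk, precomp_compMk, ← sub_eq_zero, sub_eq_add_neg, compMk_neg,
      compMk_add, compMk_eq_zero_iff] at hz₁
    rw [comp_ι, precomp_compMk, precomp_compMk, ← sub_eq_zero, compMk_neg, sub_eq_add_neg,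
      compMk_neg, compMk_add, compMk_eq_zero_iff] at hz₂
    obtain ⟨y, hy₁, hy₂⟩ := hz₁
    obtain ⟨y', hy₁', hy₂'⟩ := hz₂
    refine ⟨_, 𝟙 _, inferInstance, ?_⟩
    rw [Category.id_comp, precomp_compMk, compMk_eq_zero_iff]
    refine ⟨-(y + y'), ?_, ?_⟩
    · rw [add_ι, precomp_addMk, precomp_addMk, ← sub_eq_zero, sub_eq_add_neg, addMk_neg,
        addMk_add, addMk_eq_zero_iff]
      refine ⟨y, by simp [hy₁], ?_⟩
      simp only [Preadditive.neg_comp, Preadditive.add_comp, hy₁']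
      simp
    · simp only [Preadditive.neg_comp, Preadditive.add_comp, hy₂, hy₂', Preadditive.comp_add]
      abel
  · simp [comp_κ, add_κ, k₁, k₂, k₃, k₄]
  · simp [comp_κ, add_κ, k₁, k₂, k₃, k₄]
  · simp [comp_ι, add_ι, i₁, i₂, i₃, i₄]
  · simp [comp_ι, add_ι, i₁, i₂, i₃, i₄]
  · simp
  · simp

/-- Multiplication by a scalar commutes with butterflies. -/
theorem comp_smulId {K : Type w} [CommRing K] [Linear K A] (r : K) (P : Butterfly X Y) :
    Iso (P.comp (ofStrict (StrictHom.smulId r Y))) ((ofStrict (StrictHom.smulId r X)).comp P) :=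
  comp_strict_iso _ _ (r • 𝟙 _) (by simp) (by simp) (by simp) (by simp)

/-- A composition is zero if there is a link between the two butterflies, that is a morphism of
the middle objects that is compatible with the four inner arrows and zero on the outer ones. -/
theorem comp_iso_zero (P : Butterfly X Y) (Q : Butterfly Y Z) (δ : P.E ⟶ Q.E)
    (h₁ : P.ι ≫ δ = Q.κ) (h₂ : δ ≫ Q.σ = P.ρ) (h₃ : P.κ ≫ δ = 0) (h₄ : δ ≫ Q.ρ = 0) :
    Iso (P.comp Q) (ofStrict (StrictHom.zero X Z)) := by
  have w : (pullback.snd P.ρ Q.σ - pullback.fst P.ρ Q.σ ≫ δ) ≫ Q.σ = 0 := by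
    rw [Preadditive.sub_comp, ← pullback.condition, Category.assoc, h₂, sub_self]
  let l := Q.exact.exact.lift _ w
  have hl : l ≫ Q.ι = pullback.snd P.ρ Q.σ - pullback.fst P.ρ Q.σ ≫ δ := Q.exact.exact.lift_f _ w
  refine comp_iso_of (pullback.fst _ _ ≫ P.σ ≫ inS _ + l ≫ (ofStrict _).ι) ?_ ?_ ?_ ?_ ?_
  · have h : compDiag P Q ≫ l = 0 := by
      rw [← cancel_mono Q.ι, Category.assoc, hl, Preadditive.comp_sub, ← Category.assoc _ _ δ,
        compDiag_fst, compDiag_snd, h₁]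
      simp
    rw [Preadditive.comp_add, ← Category.assoc, ← Category.assoc _ l, compDiag_fst, h]
    simp
  · have h : pullback.lift P.κ 0 (by simp) ≫ l = 0 := by
      rw [← cancel_mono Q.ι, Category.assoc, hl]
      simp [h₃]
    rw [Preadditive.comp_add, ← Category.assoc _ l, h, pullback.lift_fst_assoc, κ_eq]
    simp
  · have h : pullback.lift 0 Q.ι (by simp) ≫ l = 𝟙 _ := by
      rw [← cancel_mono Q.ι, Category.assoc, hl]
      simp
    rw [Preadditive.comp_add, ← Category.assoc _ l, h, pullback.lift_fst_assoc]
    simp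
  · simp
  · simp only [Preadditive.add_comp, Category.assoc, inS_ρ, ιρ, StrictHom.zero_right, comp_zero,
      _root_.zero_add]
    rw [← Q.ιρ, ← Category.assoc, hl]
    simp [h₄]

end

end Butterfly

/-! ### The tilted category -/

/-- Isomorphism of butterflies, as a setoid. -/
def Butterfly.setoid (X Y : TwoTerm A) : Setoid (Butterfly X Y) where
  r := Butterfly.Iso
  iseqv := ⟨Butterfly.Iso.refl, Butterfly.Iso.symm, Butterfly.Iso.trans⟩

/-- Isomorphism classes of butterflies. -/
def BHom (X Y : TwoTerm A) : Type (max u v) := Quotient (Butterfly.setoid X Y)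

namespace BHom

variable {X Y Z W : TwoTerm A}

/-- The isomorphism class of a butterfly. -/
def mk (P : Butterfly X Y) : BHom X Y := Quotient.mk (Butterfly.setoid X Y) P

theorem sound {P Q : Butterfly X Y} (h : Butterfly.Iso P Q) : mk P = mk Q :=
  Quotient.sound (s := Butterfly.setoid X Y) h

theorem exists_mk (f : BHom X Y) : ∃ P, mk P = f := Quotient.exists_rep f

/-- The class of a strict morphism. -/
noncomputable def ofStrict (f : StrictHom X Y) : BHom X Y := mk (Butterfly.ofStrict f)

noncomputable def comp : BHom X Y → BHom Y Z → BHom X Z :=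
  Quotient.map₂ Butterfly.comp fun _ _ h _ _ h' => Butterfly.Iso.comp h h'

noncomputable instance : Add (BHom X Y) :=
  ⟨Quotient.map₂ Butterfly.add fun _ _ h _ _ h' => Butterfly.Iso.add h h'⟩

noncomputable instance : Neg (BHom X Y) :=
  ⟨Quotient.map Butterfly.neg fun _ _ h => Butterfly.Iso.neg h⟩

noncomputable instance : Zero (BHom X Y) := ⟨ofStrict (StrictHom.zero X Y)⟩

theorem comp_mk (P : Butterfly X Y) (Q : Butterfly Y Z) : comp (mk P) (mk Q) = mk (P.comp Q) := rfl
theorem add_mk (P Q : Butterfly X Y) : mk P + mk Q = mk (P.add Q) := rfl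
theorem neg_mk (P : Butterfly X Y) : -mk P = mk P.neg := rfl
theorem zero_def : (0 : BHom X Y) = ofStrict (StrictHom.zero X Y) := rfl

theorem id_comp (f : BHom X Y) : comp (ofStrict (StrictHom.id X)) f = f := by
  obtain ⟨P, rfl⟩ := f.exists_mk
  exact sound (P.id_comp)

theorem comp_id (f : BHom X Y) : comp f (ofStrict (StrictHom.id Y)) = f := by
  obtain ⟨P, rfl⟩ := f.exists_mk
  exact sound (P.comp_id)

theorem assoc (f : BHom X Y) (g : BHom Y Z) (h : BHom Z W) :
    comp (comp f g) h = comp f (comp g h) := by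
  obtain ⟨P, rfl⟩ := f.exists_mk
  obtain ⟨Q, rfl⟩ := g.exists_mk
  obtain ⟨R, rfl⟩ := h.exists_mk
  exact sound (Butterfly.assoc P Q R)

theorem add_comp (f g : BHom X Y) (h : BHom Y Z) : comp (f + g) h = comp f h + comp g h := by
  obtain ⟨P, rfl⟩ := f.exists_mk
  obtain ⟨Q, rfl⟩ := g.exists_mk
  obtain ⟨R, rfl⟩ := h.exists_mk
  exact sound (Butterfly.add_comp P Q R)

theorem comp_add (f : BHom X Y) (g h : BHom Y Z) : comp f (g + h) = comp f g + comp f h := by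
  obtain ⟨P, rfl⟩ := f.exists_mk
  obtain ⟨Q, rfl⟩ := g.exists_mk
  obtain ⟨R, rfl⟩ := h.exists_mk
  exact sound (Butterfly.comp_add P Q R)

theorem ofStrict_comp (f : StrictHom X Y) (g : StrictHom Y Z) :
    comp (ofStrict f) (ofStrict g) = ofStrict (f.comp g) := sound (Butterfly.ofStrict_comp f g)

theorem ofStrict_add (f g : StrictHom X Y) :
    ofStrict f + ofStrict g = ofStrict (f.add g) := sound (Butterfly.ofStrict_add f g)

theorem add_comm' (f g : BHom X Y) : f + g = g + f := by
  obtain ⟨P, rfl⟩ := f.exists_mk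
  obtain ⟨Q, rfl⟩ := g.exists_mk
  exact sound (Butterfly.add_comm' P Q)

theorem zero_add' (f : BHom X Y) : 0 + f = f := by
  obtain ⟨P, rfl⟩ := f.exists_mk
  exact sound (P.zero_add)

noncomputable instance : AddCommGroup (BHom X Y) where
  add_assoc f g h := by
    obtain ⟨P, rfl⟩ := f.exists_mk
    obtain ⟨Q, rfl⟩ := g.exists_mk
    obtain ⟨R, rfl⟩ := h.exists_mk
    exact sound (Butterfly.add_assoc' P Q R)
  zero_add := zero_add'
  add_zero f := by rw [add_comm', zero_add']
  nsmul := nsmulRec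
  zsmul := zsmulRec
  neg_add_cancel f := by
    obtain ⟨P, rfl⟩ := f.exists_mk
    exact sound (P.neg_add)
  add_comm := add_comm'

theorem comp_zero (f : BHom X Y) : comp f (0 : BHom Y Z) = 0 := by
  have h := comp_add f (0 : BHom Y Z) 0
  rwa [add_zero, left_eq_add] at h

theorem zero_comp (f : BHom Y Z) : comp (0 : BHom X Y) f = 0 := by
  have h := add_comp (0 : BHom X Y) 0 f
  rwa [add_zero, left_eq_add] at h

section

variable {K : Type w} [CommRing K] [Linear K A]

theorem comp_smulId (r : K) (f : BHom X Y) :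
    comp f (ofStrict (StrictHom.smulId r Y)) = comp (ofStrict (StrictHom.smulId r X)) f := by
  obtain ⟨P, rfl⟩ := f.exists_mk
  exact sound (P.comp_smulId r)

/-- Scalars act through the strict endomorphisms `r • 𝟙`. -/
noncomputable instance : Module K (BHom X Y) where
  smul r f := comp f (ofStrict (StrictHom.smulId r Y))
  one_smul f := by
    have h : StrictHom.smulId (1 : K) Y = StrictHom.id Y := by ext <;> simp
    change comp f _ = f
    rw [h, comp_id]
  mul_smul r s f := by
    have h : StrictHom.smulId (r * s) Y = (StrictHom.smulId s Y).comp (StrictHom.smulId r Y) := by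
      ext <;> simp [smul_smul]
    change comp f _ = comp (comp f _) _
    rw [h, ← ofStrict_comp, assoc]
  smul_zero r := zero_comp _
  smul_add r f g := add_comp f g _
  add_smul r s f := by
    have h : StrictHom.smulId (r + s) Y = (StrictHom.smulId r Y).add (StrictHom.smulId s Y) := by
      ext <;> simp [add_smul]
    change comp f _ = comp f _ + comp f _
    rw [h, ← ofStrict_add, comp_add]
  zero_smul f := by
    have h : StrictHom.smulId (0 : K) Y = StrictHom.zero Y Y := by ext <;> simp
    change comp f _ = 0
    rw [h, ← zero_def, comp_zero]

theorem smul_def (r : K) (f : BHom X Y) : r • f = comp f (ofStrict (StrictHom.smulId r Y)) := rfl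

end

end BHom

variable (A) in
/-- A torsion pair `(T, F)` in an abelian category. -/
structure TorsionPair where
  T : ObjectProperty A
  F : ObjectProperty A
  T_iso : T.IsClosedUnderIsomorphisms
  F_iso : F.IsClosedUnderIsomorphisms
  hom_eq_zero : ∀ {X Y : A}, T X → F Y → ∀ f : X ⟶ Y, f = 0
  exists_shortExact : ∀ X : A, ∃ (X₁ X₂ : A) (i : X₁ ⟶ X) (p : X ⟶ X₂) (h : i ≫ p = 0),
    T X₁ ∧ F X₂ ∧ (ShortComplex.mk i p h).ShortExact

/-- The objects of the tilted category `B`: the complexes `[X⁻¹ → X⁰]` with kernel in `F` and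
cokernel in `T`. -/
structure Tilt (t : TorsionPair A) where
  obj : TwoTerm A
  kernel_mem : t.F (kernel obj.d)
  cokernel_mem : t.T (cokernel obj.d)

/-- The morphisms of `B` are the isomorphism classes of butterflies. -/
noncomputable instance (t : TorsionPair A) : Category.{max u v} (Tilt t) where
  Hom X Y := BHom X.obj Y.obj
  id X := BHom.ofStrict (StrictHom.id X.obj)
  comp := BHom.comp
  id_comp := BHom.id_comp
  comp_id := BHom.comp_id
  assoc := BHom.assoc

noncomputable instance (t : TorsionPair A) : Preadditive (Tilt t) where
  homGroup X Y := inferInstanceAs (AddCommGroup (BHom X.obj Y.obj))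
  add_comp _ _ _ := BHom.add_comp
  comp_add _ _ _ := BHom.comp_add

noncomputable instance (K : Type w) [CommRing K] [Linear K A] (t : TorsionPair A) :
    Linear K (Tilt t) where
  homModule X Y := inferInstanceAs (Module K (BHom X.obj Y.obj))
  smul_comp X Y Z r f g := by
    change BHom.comp (BHom.comp f _) g = BHom.comp (BHom.comp f g) _
    rw [BHom.assoc, BHom.assoc, BHom.comp_smulId]
  comp_smul X Y Z f r g := (BHom.assoc f g (BHom.ofStrict (StrictHom.smulId r Z.obj))).symm

/-! ### DG categories -/

/-- A DG category over `K`. The composition is written in diagrammatic order, so that in the usual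
order the Leibniz rule below reads `d (g ∘ f) = dg ∘ f + (-1)^|g| g ∘ df`. -/
structure DGCategory (K : Type w) [CommRing K] where
  Obj : Type u
  Hom : Obj → Obj → ℤ → Type v
  [addCommGroup : ∀ X Y n, AddCommGroup (Hom X Y n)]
  [module : ∀ X Y n, Module K (Hom X Y n)]
  d : ∀ {X Y : Obj} {n m : ℤ}, n + 1 = m → Hom X Y n →ₗ[K] Hom X Y m
  comp : ∀ {X Y Z : Obj} {n m p : ℤ}, n + m = p → Hom X Y n →ₗ[K] Hom Y Z m →ₗ[K] Hom X Z p
  id : ∀ X : Obj, Hom X X 0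
  d_d : ∀ {X Y : Obj} {n m p : ℤ} (h : n + 1 = m) (h' : m + 1 = p) (f : Hom X Y n),
    d h' (d h f) = 0
  d_comp : ∀ {X Y Z : Obj} {n m p n' m' p' : ℤ} (h : n + m = p) (hn : n + 1 = n')
    (hm : m + 1 = m') (hp : p + 1 = p') (f : Hom X Y n) (g : Hom Y Z m),
    d hp (comp h f g) = comp (by lia) f (d hm g) + m.negOnePow • comp (by lia) (d hn f) g
  d_id : ∀ (X : Obj) {n : ℤ} (h : 0 + 1 = n), d h (id X) = 0
  id_comp : ∀ {X Y : Obj} {n : ℤ} (f : Hom X Y n), comp (zero_add n) (id X) f = f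
  comp_id : ∀ {X Y : Obj} {n : ℤ} (f : Hom X Y n), comp (add_zero n) f (id Y) = f
  assoc : ∀ {X Y Z W : Obj} {n m p nm mp q : ℤ} (h₁ : n + m = nm) (h₂ : m + p = mp)
    (h₁' : nm + p = q) (h₂' : n + mp = q) (f : Hom X Y n) (g : Hom Y Z m) (h : Hom Z W p),
    comp h₁' (comp h₁ f g) h = comp h₂' f (comp h₂ g h)

attribute [instance] DGCategory.addCommGroup DGCategory.module

universe u₁ v₁ u₂ v₂

section

variable {K : Type w} [CommRing K]

/-- The closed morphisms of degree `0`. -/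
def DGCategory.IsClosed (C : DGCategory.{w, v₁, u₁} K) {X Y : C.Obj} (f : C.Hom X Y 0) : Prop :=
  C.d (zero_add 1) f = 0

/-- The closed morphisms of degree `0` that have an inverse (closed, of degree `0`). -/
def DGCategory.IsIso (C : DGCategory.{w, v₁, u₁} K) {X Y : C.Obj} (f : C.Hom X Y 0) : Prop :=
  C.IsClosed f ∧ ∃ g : C.Hom Y X 0, C.IsClosed g ∧ C.comp (add_zero 0) f g = C.id X ∧
    C.comp (add_zero 0) g f = C.id Y

/-- A DG functor with the given action on objects. -/
structure DGFunctor (C : DGCategory.{w, v₁, u₁} K) (D : DGCategory.{w, v₂, u₂} K)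
    (obj : C.Obj → D.Obj) where
  map : ∀ {X Y : C.Obj} {n : ℤ}, C.Hom X Y n →ₗ[K] D.Hom (obj X) (obj Y) n
  map_d : ∀ {X Y : C.Obj} {n m : ℤ} (h : n + 1 = m) (f : C.Hom X Y n),
    map (C.d h f) = D.d h (map f)
  map_comp : ∀ {X Y Z : C.Obj} {n m p : ℤ} (h : n + m = p) (f : C.Hom X Y n) (g : C.Hom Y Z m),
    map (C.comp h f g) = D.comp h (map f) (map g)
  map_id : ∀ X : C.Obj, map (C.id X) = D.id (obj X)

/-- The full DG subcategory on the objects with a given property. -/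
def DGCategory.full (C : DGCategory.{w, v₁, u₁} K) (Q : C.Obj → Prop) :
    DGCategory.{w, v₁, u₁} K where
  Obj := { X : C.Obj // Q X }
  Hom X Y n := C.Hom X.1 Y.1 n
  d := C.d
  comp := C.comp
  id X := C.id X.1
  d_d := C.d_d
  d_comp := C.d_comp
  d_id X := C.d_id X.1
  id_comp := C.id_comp
  comp_id := C.comp_id
  assoc := C.assoc

/-- The restriction of a DG functor to a full DG subcategory. -/
def DGFunctor.restrict {C : DGCategory.{w, v₁, u₁} K} {D : DGCategory.{w, v₂, u₂} K}
    {obj : C.Obj → D.Obj} (F : DGFunctor C D obj) (Q : C.Obj → Prop) :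
    DGFunctor (C.full Q) D (fun X => obj X.1) where
  map := F.map
  map_d := F.map_d
  map_comp := F.map_comp
  map_id X := F.map_id X.1

/-- A DG functor is a (strong) DG equivalence if it is bijective on the Hom complexes and
essentially surjective up to closed isomorphisms of degree `0`. -/
structure DGFunctor.IsEquivalence {C : DGCategory.{w, v₁, u₁} K} {D : DGCategory.{w, v₂, u₂} K}
    {obj : C.Obj → D.Obj} (F : DGFunctor C D obj) : Prop where
  bijective : ∀ (X Y : C.Obj) (n : ℤ), Function.Bijective (F.map (X := X) (Y := Y) (n := n))
  essSurj : ∀ Z : D.Obj, ∃ (X : C.Obj) (f : D.Hom (obj X) Z 0), D.IsIso f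

section

variable {C : DGCategory.{w, v₁, u₁} K} {D : DGCategory.{w, v₂, u₂} K} {obj : C.Obj → D.Obj}

/-- A left resolution `p : P → X`: it belongs to the class `S`, and `P` has the property `Q`. -/
structure IsLeftResolution (S : ∀ {X Y : C.Obj}, C.Hom X Y 0 → Prop) (Q : C.Obj → Prop)
    {P X : C.Obj} (p : C.Hom P X 0) : Prop where
  mem : S p
  closed : C.IsClosed p
  prop : Q P

/-- A right resolution `q : X → I`: it belongs to the class `S`, and `I` has the property `Q`. -/
structure IsRightResolution (S : ∀ {X Y : C.Obj}, C.Hom X Y 0 → Prop) (Q : C.Obj → Prop)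
    {X I : C.Obj} (q : C.Hom X I 0) : Prop where
  mem : S q
  closed : C.IsClosed q
  prop : Q I

/-- The DG functor `F : C → D` is a derived equivalence with respect to the localizing class `S`
(of closed morphisms of degree `0` in `C`), where the derived Hom complexes
`RHom (X, Y) = Hom (P, Y)` are computed by left resolutions `p : P → X` in `S` with `P` satisfying
`Q`. -/
structure IsLeftDerivedEquivalence (F : DGFunctor C D obj)
    (S : ∀ {X Y : C.Obj}, C.Hom X Y 0 → Prop) (Q : C.Obj → Prop) : Prop where
  /-- The class `S` consists of the closed morphisms that become isomorphisms in `D`. -/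
  mem_iff : ∀ {X Y : C.Obj} (s : C.Hom X Y 0), C.IsClosed s → (S s ↔ D.IsIso (F.map s))
  /-- Every object has a resolution. -/
  exists_resolution : ∀ X : C.Obj, ∃ (P : C.Obj) (p : C.Hom P X 0), IsLeftResolution S Q p
  /-- Two resolutions of an object are related by a unique morphism over this object, and it is an
  isomorphism. -/
  unique_resolution : ∀ {X P P' : C.Obj} (p : C.Hom P X 0) (p' : C.Hom P' X 0),
    IsLeftResolution S Q p → IsLeftResolution S Q p' →
      ∃ a : C.Hom P' P 0, C.IsIso a ∧ C.comp (add_zero 0) a p = p' ∧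
        ∀ b : C.Hom P' P 0, C.comp (add_zero 0) b p = p' → b = a
  /-- `Hom (P, -)` maps `S` to isomorphisms of complexes. -/
  bijective : ∀ {P X Y : C.Obj} (s : C.Hom X Y 0), Q P → C.IsClosed s → S s →
    ∀ n : ℤ, Function.Bijective (fun f : C.Hom P X n => C.comp (add_zero n) f s)
  /-- The derived Hom complexes `RHom (X, Y)` of `C` are isomorphic, through `F`, to the Hom
  complexes of `D`. -/
  rHom_iso : ∀ {X P : C.Obj} (p : C.Hom P X 0), IsLeftResolution S Q p → ∀ Y : C.Obj,
    ∃ e : ∀ n : ℤ, C.Hom P Y n ≃ₗ[K] D.Hom (obj X) (obj Y) n,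
      (∀ {n m : ℤ} (h : n + 1 = m) (f : C.Hom P Y n), e m (C.d h f) = D.d h (e n f)) ∧
      ∀ (n : ℤ) (f : C.Hom P Y n), D.comp (zero_add n) (F.map p) (e n f) = F.map f
  /-- `F` is essentially surjective. -/
  essSurj : ∀ Z : D.Obj, ∃ (X : C.Obj) (f : D.Hom (obj X) Z 0), D.IsIso f
  /-- `F` induces a DG equivalence from the full DG subcategory of the objects that satisfy `Q`
  (the derived DG category) to `D`. -/
  isEquivalence : (F.restrict Q).IsEquivalence

/-- The DG functor `F : C → D` is a derived equivalence with respect to the localizing class `S`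
(of closed morphisms of degree `0` in `C`), where the derived Hom complexes
`RHom (X, Y) = Hom (X, I)` are computed by right resolutions `q : Y → I` in `S` with `I` satisfying
`Q`. -/
structure IsRightDerivedEquivalence (F : DGFunctor C D obj)
    (S : ∀ {X Y : C.Obj}, C.Hom X Y 0 → Prop) (Q : C.Obj → Prop) : Prop where
  /-- The class `S` consists of the closed morphisms that become isomorphisms in `D`. -/
  mem_iff : ∀ {X Y : C.Obj} (s : C.Hom X Y 0), C.IsClosed s → (S s ↔ D.IsIso (F.map s))
  /-- Every object has a resolution. -/
  exists_resolution : ∀ Y : C.Obj, ∃ (I : C.Obj) (q : C.Hom Y I 0), IsRightResolution S Q q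
  /-- Two resolutions of an object are related by a unique morphism under this object, and it is an
  isomorphism. -/
  unique_resolution : ∀ {Y I I' : C.Obj} (q : C.Hom Y I 0) (q' : C.Hom Y I' 0),
    IsRightResolution S Q q → IsRightResolution S Q q' →
      ∃ a : C.Hom I I' 0, C.IsIso a ∧ C.comp (add_zero 0) q a = q' ∧
        ∀ b : C.Hom I I' 0, C.comp (add_zero 0) q b = q' → b = a
  /-- `Hom (-, I)` maps `S` to isomorphisms of complexes. -/
  bijective : ∀ {X Y I : C.Obj} (s : C.Hom X Y 0), Q I → C.IsClosed s → S s →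
    ∀ n : ℤ, Function.Bijective (fun f : C.Hom Y I n => C.comp (zero_add n) s f)
  /-- The derived Hom complexes `RHom (X, Y)` of `C` are isomorphic, through `F`, to the Hom
  complexes of `D`. -/
  rHom_iso : ∀ {Y I : C.Obj} (q : C.Hom Y I 0), IsRightResolution S Q q → ∀ X : C.Obj,
    ∃ e : ∀ n : ℤ, C.Hom X I n ≃ₗ[K] D.Hom (obj X) (obj Y) n,
      (∀ {n m : ℤ} (h : n + 1 = m) (f : C.Hom X I n), e m (C.d h f) = D.d h (e n f)) ∧
      ∀ (n : ℤ) (f : C.Hom X I n), D.comp (add_zero n) (e n f) (F.map q) = F.map f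
  /-- `F` is essentially surjective. -/
  essSurj : ∀ Z : D.Obj, ∃ (X : C.Obj) (f : D.Hom (obj X) Z 0), D.IsIso f
  /-- `F` induces a DG equivalence from the full DG subcategory of the objects that satisfy `Q`
  (the derived DG category) to `D`. -/
  isEquivalence : (F.restrict Q).IsEquivalence

end

end

/-! ### The DG category of complexes -/

section

open CochainComplex.HomComplex

/-- The DG category of cochain complexes in a `K`-linear category. -/
def dgComplexes (K : Type w) [CommRing K] (C : Type u₁) [Category.{v₁} C] [Preadditive C]
    [Linear K C] : DGCategory.{w, v₁, max u₁ v₁} K where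
  Obj := CochainComplex C ℤ
  Hom X Y n := Cochain X Y n
  d {X Y n m} _ := δ_hom K X Y n m
  comp h := LinearMap.mk₂ K (fun f g => f.comp g h) (fun _ _ _ => Cochain.add_comp _ _ _ _)
    (fun _ _ _ => Cochain.smul_comp _ _ _ _) (fun _ _ _ => Cochain.comp_add _ _ _ _)
    (fun _ _ _ => Cochain.comp_smul _ _ _ _)
  id X := Cochain.ofHom (𝟙 X)
  d_d _ _ f := δ_δ _ _ _ f
  d_comp h hn hm hp f g := δ_comp f g h _ _ _ hp hn hm
  d_id X n _ := δ_ofHom (𝟙 X)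
  id_comp f := Cochain.id_comp f
  comp_id f := Cochain.comp_id f
  assoc h₁ h₂ h₁' _ f g h := Cochain.comp_assoc f g h h₁ h₂ (by lia)

variable (A) in
/-- A decorated complex: a complex `E` with a subobject `M n` of every term `E.X n` (with no
compatibility with the differential). -/
structure Decorated where
  E : CochainComplex A ℤ
  M : ∀ n : ℤ, Subobject (E.X n)

namespace Decorated

/-- The two-term complex `[M n → E.X (n + 1) / M (n + 1)]`. -/
noncomputable def term (X : Decorated A) (n : ℤ) : TwoTerm A where
  left := (X.M n : A)
  right := cokernel (X.M (n + 1)).arrow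
  d := (X.M n).arrow ≫ X.E.d n (n + 1) ≫ cokernel.π (X.M (n + 1)).arrow

variable (t : TorsionPair A)

/-- The decoration is compatible with the torsion pair: all the `H^{-1,n}` (the kernels of the maps
`M n → E.X (n + 1) / M (n + 1)`) are in `F`, and all the `H^{0,n}` (their cokernels) are in `T`. -/
def IsCompatible (X : Decorated A) : Prop :=
  ∀ n : ℤ, t.F (kernel (X.term n).d) ∧ t.T (cokernel (X.term n).d)

/-- A chain map respects the decorations. -/
def RespectsHom {X Y : Decorated A} (f : X.E ⟶ Y.E) : Prop :=
  ∀ n : ℤ, (Y.M n).Factors ((X.M n).arrow ≫ f.f n)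

section

variable (K : Type w) [CommRing K] [Linear K A] (X Y Z : Decorated A)

/-- The morphisms to `Y` with values in a subobject form a submodule. -/
def factoring {U V : A} (N : Subobject V) : Submodule K (U ⟶ V) where
  carrier := { g | N.Factors g }
  add_mem' hf hg := Subobject.factors_add _ _ hf hg
  zero_mem' := Subobject.factors_zero
  smul_mem' r f hf := by
    have := Subobject.factors_of_factors_right (P := N) (f := r • 𝟙 U) hf
    simpa using this

/-- The cochains `g` of degree `n` with `g (M) ⊆ N`, where `M` and `N` are the decorations. -/
def respecting (n : ℤ) : Submodule K (Cochain X.E Y.E n) where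
  carrier := { g | ∀ (p q : ℤ) (h : p + n = q), (Y.M q).Factors ((X.M p).arrow ≫ g.v p q h) }
  add_mem' hf hg p q h := by
    simpa using Subobject.factors_add _ _ (hf p q h) (hg p q h)
  zero_mem' p q h := by simpa using Subobject.factors_zero
  smul_mem' r f hf p q h := by
    have h' : (Y.M q).Factors (r • ((X.M p).arrow ≫ f.v p q h)) :=
      (factoring K (Y.M q)).smul_mem r (hf p q h)
    simpa using h'

/-- The Hom complex of decorated complexes, in degree `n`: the cochains `g` such that both `g` and
`δ g` map the decoration of `X` to the decoration of `Y`. -/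
noncomputable def homfh (n : ℤ) : Submodule K (Cochain X.E Y.E n) :=
  respecting K X Y n ⊓ (respecting K X Y (n + 1)).comap (δ_hom K X.E Y.E n (n + 1))

/-- The decoration of the Hom complex: the cochains that vanish on the decoration of `X`, with
values in the decoration of `Y`. -/
def decHom (n : ℤ) : Submodule K (Cochain X.E Y.E n) where
  carrier := { g | ∀ (p q : ℤ) (h : p + n = q),
    (X.M p).arrow ≫ g.v p q h = 0 ∧ (Y.M q).Factors (g.v p q h) }
  add_mem' hf hg p q h := ⟨by simp [(hf p q h).1, (hg p q h).1],
    Subobject.factors_add _ _ (hf p q h).2 (hg p q h).2⟩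
  zero_mem' p q h := ⟨by simp, Subobject.factors_zero⟩
  smul_mem' r f hf p q h := ⟨by simp [(hf p q h).1],
    (factoring K (Y.M q)).smul_mem r (hf p q h).2⟩

/-- The submodule `M^n + d M^{n-1}`, where `M` is the decoration of the Hom complex. -/
noncomputable def nullHom (n : ℤ) : Submodule K (Cochain X.E Y.E n) :=
  decHom K X Y n ⊔ (decHom K X Y (n - 1)).map (δ_hom K X.E Y.E (n - 1) n)

variable {X Y Z}

variable {K}

theorem mem_homfh {n m : ℤ} (h : n + 1 = m) (g : Cochain X.E Y.E n) :
    g ∈ homfh K X Y n ↔ g ∈ respecting K X Y n ∧ δ n m g ∈ respecting K X Y m := by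
  subst h; rfl

theorem δ_mem_homfh {n m : ℤ} (h : n + 1 = m) {g : Cochain X.E Y.E n} (hg : g ∈ homfh K X Y n) :
    δ n m g ∈ homfh K X Y m := by
  rw [mem_homfh rfl, δ_δ]
  exact ⟨((mem_homfh h g).1 hg).2, Submodule.zero_mem _⟩

theorem decHom_le_respecting {n : ℤ} {g : Cochain X.E Y.E n} (hg : g ∈ decHom K X Y n) :
    g ∈ respecting K X Y n := fun p q h => by
  rw [(hg p q h).1]; exact Subobject.factors_zero

theorem decHom_le_homfh {n : ℤ} {g : Cochain X.E Y.E n} (hg : g ∈ decHom K X Y n) :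
    g ∈ homfh K X Y n := by
  refine ⟨decHom_le_respecting hg, fun p q h => ?_⟩
  change (Y.M q).Factors (_ ≫ (δ n (n + 1) g).v p q h)
  rw [δ_v n (n + 1) rfl g p q h (p + n) (p + 1) (by lia) rfl, Preadditive.comp_add,
    ← Category.assoc, (hg _ _ _).1, zero_comp, zero_add, Linear.comp_units_smul, ← Category.assoc]
  have h' : (X.M p).arrow ≫ X.E.d p (p + 1) ≫ g.v (p + 1) q (by lia) ∈ factoring K (Y.M q) := by
    rw [← Category.assoc]
    exact Subobject.factors_of_factors_right _ (hg _ _ _).2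
  rcases Int.units_eq_one_or (n + 1).negOnePow with e | e
  · rw [e, one_smul, Category.assoc]; exact h'
  · rw [e, Units.neg_smul, one_smul, Category.assoc]; exact (factoring K (Y.M q)).neg_mem h'

theorem respecting_comp {n m p : ℤ} (h : n + m = p) {f : Cochain X.E Y.E n}
    {g : Cochain Y.E Z.E m} (hf : f ∈ respecting K X Y n) (hg : g ∈ respecting K Y Z m) :
    f.comp g h ∈ respecting K X Z p := fun a b hab => by
  rw [Cochain.comp_v f g h a (a + n) b rfl (by lia), ← Category.assoc,
    ← Subobject.factorThru_arrow _ _ (hf a (a + n) rfl), Category.assoc]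
  exact Subobject.factors_of_factors_right _ (hg _ _ _)

theorem respecting_comp_decHom {n m p : ℤ} (h : n + m = p) {f : Cochain X.E Y.E n}
    {g : Cochain Y.E Z.E m} (hf : f ∈ respecting K X Y n) (hg : g ∈ decHom K Y Z m) :
    f.comp g h ∈ decHom K X Z p := fun a b hab => by
  rw [Cochain.comp_v f g h a (a + n) b rfl (by lia)]
  refine ⟨?_, Subobject.factors_of_factors_right _ (hg _ _ _).2⟩
  rw [← Category.assoc, ← Subobject.factorThru_arrow _ _ (hf a (a + n) rfl), Category.assoc,
    (hg _ _ _).1, comp_zero]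

theorem decHom_comp_respecting {n m p : ℤ} (h : n + m = p) {f : Cochain X.E Y.E n}
    {g : Cochain Y.E Z.E m} (hf : f ∈ decHom K X Y n) (hg : g ∈ respecting K Y Z m) :
    f.comp g h ∈ decHom K X Z p := fun a b hab => by
  rw [Cochain.comp_v f g h a (a + n) b rfl (by lia)]
  refine ⟨by rw [← Category.assoc, (hf _ _ _).1, zero_comp], ?_⟩
  rw [← Subobject.factorThru_arrow _ _ (hf a (a + n) rfl).2, Category.assoc]
  exact Subobject.factors_of_factors_right _ (hg _ _ _)

theorem homfh_comp {n m p : ℤ} (h : n + m = p) {f : Cochain X.E Y.E n}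
    {g : Cochain Y.E Z.E m} (hf : f ∈ homfh K X Y n) (hg : g ∈ homfh K Y Z m) :
    f.comp g h ∈ homfh K X Z p := by
  refine (mem_homfh rfl _).2 ⟨respecting_comp h hf.1 hg.1, ?_⟩
  rw [δ_comp f g h (n + 1) (m + 1) (p + 1) rfl rfl rfl, Units.smul_def]
  exact Submodule.add_mem _ (respecting_comp _ hf.1 hg.2)
    (Submodule.smul_of_tower_mem _ _ (respecting_comp _ hf.2 hg.1))

theorem id_mem_homfh : Cochain.ofHom (𝟙 X.E) ∈ homfh K X X 0 := by
  refine (mem_homfh (zero_add 1) _).2 ⟨fun p q h => ?_, ?_⟩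
  · obtain rfl : p = q := by lia
    simpa using Subobject.factors_self _
  · rw [δ_ofHom]; exact Submodule.zero_mem _

theorem decHom_le_nullHom {n : ℤ} {g : Cochain X.E Y.E n} (hg : g ∈ decHom K X Y n) :
    g ∈ nullHom K X Y n := Submodule.mem_sup_left hg

theorem δ_mem_nullHom {n m : ℤ} (h : n + 1 = m) {g : Cochain X.E Y.E n}
    (hg : g ∈ decHom K X Y n) : δ n m g ∈ nullHom K X Y m := by
  obtain rfl : n = m - 1 := by lia
  exact Submodule.mem_sup_right (Submodule.mem_map_of_mem (f := δ_hom K X.E Y.E (m - 1) m) hg)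

theorem nullHom_cases {n : ℤ} {g : Cochain X.E Y.E n} (hg : g ∈ nullHom K X Y n) :
    ∃ a ∈ decHom K X Y n, ∃ b ∈ decHom K X Y (n - 1), g = a + δ (n - 1) n b := by
  obtain ⟨a, ha, _, ⟨b, hb, rfl⟩, rfl⟩ := Submodule.mem_sup.1 hg
  exact ⟨a, ha, b, hb, rfl⟩

theorem nullHom_d {n m : ℤ} (h : n + 1 = m) {g : Cochain X.E Y.E n} (hg : g ∈ nullHom K X Y n) :
    δ n m g ∈ nullHom K X Y m := by
  obtain ⟨a, ha, b, hb, rfl⟩ := nullHom_cases hg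
  rw [δ_add, δ_δ, add_zero]
  exact δ_mem_nullHom h ha

theorem homfh_comp_nullHom {n m p : ℤ} (h : n + m = p) {f : Cochain X.E Y.E n}
    {g : Cochain Y.E Z.E m} (hf : f ∈ homfh K X Y n) (hg : g ∈ nullHom K Y Z m) :
    f.comp g h ∈ nullHom K X Z p := by
  obtain ⟨a, ha, b, hb, rfl⟩ := nullHom_cases hg
  rw [Cochain.comp_add]
  refine Submodule.add_mem _ (decHom_le_nullHom (respecting_comp_decHom h hf.1 ha)) ?_
  have e := δ_comp f b (n₁₂ := p - 1) (by lia) (n + 1) m p (by lia) rfl (by lia)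
  rw [← sub_eq_iff_eq_add] at e
  rw [← e, Units.smul_def]
  exact Submodule.sub_mem _ (δ_mem_nullHom (by lia) (respecting_comp_decHom _ hf.1 hb))
    (Submodule.smul_of_tower_mem _ _ (decHom_le_nullHom (respecting_comp_decHom _ hf.2 hb)))

theorem nullHom_comp_homfh {n m p : ℤ} (h : n + m = p) {f : Cochain X.E Y.E n}
    {g : Cochain Y.E Z.E m} (hf : f ∈ nullHom K X Y n) (hg : g ∈ homfh K Y Z m) :
    f.comp g h ∈ nullHom K X Z p := by
  obtain ⟨a, ha, b, hb, rfl⟩ := nullHom_cases hf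
  rw [Cochain.add_comp]
  refine Submodule.add_mem _ (decHom_le_nullHom (decHom_comp_respecting h ha hg.1)) ?_
  have e := δ_comp b g (n₁₂ := p - 1) (by lia) n (m + 1) p (by lia) (by lia) rfl
  rw [← sub_eq_iff_eq_add'] at e
  have e' := congrArg (m.negOnePow • ·) e
  simp only [smul_smul, Int.units_mul_self, one_smul] at e'
  rw [← e', Units.smul_def]
  exact Submodule.smul_of_tower_mem _ _ (Submodule.sub_mem _
    (δ_mem_nullHom (by lia) (decHom_comp_respecting _ hb hg.1))
    (decHom_le_nullHom (decHom_comp_respecting _ hb hg.2)))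

end

/-- The Hom modules of the DG category of decorated complexes:
`homfh^n / (M^n + d M^{n-1})`, where `M` is the decoration of `homfh`. -/
abbrev QHom (K : Type w) [CommRing K] [Linear K A] (X Y : Decorated A) (n : ℤ) : Type v :=
  homfh K X Y n ⧸ (nullHom K X Y n).comap (homfh K X Y n).subtype

section

variable {K : Type w} [CommRing K] [Linear K A] {X Y Z : Decorated A}

/-- The class of an element of the Hom complex. -/
noncomputable def QHom.mk {n : ℤ} (g : homfh K X Y n) : QHom K X Y n := Submodule.Quotient.mk g

/-- The differential of `homfh`. -/
noncomputable def homfhD {n m : ℤ} (h : n + 1 = m) : homfh K X Y n →ₗ[K] homfh K X Y m :=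
  (δ_hom K X.E Y.E n m).restrict fun _ hg => δ_mem_homfh h hg

/-- The composition of `homfh`. -/
noncomputable def homfhComp {n m p : ℤ} (h : n + m = p) :
    homfh K X Y n →ₗ[K] homfh K Y Z m →ₗ[K] homfh K X Z p :=
  LinearMap.mk₂ K (fun f g => ⟨f.1.comp g.1 h, homfh_comp h f.2 g.2⟩)
    (fun _ _ _ => Subtype.ext (Cochain.add_comp _ _ _ h))
    (fun _ _ _ => Subtype.ext (Cochain.smul_comp _ _ _ h))
    (fun _ _ _ => Subtype.ext (Cochain.comp_add _ _ _ h))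
    (fun _ _ _ => Subtype.ext (Cochain.comp_smul _ _ _ h))

/-- The differential of the quotient. -/
noncomputable def QHom.d {n m : ℤ} (h : n + 1 = m) : QHom K X Y n →ₗ[K] QHom K X Y m :=
  Submodule.mapQ _ _ (homfhD h) fun _ hg => nullHom_d h hg

/-- The composition of the quotient. -/
noncomputable def QHom.comp {n m p : ℤ} (h : n + m = p) :
    QHom K X Y n →ₗ[K] QHom K Y Z m →ₗ[K] QHom K X Z p :=
  Submodule.liftQ _ (LinearMap.flip (Submodule.liftQ _
    ((homfhComp (K := K) (X := X) (Y := Y) (Z := Z) h).compr₂ (Submodule.mkQ _)).flip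
    (fun g hg => LinearMap.ext fun f =>
      (Submodule.Quotient.mk_eq_zero _).2 (homfh_comp_nullHom h f.2 hg))))
    (fun f hf => LinearMap.ext fun g => by
      obtain ⟨g, rfl⟩ := Submodule.Quotient.mk_surjective _ g
      exact (Submodule.Quotient.mk_eq_zero _).2 (nullHom_comp_homfh h hf g.2))

theorem QHom.exists_mk {n : ℤ} (x : QHom K X Y n) : ∃ g, QHom.mk g = x :=
  Submodule.Quotient.mk_surjective _ x

theorem QHom.d_mk {n m : ℤ} (h : n + 1 = m) (g : homfh K X Y n) :
    QHom.d h (QHom.mk g) = QHom.mk (homfhD h g) := rfl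

theorem QHom.comp_mk {n m p : ℤ} (h : n + m = p) (f : homfh K X Y n) (g : homfh K Y Z m) :
    QHom.comp h (QHom.mk f) (QHom.mk g) = QHom.mk (homfhComp h f g) := rfl

end

end Decorated

/-- The DG category `Ch(A, T, F)`: its objects are the decorated complexes that are compatible with
the torsion pair, and its Hom complexes are the quotients `homfh / (M + dM)`. -/
noncomputable def dgDecorated (K : Type w) [CommRing K] [Linear K A] (t : TorsionPair A) :
    DGCategory.{w, v, max u v} K where
  Obj := { X : Decorated A // X.IsCompatible t }
  Hom X Y n := Decorated.QHom K X.1 Y.1 n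
  d := Decorated.QHom.d
  comp := Decorated.QHom.comp
  id X := Decorated.QHom.mk ⟨Cochain.ofHom (𝟙 X.1.E), Decorated.id_mem_homfh⟩
  d_d h h' f := by
    obtain ⟨f, rfl⟩ := f.exists_mk
    exact congrArg Decorated.QHom.mk (Subtype.ext (δ_δ _ _ _ f.1))
  d_comp h hn hm hp f g := by
    obtain ⟨f, rfl⟩ := f.exists_mk
    obtain ⟨g, rfl⟩ := g.exists_mk
    exact congrArg Decorated.QHom.mk (Subtype.ext (δ_comp f.1 g.1 h _ _ _ hp hn hm))
  d_id X n h := congrArg Decorated.QHom.mk (Subtype.ext (δ_ofHom (𝟙 X.1.E)))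
  id_comp f := by
    obtain ⟨f, rfl⟩ := f.exists_mk
    exact congrArg Decorated.QHom.mk (Subtype.ext (Cochain.id_comp f.1))
  comp_id f := by
    obtain ⟨f, rfl⟩ := f.exists_mk
    exact congrArg Decorated.QHom.mk (Subtype.ext (Cochain.comp_id f.1))
  assoc h₁ h₂ h₁' _ f g h := by
    obtain ⟨f, rfl⟩ := f.exists_mk
    obtain ⟨g, rfl⟩ := g.exists_mk
    obtain ⟨h, rfl⟩ := h.exists_mk
    exact congrArg Decorated.QHom.mk
      (Subtype.ext (Cochain.comp_assoc f.1 g.1 h.1 h₁ h₂ (by lia)))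

namespace Decorated

section

variable {X Y : Decorated A}

theorem ofHom_mem_homfh {K : Type w} [CommRing K] [Linear K A] {f : X.E ⟶ Y.E}
    (hf : RespectsHom f) : Cochain.ofHom f ∈ homfh K X Y 0 := by
  refine (mem_homfh (zero_add 1) _).2 ⟨fun p q h => ?_, ?_⟩
  · obtain rfl : p = q := by lia
    simpa using hf p
  · rw [δ_ofHom]; exact Submodule.zero_mem _

/-- The morphism of two-term complexes induced by a chain map that respects the decorations. -/
noncomputable def termMap (f : X.E ⟶ Y.E) (hf : RespectsHom f) (n : ℤ) :
    StrictHom (X.term n) (Y.term n) where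
  left := (Y.M n).factorThru _ (hf n)
  right := cokernel.map _ _ ((Y.M (n + 1)).factorThru _ (hf (n + 1))) (f.f (n + 1))
    (Subobject.factorThru_arrow _ _ _).symm
  comm := by simp [term]

/-- A chain map that respects the decorations belongs to the class `S_sis` if it induces
isomorphisms on all the `H^{-1,n}` and `H^{0,n}`. -/
def IsSis (f : X.E ⟶ Y.E) (hf : RespectsHom f) : Prop :=
  ∀ n : ℤ,
    IsIso (kernel.map (X.term n).d (Y.term n).d (termMap f hf n).left (termMap f hf n).right
      (termMap f hf n).comm.symm) ∧
    IsIso (cokernel.map (X.term n).d (Y.term n).d (termMap f hf n).left (termMap f hf n).right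
      (termMap f hf n).comm.symm)

/-- The morphism of two-term complexes, with components `(-1)^k g` on `M p` and `g` on
`E.X (p + 1) / M (p + 1)`, that is induced by an element `g` of `homfh^k`. -/
noncomputable def strictOf {K : Type w} [CommRing K] [Linear K A] {k : ℤ} (g : homfh K X Y k)
    (p q : ℤ) (h : p + k = q) : StrictHom (X.term p) (Y.term q) where
  left := k.negOnePow • (Y.M q).factorThru _ (g.2.1 p q h)
  right := cokernel.map _ _
    ((Y.M (q + 1)).factorThru _ (g.2.1 (p + 1) (q + 1) (by lia))) (g.1.v (p + 1) (q + 1) (by lia))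
    (Subobject.factorThru_arrow _ _ _).symm
  comm := by
    have h₁ : (Y.M (q + 1)).Factors ((X.M p).arrow ≫ (δ k (k + 1) g.1).v p (q + 1) (by lia)) :=
      g.2.2 p (q + 1) (by lia)
    have h₂ : ((X.M p).arrow ≫ (δ k (k + 1) g.1).v p (q + 1) (by lia)) ≫
        cokernel.π (Y.M (q + 1)).arrow = 0 := by
      rw [← Subobject.factorThru_arrow _ _ h₁, Category.assoc, cokernel.condition, comp_zero]
    rw [δ_v k (k + 1) rfl g.1 p (q + 1) (by lia) q (p + 1) (by lia) rfl] at h₂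
    have h₃ : (k + 1).negOnePow = -k.negOnePow := Int.negOnePow_succ k
    rw [h₃] at h₂
    simp only [term]
    rcases Int.units_eq_one_or k.negOnePow with e | e
    · simp [e] at h₂ ⊢
      exact add_neg_eq_zero.1 h₂
    · simp [e] at h₂ ⊢
      exact neg_eq_iff_add_eq_zero.2 h₂

end

/-- The butterfly from `[M n → E.X (n + 1) / M (n + 1)]` to
`[M (n + 1) → E.X (n + 2) / M (n + 2)]` with middle object `E.X (n + 1)`. -/
noncomputable def butterfly (X : Decorated A) (n : ℤ) :
    Butterfly (X.term n) (X.term (n + 1)) where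
  E := X.E.X (n + 1)
  κ := (X.M n).arrow ≫ X.E.d n (n + 1)
  ι := (X.M (n + 1)).arrow
  σ := cokernel.π (X.M (n + 1)).arrow
  ρ := X.E.d (n + 1) (n + 1 + 1) ≫ cokernel.π (X.M (n + 1 + 1)).arrow
  κσ := Category.assoc _ _ _
  ιρ := rfl
  κρ := (by simp : ((X.M n).arrow ≫ X.E.d n (n + 1)) ≫ X.E.d (n + 1) (n + 1 + 1) ≫
    cokernel.π (X.M (n + 1 + 1)).arrow = 0)
  ισ := cokernel.condition _
  exact :=
    { exact := ShortComplex.exact_cokernel _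
      mono_f := inferInstanceAs (Mono (X.M (n + 1)).arrow)
      epi_g := inferInstanceAs (Epi (cokernel.π (X.M (n + 1)).arrow)) }

end Decorated

variable {t : TorsionPair A}

/-- The object `[M n → E.X (n + 1) / M (n + 1)]` of the tilted category. -/
noncomputable def tiltTerm (X : { X : Decorated A // X.IsCompatible t }) (n : ℤ) : Tilt t :=
  ⟨X.1.term n, (X.2 n).1, (X.2 n).2⟩

/-- The complex in the tilted category of a compatible decorated complex. -/
noncomputable def tiltComplex (X : { X : Decorated A // X.IsCompatible t }) :
    CochainComplex (Tilt t) ℤ :=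
  CochainComplex.of (tiltTerm X) (fun n => BHom.mk (X.1.butterfly n)) fun n =>
    BHom.sound (Butterfly.comp_iso_zero (X.1.butterfly n) (X.1.butterfly (n + 1))
      (X.1.E.d (n + 1) (n + 1 + 1)) rfl rfl
      (by simp : ((X.1.M n).arrow ≫ X.1.E.d n (n + 1)) ≫ X.1.E.d (n + 1) (n + 1 + 1) = 0)
      (by simp : X.1.E.d (n + 1) (n + 1 + 1) ≫ X.1.E.d (n + 1 + 1) (n + 1 + 1 + 1) ≫
        cokernel.π (X.1.M (n + 1 + 1 + 1)).arrow = 0))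

/-- The cochain of complexes in the tilted category that is induced by an element of `homfh^k`. -/
noncomputable def tiltCochain {K : Type w} [CommRing K] [Linear K A]
    {X Y : { X : Decorated A // X.IsCompatible t }} {k : ℤ} (g : Decorated.homfh K X.1 Y.1 k) :
    Cochain (tiltComplex X) (tiltComplex Y) k :=
  Cochain.mk fun p q h => BHom.ofStrict (Decorated.strictOf g p q h)

/-- The localizing class `S_sis`, in the DG category `Ch(A, T, F)`. -/
def sis (K : Type w) [CommRing K] [Linear K A] (t : TorsionPair A)
    {X Y : (dgDecorated K t).Obj} (s : (dgDecorated K t).Hom X Y 0) : Prop :=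
  ∃ (f : X.1.E ⟶ Y.1.E) (hf : Decorated.RespectsHom f), Decorated.IsSis f hf ∧
    s = Decorated.QHom.mk ⟨Cochain.ofHom f, Decorated.ofHom_mem_homfh hf⟩

/-- An object `[X⁻¹ → X⁰]` of the tilted category is semi-projective if `X⁰` is projective. -/
def Tilt.SemiProjective (Z : Tilt t) : Prop := Projective Z.obj.right

/-- An object `[X⁻¹ → X⁰]` of the tilted category is semi-injective if `X⁻¹` is injective. -/
def Tilt.SemiInjective (Z : Tilt t) : Prop := Injective Z.obj.left

/-- The terms of the complex in the tilted category are semi-projective. -/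
def IsSemiProjective (X : { X : Decorated A // X.IsCompatible t }) : Prop :=
  ∀ n : ℤ, ((tiltComplex X).X n).SemiProjective

/-- The terms of the complex in the tilted category are semi-injective. -/
def IsSemiInjective (X : { X : Decorated A // X.IsCompatible t }) : Prop :=
  ∀ n : ℤ, ((tiltComplex X).X n).SemiInjective

end

end Tilting

-- A degree `k` element of a Hom complex of complexes in `B` is an arbitrary family of butterflies
-- between terms, so the theorem rests on a few facts about single butterflies. A strict morphism
-- whose butterfly is zero is null-homotopic, through a map `X⁰ → Y⁻¹` (`exists_homotopy`). A
-- butterfly is strict as soon as its diagonal `Y⁻¹ → E → X⁰` splits (`exists_iso_ofStrict`), which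
-- is automatic if `X⁰` is projective or `Y⁻¹` is injective. It is invertible exactly when its other
-- diagonal `X⁻¹ → E → Y⁰` is short exact (`comp_flip`, `shortExact_of_comp_iso_id`). For a strict
-- morphism that diagonal is the mapping cone, so invertible means quasi-isomorphism
-- (`isIso_ofStrict_iff`). Two butterflies compose to zero only if a map of their middle objects
-- links them (`exists_link`).
--
-- The functor `G` commutes with differentials because the `n`-th differential of `G X` has middle
-- object `E^(n+1)`: a component of `g` is itself a map of middle objects, and the resulting square
-- with two strict sides commutes up to the strict morphism of `dg` (`comp_butterfly`).
--
-- `G` is injective on Hom complexes for all objects: the homotopies `E^(p+1)/M^(p+1) → N^(p+k)` of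
-- a family that becomes zero assemble to an element `b` of `M^(k-1)`, and `g - db` lies in `M^k`
-- (`mem_nullHom_of_homotopy`). If the source is semi-projective or the target semi-injective, every
-- butterfly between terms is strict, and prescribed maps on decorations and on quotients lift to
-- maps of the `E^n`; so `G` is bijective (`tiltMap_bijective`).
--
-- For essential surjectivity, the links between consecutive differentials of a complex in `B`
-- become the differentials of `E`. The composite of two links factors as a map `X⁰ → Y⁻¹` killed by
-- both differentials, hence through a map from an object of `T` to an object of `F`, and vanishes
-- (`eq_zero_of_comp_d`, `exists_linkage`). The same vanishing shows that a closed morphism of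
-- degree `0` is the class of a chain map, so that `S_sis` is the class inverted by `G`
-- (`sis_iff_isIso`). Terms can be replaced beforehand by quasi-isomorphic ones with projective `X⁰`
-- or injective `X⁻¹`.
--
-- The remaining assertions about resolutions and derived Hom follow formally from these three
-- inputs (`IsLeftDerivedEquivalence.of_bijective` and its dual).

universe u₁ v₁ u₂ v₂

namespace Tilting


/-! ### Butterflies: inverses, strictness, homotopies, links, twists -/

section Butterflies

variable {A : Type u} [Category.{v} A] [Abelian A] {X Y Z : TwoTerm A}

/-- The negative of a strict morphism. -/
def StrictHom.neg (f : StrictHom X Y) : StrictHom X Y := ⟨-f.left, -f.right, by simp [f.comm]⟩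

namespace Butterfly

attribute [local simp] pullback.lift_fst pullback.lift_snd pullback.lift_fst_assoc
  pullback.lift_snd_assoc

theorem exists_κ (P : Butterfly X Y) (h : (ShortComplex.mk P.κ P.ρ P.κρ).ShortExact) {T : A}
    (x : T ⟶ P.E) (hx : x ≫ P.ρ = 0) : ∃ y : T ⟶ X.left, y ≫ P.κ = x :=
  have : Mono (ShortComplex.mk P.κ P.ρ P.κρ).f := h.mono_f
  ⟨h.exact.lift x hx, h.exact.lift_f x hx⟩

/-- The butterfly with the two diagonals exchanged. -/
def flip (P : Butterfly X Y) (h : (ShortComplex.mk P.κ P.ρ P.κρ).ShortExact) : Butterfly Y X where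
  E := P.E
  κ := P.ι
  ι := P.κ
  σ := P.ρ
  ρ := P.σ
  κσ := P.ιρ
  ιρ := P.κσ
  κρ := P.ισ
  ισ := P.κρ
  exact := h

/-- Two elements `a`, `b` of the middle object with the same image in `Y⁰` differ by a unique
element `l` of `X⁻¹`. The assignment `(a, b) ↦ (σ a, l)` kills the diagonal and identifies the
composite with `X⁰ ⊕ X⁻¹`. Hence a butterfly whose second diagonal is short exact has its flip as
inverse. -/
theorem comp_flip (P : Butterfly X Y) (h : (ShortComplex.mk P.κ P.ρ P.κρ).ShortExact) :
    Iso (P.comp (P.flip h)) (ofStrict (StrictHom.id X)) := by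
  let a : pullback P.ρ (P.flip h).σ ⟶ P.E := pullback.fst _ _
  let b : pullback P.ρ (P.flip h).σ ⟶ P.E := pullback.snd _ _
  have hab : a ≫ P.ρ = b ≫ P.ρ := pullback.condition (f := P.ρ) (g := (P.flip h).σ)
  obtain ⟨l, hl⟩ := P.exists_κ h (b - a) (by rw [Preadditive.sub_comp, hab, sub_self])
  have hm : Mono P.κ := h.mono_f
  have d₁ : compDiag P (P.flip h) ≫ a = P.ι := compDiag_fst _ _
  have d₂ : compDiag P (P.flip h) ≫ b = P.ι := compDiag_snd _ _
  have k₁ : pullback.lift P.κ (0 : _ ⟶ (P.flip h).E) (by simp) ≫ a = P.κ := pullback.lift_fst _ _ _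
  have k₂ : pullback.lift P.κ (0 : _ ⟶ (P.flip h).E) (by simp) ≫ b = 0 := pullback.lift_snd _ _ _
  have i₁ : pullback.lift (0 : _ ⟶ P.E) (P.flip h).ι (by simp) ≫ a = 0 := pullback.lift_fst _ _ _
  have i₂ : pullback.lift (0 : _ ⟶ P.E) (P.flip h).ι (by simp) ≫ b = P.κ :=
    pullback.lift_snd _ _ _
  refine comp_iso_of (a ≫ P.σ ≫ inS _ + l ≫ (ofStrict _).ι) ?_ ?_ ?_ ?_ ?_
  · have h₀ : compDiag P (P.flip h) ≫ l = 0 := by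
      rw [← cancel_mono P.κ, Category.assoc, hl, Preadditive.comp_sub, d₁, d₂]
      simp
    rw [Preadditive.comp_add, ← Category.assoc, ← Category.assoc _ l, d₁, h₀]
    simp
  · have h₀ : pullback.lift P.κ (0 : _ ⟶ (P.flip h).E) (by simp) ≫ l = -𝟙 _ := by
      rw [← cancel_mono P.κ, Category.assoc, hl, Preadditive.comp_sub, k₁, k₂]
      simp
    rw [Preadditive.comp_add, ← Category.assoc, ← Category.assoc _ l, k₁, h₀, κ_eq]
    simp [sub_eq_add_neg]
  · have h₀ : pullback.lift (0 : _ ⟶ P.E) (P.flip h).ι (by simp) ≫ l = 𝟙 _ := by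
      rw [← cancel_mono P.κ, Category.assoc, hl, Preadditive.comp_sub, i₁, i₂]
      simp
    rw [Preadditive.comp_add, ← Category.assoc, ← Category.assoc _ l, i₁, h₀]
    simp
  · rw [Preadditive.add_comp, Category.assoc, Category.assoc, inS_σ, Category.comp_id,
      Category.assoc, ισ, comp_zero, _root_.add_zero]
  · simp only [Preadditive.add_comp, Category.assoc, inS_ρ, ιρ, StrictHom.id_right,
      Category.comp_id]
    rw [← P.κσ, ← Category.assoc l, hl, Preadditive.sub_comp, add_sub_cancel]
    rfl

theorem ofStrict_id_shortExact :
    (ShortComplex.mk (ofStrict (StrictHom.id X)).κ (ofStrict (StrictHom.id X)).ρ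
      (ofStrict (StrictHom.id X)).κρ).ShortExact :=
  ShortComplex.Splitting.shortExact
    -- The sign compensates for the component `-𝟙` of `κ` on `X⁻¹`.
    { r := -prS (StrictHom.id X), s := inS (StrictHom.id X)
      f_r := by simp
      s_g := by simp
      id := by
        simp only [κ_eq, ρ_eq]
        rw [← totS]
        simp
        abel }

theorem shortExact_of_iso {P P' : Butterfly X Y} (e : Iso P P')
    (h : (ShortComplex.mk P.κ P.ρ P.κρ).ShortExact) :
    (ShortComplex.mk P'.κ P'.ρ P'.κρ).ShortExact := by
  obtain ⟨e, h₁, -, -, h₄⟩ := e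
  exact ShortComplex.shortExact_of_iso (ShortComplex.isoMk (S₁ := ShortComplex.mk P.κ P.ρ P.κρ)
    (S₂ := ShortComplex.mk P'.κ P'.ρ P'.κρ) (CategoryTheory.Iso.refl _) e
    (CategoryTheory.Iso.refl _) (by simp [h₁]) (by simp [h₄])) h

theorem mono_κ_of_comp {P : Butterfly X Y} {Q : Butterfly Y Z} (h : Mono (comp P Q).κ) :
    Mono P.κ := by
  refine Preadditive.mono_of_cancel_zero _ fun {T} x hx => ?_
  have h₀ : x ≫ (comp P Q).κ = 0 := by
    rw [comp_κ, precomp_compMk, compMk_eq_zero_iff]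
    exact ⟨0, by simp [hx], by simp⟩
  rw [← cancel_mono (comp P Q).κ, h₀, zero_comp]

/-- The diagonal `X⁻¹ → E → Y⁰` of an invertible butterfly is short exact. -/
theorem shortExact_of_comp_iso_id {P : Butterfly X Y} {Q : Butterfly Y X}
    (h : Iso (P.comp Q) (ofStrict (StrictHom.id X)))
    (h' : Iso (Q.comp P) (ofStrict (StrictHom.id Y))) :
    (ShortComplex.mk P.κ P.ρ P.κρ).ShortExact := by
  have hX := shortExact_of_iso h.symm ofStrict_id_shortExact
  have hY := shortExact_of_iso h'.symm ofStrict_id_shortExact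
  have hP : Mono P.κ := mono_κ_of_comp hX.mono_f
  have hQ : Mono Q.κ := mono_κ_of_comp hY.mono_f
  refine { exact := ?_, mono_f := hP, epi_g := ?_ }
  · rw [ShortComplex.exact_iff_exact_up_to_refinements]
    intro T x hx
    dsimp at x hx ⊢
    -- An element `x` killed by `ρ` gives the class of `(x, 0)` in the composite, which is killed by
    -- the outer `ρ` and hence comes from some `y` in `X⁻¹`. Then `(κ y - x, 0)` is the diagonal
    -- image of some `z`, and `z = 0` because `Q.κ` is mono.
    obtain ⟨y, hy⟩ := exists_κ _ hX (compMk x (0 : T ⟶ Q.E) (by simp [hx])) (by simp)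
    rw [comp_κ, precomp_compMk, ← sub_eq_zero, sub_eq_add_neg, compMk_neg, compMk_add,
      compMk_eq_zero_iff] at hy
    obtain ⟨z, hz, hz'⟩ := hy
    have : z = 0 := by rw [← cancel_mono Q.κ, hz']; simp
    refine ⟨T, 𝟙 _, inferInstance, y, ?_⟩
    rw [this, zero_comp] at hz
    rw [Category.id_comp, eq_comm, ← sub_eq_zero, sub_eq_add_neg, ← hz]
  · refine epi_of_surj _ fun {T} y => ?_
    have := hY.epi_g
    dsimp at this
    obtain ⟨T₁, π₁, _, c, hc⟩ := surjective_up_to_refinements_of_epi (comp Q P).ρ y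
    obtain ⟨T₂, π₂, _, a, b, hab, h₂⟩ := comp_surj c
    exact ⟨T₂, π₂ ≫ π₁, inferInstance, b, by
      rw [Category.assoc, hc, ← Category.assoc, h₂, compMk_ρ]⟩

/-- A butterfly whose short exact diagonal splits comes from a strict morphism. -/
theorem exists_iso_ofStrict (P : Butterfly X Y) (s : X.right ⟶ P.E) (hs : s ≫ P.σ = 𝟙 _) :
    ∃ f : StrictHom X Y, Iso P (ofStrict f) := by
  -- `κ` and `d` followed by the section agree after `σ`, so they differ by a map to `Y⁻¹`. This map
  -- is the left component, with the sign that `κ` has in `ofStrict`.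
  obtain ⟨y, hy⟩ := P.exists_ι (X.d ≫ s - P.κ) (by simp [hs])
  have hκ : P.κ = X.d ≫ s - y ≫ P.ι := by rw [hy]; abel
  let f : StrictHom X Y :=
    { left := y
      right := s ≫ P.ρ
      comm := by rw [← P.ιρ, ← Category.assoc, hy]; simp }
  refine ⟨f, Iso.symm (Iso.of_hom ((ofStrict f).σ ≫ s + prS f ≫ P.ι) ?_ ?_ ?_ ?_)⟩
  · rw [Preadditive.comp_add, ← Category.assoc, ← Category.assoc, κσ, κ_prS, hκ]
    simp [f, sub_eq_add_neg]
  · rw [Preadditive.comp_add, ← Category.assoc, ← Category.assoc, ισ, ι_prS]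
    simp
  · simp [hs]
  · rw [ρ_eq]
    simp [f]

/-- An isomorphism between two copies of `X⁰ ⊕ Y⁻¹` that respects `ι` and `σ` is a shear, determined
by its off-diagonal entry `X⁰ → Y⁻¹`. Its compatibility with `κ` and `ρ` says that this entry is a
null-homotopy. -/
theorem exists_homotopy {f : StrictHom X Y}
    (e : Iso (ofStrict f) (ofStrict (StrictHom.zero X Y))) :
    ∃ h : X.right ⟶ Y.left, f.left = X.d ≫ h ∧ f.right = h ≫ Y.d := by
  obtain ⟨e, h₁, h₂, -, h₄⟩ := e
  refine ⟨inS f ≫ e.hom ≫ prS _, ?_, ?_⟩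
  · have := h₁ =≫ prS _
    rw [κ_prS, κ_eq] at this
    have hι : (ofStrict f).ι ≫ e.hom ≫ prS _ = 𝟙 _ := by rw [← Category.assoc, h₂, ι_prS]
    simp only [Preadditive.sub_comp, Category.assoc, hι] at this
    simpa using (sub_eq_zero.1 (this.trans (by simp))).symm
  · have := inS f ≫= h₄
    rw [ρ_eq, inS_ρ] at this
    simpa using this.symm

/-- If a composition is zero, then the two butterflies are linked. -/
theorem exists_link {P : Butterfly X Y} {Q : Butterfly Y Z}
    (e : Iso (P.comp Q) (ofStrict (StrictHom.zero X Z))) :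
    ∃ δ : P.E ⟶ Q.E, P.ι ≫ δ = Q.κ ∧ δ ≫ Q.σ = P.ρ ∧ P.κ ≫ δ = 0 ∧ δ ≫ Q.ρ = 0 := by
  obtain ⟨e, h₁, h₂, h₃, h₄⟩ := e
  -- The isomorphism of the composite with `X⁰ ⊕ Z⁻¹` has a component `r` in `Z⁻¹`, which sends `(0,
  -- ι z)` to `z`. So `(x, y) ↦ y - ι r(x, y)` depends only on `x`, and descends along the first
  -- projection to the link.
  let r : pullback P.ρ Q.σ ⟶ Z.left := compq P Q ≫ e.hom ≫ prS _
  let φ : pullback P.ρ Q.σ ⟶ Q.E := pullback.snd _ _ - r ≫ Q.ι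
  have r₁ : compDiag P Q ≫ r = 0 := by
    simp only [r]
    rw [← Category.assoc, compDiag_compq, zero_comp]
  have r₂ : pullback.lift P.κ 0 (by simp) ≫ r = 0 := by
    have := h₁ =≫ prS _
    rw [κ_prS, comp_κ, compMk] at this
    simpa using this
  have r₃ : pullback.lift 0 Q.ι (by simp) ≫ r = 𝟙 _ := by
    have := h₂ =≫ prS _
    rw [ι_prS, comp_ι, compMk] at this
    simpa using this
  have r₄ : r ≫ Z.d = pullback.snd _ _ ≫ Q.ρ := by
    have := compq P Q ≫= h₄
    rw [compq_ρ, ρ_eq] at this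
    simpa [r] using this
  have w : kernel.ι (pullback.fst P.ρ Q.σ) ≫ φ = 0 := by
    obtain ⟨z, hz⟩ := Q.exists_ι (kernel.ι (pullback.fst P.ρ Q.σ) ≫ pullback.snd _ _) (by
      rw [Category.assoc, ← pullback.condition, ← Category.assoc, kernel.condition, zero_comp])
    have : kernel.ι (pullback.fst P.ρ Q.σ) = z ≫ pullback.lift 0 Q.ι (by simp) :=
      pullback.hom_ext (by simp) (by simp [hz])
    simp only [φ, Preadditive.comp_sub]
    rw [← hz, this, Category.assoc, reassoc_of% r₃, sub_self]
  have hδ : pullback.fst P.ρ Q.σ ≫ Abelian.epiDesc (pullback.fst P.ρ Q.σ) φ w = φ :=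
    Abelian.comp_epiDesc _ _ _
  refine ⟨Abelian.epiDesc (pullback.fst P.ρ Q.σ) φ w, ?_, ?_, ?_, ?_⟩
  · rw [← compDiag_fst P Q, Category.assoc, hδ]
    simp only [φ, Preadditive.comp_sub, compDiag_snd]
    rw [← Category.assoc, r₁, zero_comp, sub_zero]
  · rw [← cancel_epi (pullback.fst P.ρ Q.σ), ← Category.assoc, hδ, pullback.condition]
    simp [φ]
  · have : pullback.lift P.κ 0 (by simp) ≫ pullback.fst P.ρ Q.σ = P.κ := pullback.lift_fst _ _ _
    rw [← this, Category.assoc, hδ]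
    simp only [φ, Preadditive.comp_sub]
    rw [← Category.assoc, r₂]
    simp
  · rw [← cancel_epi (pullback.fst P.ρ Q.σ), ← Category.assoc, hδ]
    simp [φ, r₄]

/-- The butterfly `P` with `κ` and `ρ` modified by a strict morphism. -/
def twist (P : Butterfly X Y) (w : StrictHom X Y) : Butterfly X Y where
  E := P.E
  κ := P.κ - w.left ≫ P.ι
  ι := P.ι
  σ := P.σ
  ρ := P.ρ + P.σ ≫ w.right
  κσ := by simp
  ιρ := by simp
  κρ := by simp [w.comm]
  ισ := P.ισ
  exact := P.exact

/-- The criterion `comp_iso_of` with the arrows of the twist written out in terms of those of `R`,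
so that the goals can be rewritten directly. -/
theorem comp_iso_twist_of {P : Butterfly X Y} {Q : Butterfly Y Z} {R : Butterfly X Z}
    (w : StrictHom X Z) (φ : pullback P.ρ Q.σ ⟶ R.E) (h₀ : compDiag P Q ≫ φ = 0)
    (hκ : pullback.lift P.κ 0 (by simp) ≫ φ = R.κ - w.left ≫ R.ι)
    (hι : pullback.lift 0 Q.ι (by simp) ≫ φ = R.ι)
    (hσ : φ ≫ R.σ = pullback.fst _ _ ≫ P.σ)
    (hρ : φ ≫ (R.ρ + R.σ ≫ w.right) = pullback.snd _ _ ≫ Q.ρ) :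
    Iso (comp P Q) (R.twist w) :=
  comp_iso_of (R := R.twist w) φ h₀ hκ hι hσ hρ

theorem add_iso_twist_of {P P' R : Butterfly X Y} (w : StrictHom X Y)
    (φ : pullback P.σ P'.σ ⟶ R.E) (h₀ : addDiag P P' ≫ φ = 0)
    (hκ : pullback.lift P.κ P'.κ (by simp) ≫ φ = R.κ - w.left ≫ R.ι)
    (hι : pullback.lift 0 P'.ι (by simp) ≫ φ = R.ι)
    (hσ : φ ≫ R.σ = pullback.fst _ _ ≫ P.σ)
    (hρ : φ ≫ (R.ρ + R.σ ≫ w.right) = pullback.fst _ _ ≫ P.ρ + pullback.snd _ _ ≫ P'.ρ) :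
    Iso (add P P') (R.twist w) :=
  add_iso_of (R := R.twist w) φ h₀ hκ hι hσ hρ

/-- The pullback of `E` and `X⁰ ⊕ Y⁻¹` over `X⁰` is `E ⊕ Y⁻¹`. Its quotient by the antidiagonal
`Y⁻¹` is `E` again, through `(a, b) ↦ a + ι (pr b)`. So adding a strict morphism changes only `κ`
and `ρ`. -/
theorem add_ofStrict (P : Butterfly X Y) (w : StrictHom X Y) :
    Iso (P.add (ofStrict w)) (P.twist w) := by
  let a : pullback P.σ (ofStrict w).σ ⟶ P.E := pullback.fst _ _
  let b : pullback P.σ (ofStrict w).σ ⟶ (ofStrict w).E := pullback.snd _ _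
  have hab : a ≫ P.σ = b ≫ (ofStrict w).σ := pullback.condition
  have d₁ : addDiag P (ofStrict w) ≫ a = P.ι := addDiag_fst _ _
  have d₂ : addDiag P (ofStrict w) ≫ b = -(ofStrict w).ι := addDiag_snd _ _
  have k₁ : pullback.lift P.κ (ofStrict w).κ (by simp) ≫ a = P.κ := pullback.lift_fst _ _ _
  have k₂ : pullback.lift P.κ (ofStrict w).κ (by simp) ≫ b = (ofStrict w).κ :=
    pullback.lift_snd _ _ _
  have i₁ : pullback.lift (0 : _ ⟶ P.E) (ofStrict w).ι (by simp) ≫ a = 0 :=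
    pullback.lift_fst _ _ _
  have i₂ : pullback.lift (0 : _ ⟶ P.E) (ofStrict w).ι (by simp) ≫ b = (ofStrict w).ι :=
    pullback.lift_snd _ _ _
  refine add_iso_twist_of w (a + b ≫ prS w ≫ P.ι) ?_ ?_ ?_ ?_ ?_
  · rw [Preadditive.comp_add, ← Category.assoc, d₁, d₂]
    simp
  · rw [Preadditive.comp_add, ← Category.assoc, k₁, k₂]
    simp [sub_eq_add_neg]
  · rw [Preadditive.comp_add, ← Category.assoc, i₁, i₂]
    simp
  · change (a + b ≫ prS w ≫ P.ι) ≫ P.σ = a ≫ P.σ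
    simp
  · change (a + b ≫ prS w ≫ P.ι) ≫ (P.ρ + P.σ ≫ w.right) = a ≫ P.ρ + b ≫ (ofStrict w).ρ
    rw [ρ_eq]
    simp [reassoc_of% hab]
    abel

/-- A square with two opposite strict sides that commutes up to a strict morphism. -/
theorem comp_strict_iso_add {X' Y' : TwoTerm A} {P : Butterfly X Y} {P' : Butterfly X' Y'}
    (u : StrictHom X X') (v : StrictHom Y Y') (w : StrictHom X Y') (φ : P.E ⟶ P'.E)
    (hκ : P.κ ≫ φ = u.left ≫ P'.κ + w.left ≫ P'.ι) (hι : P.ι ≫ φ = v.left ≫ P'.ι)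
    (hσ : φ ≫ P'.σ = P.σ ≫ u.right) (hρ : φ ≫ P'.ρ = P.ρ ≫ v.right + P.σ ≫ w.right) :
    Iso ((P.comp (ofStrict v)).add (ofStrict w)) ((ofStrict u).comp P') := by
  -- The strict defect is moved to the other side as a twist by `-w`. Adding `w` then twists back.
  have h : Iso (P.comp (ofStrict v)) (((ofStrict u).comp P').twist w.neg) := by
    have hc := pullback.condition (f := P.ρ) (g := (ofStrict v).σ)
    have hw : (pullback.fst P.ρ (ofStrict v).σ ≫ P.σ ≫ inS u) ≫ (ofStrict u).ρ =
        (pullback.fst P.ρ (ofStrict v).σ ≫ φ +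
          pullback.snd P.ρ (ofStrict v).σ ≫ prS v ≫ P'.ι) ≫ P'.σ := by
      simp [hσ]
    refine comp_iso_twist_of w.neg (compMk _ _ hw) ?_ ?_ ?_ ?_ ?_
    · rw [precomp_compMk, compMk_eq_zero_iff]
      refine ⟨0, ?_, ?_⟩
      · rw [← Category.assoc, compDiag_fst]; simp
      · rw [Preadditive.comp_add, ← Category.assoc, ← Category.assoc, compDiag_fst, compDiag_snd,
          ← Category.assoc, κ_prS]
        simp [hι]
    · rw [precomp_compMk, comp_κ, comp_ι, precomp_compMk, ← sub_eq_zero, sub_eq_add_neg,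
        neg_sub, sub_eq_add_neg, compMk_neg, compMk_add, compMk_add, compMk_eq_zero_iff]
      -- The two representatives of `κ` differ by the diagonal image of `u.left`.
      refine ⟨u.left, ?_, ?_⟩
      · rw [κ_eq]; simp
      · simp [hκ, StrictHom.neg]
    · have : (ofStrict v).ι ≫ prS v ≫ P'.ι = P'.ι := by rw [← Category.assoc]; simp
      simp [comp_ι, this]
    · simp
    · rw [Preadditive.comp_add, compMk_ρ, ← Category.assoc _ (((ofStrict u).comp P').σ), compMk_σ,
        ρ_eq, Preadditive.comp_add, ← Category.assoc _ (ofStrict v).σ, ← hc]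
      simp [hρ, StrictHom.neg]
      abel
  refine (h.add (Iso.refl _)).trans ((add_ofStrict _ _).trans ?_)
  exact Iso.of_hom (𝟙 _) (by simp [twist, StrictHom.neg]) (by simp [twist]) (by simp [twist])
    (by simp [twist, StrictHom.neg])

end Butterfly

end Butterflies


/-! ### Quasi-isomorphisms of two-term complexes -/

section QuasiIso

variable {A : Type u} [Category.{v} A] [Abelian A] {X Y : TwoTerm A}

/-- The map on kernels that is induced by a strict morphism. -/
noncomputable abbrev StrictHom.kernelMap (f : StrictHom X Y) : kernel X.d ⟶ kernel Y.d :=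
  kernel.map X.d Y.d f.left f.right f.comm.symm

/-- The map on cokernels that is induced by a strict morphism. -/
noncomputable abbrev StrictHom.cokernelMap (f : StrictHom X Y) : cokernel X.d ⟶ cokernel Y.d :=
  cokernel.map X.d Y.d f.left f.right f.comm.symm

/-- A strict morphism is a quasi-isomorphism if it induces isomorphisms on the kernels and the
cokernels of the differentials. -/
def StrictHom.IsQuasiIso (f : StrictHom X Y) : Prop := IsIso f.kernelMap ∧ IsIso f.cokernelMap

namespace Butterfly

theorem exact_of_surj (P : Butterfly X Y) (h : ∀ {T : A} (e : T ⟶ P.E), e ≫ P.ρ = 0 →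
    ∃ (T' : A) (π : T' ⟶ T) (_ : Epi π) (x : T' ⟶ X.left), π ≫ e = x ≫ P.κ) :
    (ShortComplex.mk P.κ P.ρ P.κρ).Exact :=
  (ShortComplex.exact_iff_exact_up_to_refinements _).2 fun _ e he => h e he

/-- The diagonal `X⁻¹ → X⁰ ⊕ Y⁻¹ → Y⁰` of a strict butterfly is, up to signs, the mapping cone of
`f`. Exactness at its three places gives injectivity and surjectivity on kernels and on cokernels,
by a chase with generalized elements. -/
theorem isQuasiIso_of_shortExact (f : StrictHom X Y)
    (h : (ShortComplex.mk (ofStrict f).κ (ofStrict f).ρ (ofStrict f).κρ).ShortExact) :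
    f.IsQuasiIso := by
  have hκ : Mono (ofStrict f).κ := h.mono_f
  have hρ : Epi (ofStrict f).ρ := h.epi_g
  have k₁ : Mono f.kernelMap := by
    refine Preadditive.mono_of_cancel_zero _ fun {T} x hx => ?_
    have hx' : x ≫ kernel.ι X.d ≫ f.left = 0 := by
      have := hx =≫ kernel.ι Y.d
      simpa using this
    rw [← cancel_mono (kernel.ι X.d), ← cancel_mono (ofStrict f).κ, κ_eq]
    simp [reassoc_of% hx']
  have k₂ : Epi f.kernelMap := by
    refine epi_of_surj _ fun {T} y => ?_
    obtain ⟨x, hx⟩ := exists_κ _ h (y ≫ kernel.ι Y.d ≫ (ofStrict f).ι) (by simp)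
    have h₁ : x ≫ X.d = 0 := by rw [← (ofStrict f).κσ, ← Category.assoc, hx]; simp
    have h₂ : y ≫ kernel.ι Y.d = -(x ≫ f.left) := by
      have := hx =≫ prS f
      simp only [Category.assoc, κ_prS, ι_prS] at this
      simpa using this.symm
    refine ⟨T, 𝟙 _, inferInstance, -kernel.lift _ x h₁, ?_⟩
    rw [← cancel_mono (kernel.ι Y.d)]
    simp [h₂]
  have c₁ : Mono f.cokernelMap := by
    refine Preadditive.mono_of_cancel_zero _ fun {T} x hx => ?_
    obtain ⟨T₁, π₁, _, x₁, h₁⟩ := surjective_up_to_refinements_of_epi (cokernel.π X.d) x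
    have h₂ : (x₁ ≫ f.right) ≫ cokernel.π Y.d = 0 := by
      have := π₁ ≫= hx
      rw [reassoc_of% h₁] at this
      simpa using this
    obtain ⟨T₂, π₂, _, y, h₃⟩ := cokernel_zero _ _ h₂
    obtain ⟨z, hz⟩ := exists_κ _ h (π₂ ≫ x₁ ≫ inS f - y ≫ (ofStrict f).ι) (by simp [h₃])
    have h₄ : π₂ ≫ x₁ = z ≫ X.d := by
      rw [← (ofStrict f).κσ, ← Category.assoc, hz]; simp
    rw [← cancel_epi π₁, h₁, ← cancel_epi π₂, ← Category.assoc, h₄]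
    simp
  have c₂ : Epi f.cokernelMap := by
    have : Epi ((ofStrict f).ρ ≫ cokernel.π Y.d) := epi_comp _ _
    have e : (ofStrict f).ρ ≫ cokernel.π Y.d =
        ((ofStrict f).σ ≫ cokernel.π X.d) ≫ f.cokernelMap := by
      rw [ρ_eq]; simp
    rw [e] at this
    exact epi_of_epi ((ofStrict f).σ ≫ cokernel.π X.d) _
  exact ⟨isIso_of_mono_of_epi _, isIso_of_mono_of_epi _⟩

/-- Acyclicity of the mapping cone, by the converse chase. Exactness in the middle uses injectivity
on cokernels to lift the `X⁰` component to `X⁻¹`, and then surjectivity on kernels to correct the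
lift. -/
theorem shortExact_of_isQuasiIso (f : StrictHom X Y) (hf : f.IsQuasiIso) :
    (ShortComplex.mk (ofStrict f).κ (ofStrict f).ρ (ofStrict f).κρ).ShortExact := by
  obtain ⟨hk, hc⟩ := hf
  refine { exact := ?_, mono_f := ?_, epi_g := ?_ }
  · refine exact_of_surj _ fun {T} e he => ?_
    rw [ρ_eq] at he
    have h₁ : e ≫ (ofStrict f).σ ≫ cokernel.π X.d = 0 := by
      rw [← cancel_mono f.cokernelMap]
      have := he =≫ cokernel.π Y.d
      simpa using this
    rw [← Category.assoc] at h₁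
    obtain ⟨T₁, π₁, _, x, hx⟩ := cokernel_zero _ _ h₁
    have h₂ : (π₁ ≫ e ≫ prS f + x ≫ f.left) ≫ Y.d = 0 := by
      have := π₁ ≫= he
      simp only [Preadditive.comp_add, comp_zero] at this
      have hx' := hx =≫ f.right
      simp only [Category.assoc] at hx' this
      rw [hx', add_comm] at this
      simp only [Preadditive.add_comp, Category.assoc, f.comm, this]
    -- The lift `x` gives the right component in `X⁰`; the error in `Y⁻¹` is a cycle, hence the
    -- image of a cycle `z` of `X`. The corrected preimage is `x - z`.
    let z : T₁ ⟶ kernel X.d := kernel.lift _ _ h₂ ≫ inv f.kernelMap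
    have hz : z ≫ kernel.ι X.d ≫ f.left = π₁ ≫ e ≫ prS f + x ≫ f.left := by
      have hz₀ : z ≫ f.kernelMap = kernel.lift _ _ h₂ := by
        simp only [z, Category.assoc, IsIso.inv_hom_id, Category.comp_id]
      have := hz₀ =≫ kernel.ι Y.d
      simpa only [Category.assoc, kernel.lift_ι] using this
    refine ⟨T₁, π₁, inferInstance, x - z ≫ kernel.ι X.d, ?_⟩
    rw [κ_eq]
    have : π₁ ≫ e = (π₁ ≫ e ≫ (ofStrict f).σ) ≫ inS f + (π₁ ≫ e ≫ prS f) ≫ (ofStrict f).ι := by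
      have := (π₁ ≫ e) ≫= totS f
      simpa using this.symm
    rw [this, hx, eq_sub_of_add_eq hz.symm]
    simp
    abel
  · refine Preadditive.mono_of_cancel_zero _ fun {T} x hx => ?_
    dsimp at hx x
    have h₁ : x ≫ X.d = 0 := by rw [← (ofStrict f).κσ, ← Category.assoc, hx, zero_comp]
    have h₂ : x ≫ f.left = 0 := by
      have := hx =≫ prS f
      simpa using this
    have h₃ : kernel.lift _ x h₁ = 0 := by
      rw [← cancel_mono f.kernelMap, ← cancel_mono (kernel.ι Y.d)]
      simp [h₂]
    rw [← kernel.lift_ι _ x h₁, h₃, zero_comp]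
  · refine epi_of_surj _ fun {T} y => ?_
    dsimp at y ⊢
    obtain ⟨T₁, π₁, _, x, hx⟩ := surjective_up_to_refinements_of_epi (cokernel.π X.d)
      (y ≫ cokernel.π Y.d ≫ inv f.cokernelMap)
    have h₁ : (π₁ ≫ y - x ≫ f.right) ≫ cokernel.π Y.d = 0 := by
      have := hx =≫ f.cokernelMap
      simp only [Category.assoc, IsIso.inv_hom_id, Category.comp_id] at this
      rw [Preadditive.sub_comp, Category.assoc, this]
      simp
    obtain ⟨T₂, π₂, _, z, hz⟩ := cokernel_zero _ _ h₁
    refine ⟨T₂, π₂ ≫ π₁, inferInstance, π₂ ≫ x ≫ inS f + z ≫ (ofStrict f).ι, ?_⟩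
    rw [Preadditive.comp_sub, sub_eq_iff_eq_add] at hz
    simp only [Preadditive.add_comp, Category.assoc, inS_ρ, ιρ, hz]
    rw [add_comm]

end Butterfly

/-- An object of the abelian category with enough projectives is covered by a quasi-isomorphism
from a two-term complex with projective right term. -/
theorem exists_isQuasiIso_projective [EnoughProjectives A] (X : TwoTerm A) :
    ∃ (P : TwoTerm A) (f : StrictHom P X), Projective P.right ∧ f.IsQuasiIso := by
  -- `d` is pulled back along an epimorphism from a projective object onto `X⁰`. The pullback
  -- property makes the mapping cone left exact, and the epimorphism `π` makes it right exact.
  let π := Projective.π X.right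
  let P : TwoTerm A := ⟨pullback X.d π, Projective.over X.right, pullback.snd _ _⟩
  let f : StrictHom P X := ⟨pullback.fst _ _, π, pullback.condition⟩
  refine ⟨P, f, inferInstanceAs (Projective (Projective.over X.right)),
    Butterfly.isQuasiIso_of_shortExact f { exact := ?_, mono_f := ?_, epi_g := ?_ }⟩
  · refine Butterfly.exact_of_surj _ fun {T} e he => ?_
    rw [Butterfly.ρ_eq] at he
    have h : (-(e ≫ Butterfly.prS f)) ≫ X.d = (e ≫ (Butterfly.ofStrict f).σ) ≫ π := by
      rw [Preadditive.comp_add, ← eq_neg_iff_add_eq_zero] at he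
      simpa using he.symm
    have h₁ : pullback.lift _ _ h ≫ f.left = _ := pullback.lift_fst _ _ h
    have h₂ : pullback.lift _ _ h ≫ P.d = _ := pullback.lift_snd _ _ h
    refine ⟨T, 𝟙 _, inferInstance, pullback.lift _ _ h, ?_⟩
    rw [Butterfly.κ_eq, Preadditive.comp_sub, ← Category.assoc, ← Category.assoc]
    refine Eq.trans ?_ (congrArg₂ (fun a b => a ≫ Butterfly.inS f - b ≫ (Butterfly.ofStrict f).ι)
      h₂.symm h₁.symm)
    have := e ≫= Butterfly.totS f
    simpa using this.symm
  · refine Preadditive.mono_of_cancel_zero _ fun {T} x hx => ?_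
    dsimp at hx x
    have h₁ : x ≫ P.d = 0 := by
      rw [← (Butterfly.ofStrict f).κσ, ← Category.assoc, hx, zero_comp]
    have h₂ : x ≫ f.left = 0 := by
      have := hx =≫ Butterfly.prS f
      simpa using this
    exact pullback.hom_ext (h₂.trans zero_comp.symm) (h₁.trans zero_comp.symm)
  · dsimp
    have : Epi (Butterfly.inS f ≫ (Butterfly.ofStrict f).ρ) := by
      rw [Butterfly.inS_ρ]; exact inferInstanceAs (Epi (Projective.π X.right))
    exact epi_of_epi (Butterfly.inS f) _

/-- In an abelian category with enough injectives, every two-term complex has a quasi-isomorphism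
to a two-term complex with injective left term. -/
theorem exists_isQuasiIso_injective [EnoughInjectives A] (X : TwoTerm A) :
    ∃ (I : TwoTerm A) (f : StrictHom X I), Injective I.left ∧ f.IsQuasiIso := by
  -- Dually, `d` is pushed out along an embedding of `X⁻¹` in an injective object. The pushout
  -- property makes the mapping cone right exact, and the monomorphism `i` makes its first map mono.
  let i := Injective.ι X.left
  let I : TwoTerm A := ⟨Injective.under X.left, pushout i X.d, pushout.inl _ _⟩
  let f : StrictHom X I := ⟨i, pushout.inr _ _, pushout.condition⟩
  have hρ : Epi (Butterfly.ofStrict f).ρ := by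
    refine Preadditive.epi_of_cancel_zero _ fun {T} x hx => ?_
    have h₁ : I.d ≫ x = 0 := by
      rw [← (Butterfly.ofStrict f).ιρ, Category.assoc, hx, comp_zero]
    have h₂ : f.right ≫ x = 0 := by
      rw [← Butterfly.inS_ρ f, Category.assoc, hx, comp_zero]
    exact pushout.hom_ext (h₁.trans comp_zero.symm) (h₂.trans comp_zero.symm)
  refine ⟨I, f, inferInstanceAs (Injective (Injective.under X.left)),
    Butterfly.isQuasiIso_of_shortExact f { exact := ?_, mono_f := ?_, epi_g := ?_ }⟩
  · refine ShortComplex.exact_of_g_is_cokernel _ (CokernelCofork.IsColimit.ofπ' _ _ fun {T} k hk => ?_)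
    have : Epi (ShortComplex.mk (Butterfly.ofStrict f).κ (Butterfly.ofStrict f).ρ
      (Butterfly.ofStrict f).κρ).g := hρ
    replace hk : (Butterfly.ofStrict f).κ ≫ k = 0 := hk
    have h : i ≫ (Butterfly.ofStrict f).ι ≫ k = X.d ≫ Butterfly.inS f ≫ k := by
      rw [Butterfly.κ_eq, Preadditive.sub_comp, sub_eq_zero] at hk
      simpa using hk.symm
    refine ⟨pushout.desc _ _ h, ?_⟩
    change (Butterfly.ofStrict f).ρ ≫ _ = k
    have h₁ : f.right ≫ pushout.desc _ _ h = _ := pushout.inr_desc _ _ h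
    have h₂ : I.d ≫ pushout.desc _ _ h = _ := pushout.inl_desc _ _ h
    rw [Butterfly.ρ_eq, Preadditive.add_comp, Category.assoc, Category.assoc]
    refine (congrArg₂ (fun a b => (Butterfly.ofStrict f).σ ≫ a + Butterfly.prS f ≫ b)
      h₁ h₂).trans ?_
    have := Butterfly.totS f =≫ k
    simpa using this
  · dsimp
    have : Mono (-(Butterfly.ofStrict f).κ ≫ Butterfly.prS f) := by
      rw [Butterfly.κ_prS, neg_neg]; exact inferInstanceAs (Mono (Injective.ι X.left))
    rw [← Preadditive.comp_neg] at this
    exact mono_of_mono _ (-Butterfly.prS f)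
  · exact hρ

end QuasiIso


/-! ### Formal criteria for derived equivalences of DG categories -/

section DG

variable {K : Type w} [CommRing K]

section

variable {C : DGCategory.{w, v₁, u₁} K} {X Y Z : C.Obj}

theorem DGCategory.IsIso.bijective_comp_left {f : C.Hom X Y 0} (hf : C.IsIso f) (n : ℤ) :
    Function.Bijective (fun g : C.Hom Y Z n => C.comp (zero_add n) f g) := by
  obtain ⟨-, f', -, h, h'⟩ := hf
  refine Function.bijective_iff_has_inverse.2 ⟨fun g => C.comp (zero_add n) f' g, fun g => ?_,
    fun g => ?_⟩
  · change C.comp _ f' (C.comp _ f g) = g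
    rw [← C.assoc (add_zero 0) (zero_add n) (zero_add n) (zero_add n), h', C.id_comp]
  · change C.comp _ f (C.comp _ f' g) = g
    rw [← C.assoc (add_zero 0) (zero_add n) (zero_add n) (zero_add n), h, C.id_comp]

theorem DGCategory.IsIso.bijective_comp_right {f : C.Hom Y Z 0} (hf : C.IsIso f) (n : ℤ) :
    Function.Bijective (fun g : C.Hom X Y n => C.comp (add_zero n) g f) := by
  obtain ⟨-, f', -, h, h'⟩ := hf
  refine Function.bijective_iff_has_inverse.2 ⟨fun g => C.comp (add_zero n) g f', fun g => ?_,
    fun g => ?_⟩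
  · change C.comp _ (C.comp _ g f) f' = g
    rw [C.assoc (add_zero n) (add_zero 0) (add_zero n) (add_zero n), h, C.comp_id]
  · change C.comp _ (C.comp _ g f') f = g
    rw [C.assoc (add_zero n) (add_zero 0) (add_zero n) (add_zero n), h', C.comp_id]

theorem DGCategory.d_comp_closed_right {f : C.Hom X Y 0} {g : C.Hom Y Z 0} (hg : C.IsClosed g) :
    C.d (zero_add 1) (C.comp (add_zero 0) f g) = C.comp (add_zero 1) (C.d (zero_add 1) f) g := by
  rw [C.d_comp (add_zero 0) (zero_add 1) (zero_add 1) (zero_add 1), show C.d _ g = 0 from hg]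
  simp

theorem DGCategory.d_comp_closed_left {n m : ℤ} (h : n + 1 = m) {f : C.Hom X Y 0} {g : C.Hom Y Z n}
    (hf : C.IsClosed f) :
    C.d h (C.comp (zero_add n) f g) = C.comp (zero_add m) f (C.d h g) := by
  rw [C.d_comp (zero_add n) (zero_add 1) h h, show C.d _ f = 0 from hf]
  simp

theorem DGCategory.d_comp_closed_right' {n m : ℤ} (h : n + 1 = m) {f : C.Hom X Y n}
    {g : C.Hom Y Z 0} (hg : C.IsClosed g) :
    C.d h (C.comp (add_zero n) f g) = C.comp (add_zero m) (C.d h f) g := by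
  rw [C.d_comp (add_zero n) h (zero_add 1) h, show C.d _ g = 0 from hg]
  simp

/-- A closed morphism with respect to which two objects are local is an isomorphism
between them. -/
theorem DGCategory.isIso_of_over {P P' X : C.Obj} {p : C.Hom P X 0} {p' : C.Hom P' X 0}
    (hp : C.IsClosed p) (hp' : C.IsClosed p')
    (h : ∀ n : ℤ, Function.Bijective (fun f : C.Hom P P n => C.comp (add_zero n) f p))
    (h' : ∀ n : ℤ, Function.Bijective (fun f : C.Hom P' P n => C.comp (add_zero n) f p))
    (k : ∀ n : ℤ, Function.Bijective (fun f : C.Hom P P' n => C.comp (add_zero n) f p'))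
    (k' : ∀ n : ℤ, Function.Bijective (fun f : C.Hom P' P' n => C.comp (add_zero n) f p')) :
    ∃ a : C.Hom P' P 0, C.IsIso a ∧ C.comp (add_zero 0) a p = p' ∧
      ∀ b : C.Hom P' P 0, C.comp (add_zero 0) b p = p' → b = a := by
  obtain ⟨a, ha : C.comp _ a p = p'⟩ := (h' 0).2 p'
  obtain ⟨b, hb : C.comp _ b p' = p⟩ := (k 0).2 p
  refine ⟨a, ⟨?_, b, ?_, ?_, ?_⟩, ha, fun c hc => (h' 0).1 (hc.trans ha.symm)⟩
  -- Closedness of `a` is tested after composing with `p`, by injectivity in degree `1`: there `da`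
  -- becomes `dp' = 0`.
  · refine (h' 1).1 ?_
    change C.comp _ (C.d (zero_add 1) a) p = C.comp _ 0 p
    rw [← C.d_comp_closed_right hp, ha, show C.d _ p' = 0 from hp']
    simp
  · refine (k 1).1 ?_
    change C.comp _ (C.d (zero_add 1) b) p' = C.comp _ 0 p'
    rw [← C.d_comp_closed_right hp', hb, show C.d _ p = 0 from hp]
    simp
  · refine (k' 0).1 ?_
    change C.comp _ (C.comp _ a b) p' = C.comp _ (C.id P') p'
    rw [C.assoc (add_zero 0) (add_zero 0) (add_zero 0) (add_zero 0), hb, ha, C.id_comp]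
  · refine (h 0).1 ?_
    change C.comp _ (C.comp _ b a) p = C.comp _ (C.id P) p
    rw [C.assoc (add_zero 0) (add_zero 0) (add_zero 0) (add_zero 0), ha, hb, C.id_comp]

/-- The version of `DGCategory.isIso_of_over` for objects under a given one. -/
theorem DGCategory.isIso_of_under {I I' Y : C.Obj} {q : C.Hom Y I 0} {q' : C.Hom Y I' 0}
    (hq : C.IsClosed q) (hq' : C.IsClosed q')
    (h : ∀ n : ℤ, Function.Bijective (fun f : C.Hom I I n => C.comp (zero_add n) q f))
    (h' : ∀ n : ℤ, Function.Bijective (fun f : C.Hom I I' n => C.comp (zero_add n) q f))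
    (k : ∀ n : ℤ, Function.Bijective (fun f : C.Hom I' I n => C.comp (zero_add n) q' f))
    (k' : ∀ n : ℤ, Function.Bijective (fun f : C.Hom I' I' n => C.comp (zero_add n) q' f)) :
    ∃ a : C.Hom I I' 0, C.IsIso a ∧ C.comp (add_zero 0) q a = q' ∧
      ∀ b : C.Hom I I' 0, C.comp (add_zero 0) q b = q' → b = a := by
  obtain ⟨a, ha : C.comp _ q a = q'⟩ := (h' 0).2 q'
  obtain ⟨b, hb : C.comp _ q' b = q⟩ := (k 0).2 q
  refine ⟨a, ⟨?_, b, ?_, ?_, ?_⟩, ha, fun c hc => (h' 0).1 (hc.trans ha.symm)⟩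
  · refine (h' 1).1 ?_
    change C.comp _ q (C.d (zero_add 1) a) = C.comp _ q 0
    rw [← C.d_comp_closed_left (zero_add 1) hq, ha, show C.d _ q' = 0 from hq']
    simp
  · refine (k 1).1 ?_
    change C.comp _ q' (C.d (zero_add 1) b) = C.comp _ q' 0
    rw [← C.d_comp_closed_left (zero_add 1) hq', hb, show C.d _ q = 0 from hq]
    simp
  · refine (h 0).1 ?_
    change C.comp _ q (C.comp _ a b) = C.comp _ q (C.id I)
    rw [← C.assoc (add_zero 0) (add_zero 0) (add_zero 0) (add_zero 0), ha, hb, C.comp_id]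
  · refine (k' 0).1 ?_
    change C.comp _ q' (C.comp _ b a) = C.comp _ q' (C.id I')
    rw [← C.assoc (add_zero 0) (add_zero 0) (add_zero 0) (add_zero 0), hb, ha, C.comp_id]

end

variable {C : DGCategory.{w, v₁, u₁} K} {D : DGCategory.{w, v₂, u₂} K} {obj : C.Obj → D.Obj}
  {F : DGFunctor C D obj} {S : ∀ {X Y : C.Obj}, C.Hom X Y 0 → Prop} {Q : C.Obj → Prop}

theorem DGFunctor.isClosed_of_map {X Y : C.Obj} {s : C.Hom X Y 0}
    (h : Function.Injective (F.map (X := X) (Y := Y) (n := 1))) (hs : D.IsClosed (F.map s)) :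
    C.IsClosed s :=
  h (by rw [F.map_d, map_zero]; exact hs)

theorem DGFunctor.isClosed_map {X Y : C.Obj} {s : C.Hom X Y 0} (hs : C.IsClosed s) :
    D.IsClosed (F.map s) := by
  change D.d _ _ = 0
  rw [← F.map_d, show C.d _ s = 0 from hs, map_zero]

/-- A criterion for derived equivalences, by left resolutions. -/
theorem IsLeftDerivedEquivalence.of_bijective
    (hS : ∀ {X Y : C.Obj} (s : C.Hom X Y 0), C.IsClosed s → (S s ↔ D.IsIso (F.map s)))
    (hF : ∀ (X Y : C.Obj) (n : ℤ), Q X → Function.Bijective (F.map (X := X) (Y := Y) (n := n)))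
    (hQ : ∀ Z : D.Obj, ∃ (X : C.Obj) (f : D.Hom (obj X) Z 0), Q X ∧ D.IsIso f) :
    IsLeftDerivedEquivalence F S Q := by
  have hb {P X Y : C.Obj} (s : C.Hom X Y 0) (hP : Q P) (hs : C.IsClosed s) (hs' : S s) (n : ℤ) :
      Function.Bijective (fun f : C.Hom P X n => C.comp (add_zero n) f s) := by
    -- `F` is bijective on morphisms out of `P` and turns composition with `s` into composition with
    -- the isomorphism `F s`.
    rw [← Function.Bijective.of_comp_iff' (hF P Y n hP)]
    convert (((hS s hs).1 hs').bijective_comp_right n).comp (hF P X n hP) using 1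
    exact funext fun f => F.map_comp _ f s
  refine ⟨hS, fun X => ?_, fun p p' hp hp' => ?_, hb, fun {X P} p hp Y => ?_, fun Z => ?_,
    ⟨fun X Y n => hF X.1 Y.1 n X.2, fun Z => ?_⟩⟩
  -- A resolution of `X` is a lift of an isomorphism `F P → F X` with `P` in `Q`. It is closed by
  -- injectivity of `F` in degree `1`, and belongs to `S` because its image is invertible.
  · obtain ⟨P, f, hP, hf⟩ := hQ (obj X)
    obtain ⟨p, rfl⟩ := (hF P X 0 hP).2 f
    have hp := F.isClosed_of_map (hF P X 1 hP).1 hf.1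
    exact ⟨P, p, (hS p hp).2 hf, hp, hP⟩
  · exact C.isIso_of_over hp.closed hp'.closed (hb p hp.prop hp.closed hp.mem)
      (hb p hp'.prop hp.closed hp.mem) (hb p' hp.prop hp'.closed hp'.mem)
      (hb p' hp'.prop hp'.closed hp'.mem)
  -- The required isomorphism is forced: `F`, followed by the inverse of precomposition with `F p`.
  -- It commutes with `d` because that precomposition does, `F p` being closed, and is injective.
  · let e₁ (n : ℤ) : C.Hom P Y n ≃ₗ[K] D.Hom (obj P) (obj Y) n :=
      LinearEquiv.ofBijective F.map (hF P Y n hp.prop)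
    let e₂ (n : ℤ) : D.Hom (obj X) (obj Y) n ≃ₗ[K] D.Hom (obj P) (obj Y) n :=
      LinearEquiv.ofBijective (D.comp (zero_add n) (F.map p))
        (((hS p hp.closed).1 hp.mem).bijective_comp_left n)
    have he (n : ℤ) (f : C.Hom P Y n) :
        D.comp (zero_add n) (F.map p) ((e₁ n ≪≫ₗ (e₂ n).symm) f) = F.map f :=
      (e₂ n).apply_symm_apply (F.map f)
    refine ⟨fun n => e₁ n ≪≫ₗ (e₂ n).symm, fun {n m} h f => ?_, he⟩
    refine (e₂ m).injective ?_
    change D.comp (zero_add m) (F.map p) _ = D.comp (zero_add m) (F.map p) _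
    rw [he, ← D.d_comp_closed_left h (F.isClosed_map hp.closed), he, F.map_d]
  · obtain ⟨X, f, -, hf⟩ := hQ Z
    exact ⟨X, f, hf⟩
  · obtain ⟨X, f, hX, hf⟩ := hQ Z
    exact ⟨⟨X, hX⟩, f, hf⟩

/-- A criterion for derived equivalences, by right resolutions. -/
theorem IsRightDerivedEquivalence.of_bijective
    (hS : ∀ {X Y : C.Obj} (s : C.Hom X Y 0), C.IsClosed s → (S s ↔ D.IsIso (F.map s)))
    (hF : ∀ (X Y : C.Obj) (n : ℤ), Q Y → Function.Bijective (F.map (X := X) (Y := Y) (n := n)))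
    (hQ : ∀ Z : D.Obj, ∃ (X : C.Obj) (f : D.Hom (obj X) Z 0), Q X ∧ D.IsIso f) :
    IsRightDerivedEquivalence F S Q := by
  have hb {X Y I : C.Obj} (s : C.Hom X Y 0) (hI : Q I) (hs : C.IsClosed s) (hs' : S s) (n : ℤ) :
      Function.Bijective (fun f : C.Hom Y I n => C.comp (zero_add n) s f) := by
    rw [← Function.Bijective.of_comp_iff' (hF X I n hI)]
    convert (((hS s hs).1 hs').bijective_comp_left n).comp (hF Y I n hI) using 1
    exact funext fun f => F.map_comp _ s f
  refine ⟨hS, fun X => ?_, fun q q' hq hq' => ?_, hb, fun {Y I} q hq X => ?_, fun Z => ?_,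
    ⟨fun X Y n => hF X.1 Y.1 n Y.2, fun Z => ?_⟩⟩
  -- The available isomorphism goes from `F I` to `F X`, whereas a right resolution goes from `X` to
  -- `I`. So its inverse `g` is lifted.
  · obtain ⟨I, f, hI, hf, g, hg, hfg, hgf⟩ := hQ (obj X)
    obtain ⟨q, rfl⟩ := (hF X I 0 hI).2 g
    have hq := F.isClosed_of_map (hF X I 1 hI).1 hg
    exact ⟨I, q, (hS q hq).2 ⟨hg, f, hf, hgf, hfg⟩, hq, hI⟩
  · exact C.isIso_of_under hq.closed hq'.closed (hb q hq.prop hq.closed hq.mem)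
      (hb q hq'.prop hq.closed hq.mem) (hb q' hq.prop hq'.closed hq'.mem)
      (hb q' hq'.prop hq'.closed hq'.mem)
  · let e₁ (n : ℤ) : C.Hom X I n ≃ₗ[K] D.Hom (obj X) (obj I) n :=
      LinearEquiv.ofBijective F.map (hF X I n hq.prop)
    let e₂ (n : ℤ) : D.Hom (obj X) (obj Y) n ≃ₗ[K] D.Hom (obj X) (obj I) n :=
      LinearEquiv.ofBijective ((D.comp (add_zero n)).flip (F.map q))
        (((hS q hq.closed).1 hq.mem).bijective_comp_right n)
    have he (n : ℤ) (f : C.Hom X I n) :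
        D.comp (add_zero n) ((e₁ n ≪≫ₗ (e₂ n).symm) f) (F.map q) = F.map f :=
      (e₂ n).apply_symm_apply (F.map f)
    refine ⟨fun n => e₁ n ≪≫ₗ (e₂ n).symm, fun {n m} h f => ?_, he⟩
    refine (e₂ m).injective ?_
    change D.comp (add_zero m) _ (F.map q) = D.comp (add_zero m) _ (F.map q)
    rw [he, ← D.d_comp_closed_right' h (F.isClosed_map hq.closed), he, F.map_d]
  · obtain ⟨X, f, -, hf⟩ := hQ Z
    exact ⟨X, f, hf⟩
  · obtain ⟨X, f, hX, hf⟩ := hQ Z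
    exact ⟨⟨X, hX⟩, f, hf⟩

section

variable {B : Type u₁} [Category.{v₁} B] [Preadditive B] [Linear K B]

open CochainComplex.HomComplex

/-- An isomorphism of complexes is an isomorphism in the DG category of complexes. -/
theorem dgComplexes_isIso_ofHom {X Y : CochainComplex B ℤ} (f : X ⟶ Y) [IsIso f] :
    (dgComplexes K B).IsIso (X := X) (Y := Y) (Cochain.ofHom f) := by
  refine ⟨δ_ofHom f, Cochain.ofHom (inv f), δ_ofHom (inv f), ?_, ?_⟩
  · exact (Cochain.ofHom_comp f (inv f)).symm.trans (by rw [IsIso.hom_inv_id]; rfl)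
  · exact (Cochain.ofHom_comp (inv f) f).symm.trans (by rw [IsIso.inv_hom_id]; rfl)

/-- The isomorphisms of the DG category of complexes are the termwise isomorphisms. -/
theorem dgComplexes_isIso_iff {X Y : CochainComplex B ℤ} {f : Cochain X Y 0}
    (hf : δ 0 1 f = 0) :
    (dgComplexes K B).IsIso (X := X) (Y := Y) f ↔
      ∀ n : ℤ, IsIso (f.v n n (add_zero n)) := by
  constructor
  · rintro ⟨-, g, -, h, h'⟩ n
    refine ⟨Cochain.v g n n (add_zero n), ?_, ?_⟩
    · exact (Cochain.comp_v (n₁ := 0) (n₂ := 0) f g (add_zero 0) n n n (add_zero n)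
        (add_zero n)).symm.trans (by
          rw [show Cochain.comp f g (add_zero 0) = Cochain.ofHom (𝟙 X) from h]; simp)
    · exact (Cochain.comp_v (n₁ := 0) (n₂ := 0) g f (add_zero 0) n n n (add_zero n)
        (add_zero n)).symm.trans (by
          rw [show Cochain.comp g f (add_zero 0) = Cochain.ofHom (𝟙 Y) from h']; simp)
  · intro h
    let φ : X ⟶ Y := Cocycle.homOf (Cocycle.mk f 1 (zero_add 1) hf)
    have hφ : Cochain.ofHom φ = f := Cocycle.cochain_ofHom_homOf_eq_coe _
    have (n : ℤ) : IsIso (φ.f n) := by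
      have := h n
      rwa [← hφ, Cochain.ofHom_v] at this
    have : IsIso φ := HomologicalComplex.Hom.isIso_of_components φ
    rw [← hφ]
    exact dgComplexes_isIso_ofHom φ

end

end DG


/-! ### Isomorphisms in the tilted category and the torsion pair -/

section TiltedCategory

variable {A : Type u} [Category.{v} A] [Abelian A] {X Y Z : TwoTerm A}

theorem BHom.exact {P Q : Butterfly X Y} (h : BHom.mk P = BHom.mk Q) : Butterfly.Iso P Q :=
  Quotient.exact (s := Butterfly.setoid X Y) h

theorem BHom.ofStrict_neg (f : StrictHom X Y) : BHom.ofStrict f.neg = -BHom.ofStrict f := by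
  rw [eq_neg_iff_add_eq_zero, BHom.ofStrict_add, BHom.zero_def]
  congr 1
  ext <;> simp [StrictHom.neg]

theorem BHom.comp_neg (f : BHom X Y) (g : BHom Y Z) : BHom.comp f (-g) = -BHom.comp f g := by
  rw [eq_neg_iff_add_eq_zero, ← BHom.comp_add, neg_add_cancel, BHom.comp_zero]

theorem BHom.smul_ofStrict {K : Type w} [CommRing K] [Linear K A] (r : K) (f : StrictHom X Y) :
    r • BHom.ofStrict f = BHom.ofStrict (f.comp (StrictHom.smulId r Y)) := by
  rw [BHom.smul_def, BHom.ofStrict_comp]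

/-- The cone of a quasi-isomorphism is acyclic, so the flipped butterfly exists. Flipping twice
gives back the original one, so `comp_flip` handles both composites. -/
theorem BHom.exists_comp_eq_id (f : StrictHom X Y) (hf : f.IsQuasiIso) :
    ∃ g : BHom Y X, BHom.comp (BHom.ofStrict f) g = BHom.ofStrict (StrictHom.id X) ∧
      BHom.comp g (BHom.ofStrict f) = BHom.ofStrict (StrictHom.id Y) := by
  have h := Butterfly.shortExact_of_isQuasiIso f hf
  exact ⟨BHom.mk ((Butterfly.ofStrict f).flip h), BHom.sound (Butterfly.comp_flip _ h),
    BHom.sound (Butterfly.comp_flip ((Butterfly.ofStrict f).flip h) (Butterfly.ofStrict f).exact)⟩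

variable {t : TorsionPair A}

/-- A strict morphism becomes an isomorphism of the tilted category if and only if it is a
quasi-isomorphism. -/
theorem isIso_ofStrict_iff {U V : Tilt t} (f : StrictHom U.obj V.obj) :
    @IsIso (Tilt t) _ U V (BHom.ofStrict f) ↔ f.IsQuasiIso := by
  constructor
  · rintro ⟨g, h, h'⟩
    obtain ⟨P, rfl⟩ := BHom.exists_mk g
    exact Butterfly.isQuasiIso_of_shortExact f
      (Butterfly.shortExact_of_comp_iso_id (BHom.exact h) (BHom.exact h'))
  · intro hf
    obtain ⟨g, h, h'⟩ := BHom.exists_comp_eq_id f hf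
    exact ⟨g, h, h'⟩

/-- Such a `c` factors as `U⁰ → coker d → ker d → V⁻¹`, and the middle arrow goes from an object of
`T` to one of `F`. This is how the orthogonality of the torsion pair enters, both for closed
morphisms and for the differential of a linkage. -/
theorem eq_zero_of_comp_d {U V : TwoTerm A} (hU : t.T (cokernel U.d)) (hV : t.F (kernel V.d))
    (c : U.right ⟶ V.left) (h : U.d ≫ c = 0) (h' : c ≫ V.d = 0) : c = 0 := by
  have hl : U.d ≫ kernel.lift _ c h' = 0 := by
    rw [← cancel_mono (kernel.ι V.d)]; simp [h]
  rw [← kernel.lift_ι V.d c h', ← cokernel.π_desc U.d _ hl,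
    t.hom_eq_zero hU hV (cokernel.desc _ _ hl)]
  simp

theorem StrictHom.IsQuasiIso.kernel_mem {U V : TwoTerm A} {f : StrictHom U V} (hf : f.IsQuasiIso)
    : t.F (kernel U.d) ↔ t.F (kernel V.d) := by
  have := t.F_iso
  have := hf.1
  exact t.F.prop_iff_of_iso (asIso f.kernelMap)

theorem StrictHom.IsQuasiIso.cokernel_mem {U V : TwoTerm A} {f : StrictHom U V}
    (hf : f.IsQuasiIso) : t.T (cokernel U.d) ↔ t.T (cokernel V.d) := by
  have := t.T_iso
  have := hf.2
  exact t.T.prop_iff_of_iso (asIso f.cokernelMap)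

end TiltedCategory

/-! ### The DG functor on Hom complexes -/

section Functor

open CochainComplex.HomComplex

variable {A : Type u} [Category.{v} A] [Abelian A]

theorem factors_iff_comp_cokernelπ {U V : A} (N : Subobject V) (f : U ⟶ V) :
    N.Factors f ↔ f ≫ cokernel.π N.arrow = 0 := by
  constructor
  · intro h
    rw [← Subobject.factorThru_arrow _ _ h, Category.assoc, cokernel.condition, comp_zero]
  · intro h
    rw [← Abelian.monoLift_comp N.arrow f h]
    exact Subobject.factors_comp_arrow _

namespace Decorated

/-- The inclusion of the decoration. -/
noncomputable def termι (X : Decorated A) (n : ℤ) : (X.term n).left ⟶ X.E.X n := (X.M n).arrow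

/-- The projection to the quotient by the decoration. -/
noncomputable def termπ (X : Decorated A) (n : ℤ) : X.E.X (n + 1) ⟶ (X.term n).right :=
  cokernel.π (X.M (n + 1)).arrow

instance (X : Decorated A) (n : ℤ) : Mono (X.termι n) := inferInstanceAs (Mono (X.M n).arrow)

instance (X : Decorated A) (n : ℤ) : Epi (X.termπ n) :=
  inferInstanceAs (Epi (cokernel.π (X.M (n + 1)).arrow))

theorem term_d (X : Decorated A) (n : ℤ) :
    (X.term n).d = X.termι n ≫ X.E.d n (n + 1) ≫ X.termπ n := rfl

theorem termι_termπ (X : Decorated A) (n : ℤ) : X.termι (n + 1) ≫ X.termπ n = 0 :=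
  cokernel.condition _

/-- Since `termι` is mono and `termπ` is epi, strict morphisms between terms can be compared through
the objects `E^n`. Identities between factorizations and induced maps on cokernels thereby become
identities between components of cochains. -/
theorem strictHom_ext {X Y : Decorated A} {p q : ℤ}
    {f g : StrictHom (X.term p) (Y.term q)} (h : f.left ≫ Y.termι q = g.left ≫ Y.termι q)
    (h' : X.termπ p ≫ f.right = X.termπ p ≫ g.right) : f = g := by
  rw [cancel_mono] at h
  rw [cancel_epi] at h'
  exact StrictHom.ext h h'

section

variable {X Y Z : Decorated A} {K : Type w} [CommRing K] [Linear K A]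

theorem factors_iff_exists {U : A} {n : ℤ} (f : U ⟶ X.E.X n) :
    (X.M n).Factors f ↔ ∃ a, a ≫ X.termι n = f := by
  constructor
  · exact fun h => ⟨(X.M n).factorThru f h, Subobject.factorThru_arrow _ _ h⟩
  · rintro ⟨a, rfl⟩
    exact Subobject.factors_comp_arrow _

theorem factors_iff_comp_termπ {U : A} {n : ℤ} (f : U ⟶ X.E.X (n + 1)) :
    (X.M (n + 1)).Factors f ↔ f ≫ X.termπ n = 0 := factors_iff_comp_cokernelπ _ _

theorem mem_respecting {k : ℤ} {g : Cochain X.E Y.E k} :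
    g ∈ respecting K X Y k ↔ ∀ (p q : ℤ) (h : p + k = q),
      ∃ a, a ≫ Y.termι q = X.termι p ≫ g.v p q h :=
  forall_congr' fun _ => forall_congr' fun _ => forall_congr' fun _ => factors_iff_exists _

theorem mem_decHom {k : ℤ} {g : Cochain X.E Y.E k} :
    g ∈ decHom K X Y k ↔ ∀ (p q : ℤ) (h : p + k = q),
      X.termι p ≫ g.v p q h = 0 ∧ ∃ a, a ≫ Y.termι q = g.v p q h :=
  forall_congr' fun _ => forall_congr' fun _ => forall_congr' fun _ =>
    and_congr Iff.rfl (factors_iff_exists _)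

/-- With `strictOf_right` and `strictHom_ext`, this determines `strictOf g` by the components of
`g`. -/
theorem strictOf_left {k : ℤ} (g : homfh K X Y k) (p q : ℤ) (h : p + k = q) :
    (strictOf g p q h).left ≫ Y.termι q = k.negOnePow • (X.termι p ≫ g.1.v p q h) := by
  refine (Linear.units_smul_comp _ _ _).trans ?_
  exact congrArg (k.negOnePow • ·) (Subobject.factorThru_arrow _ _ (g.2.1 p q h))

theorem strictOf_right {k : ℤ} (g : homfh K X Y k) (p q : ℤ) (h : p + k = q) :
    X.termπ p ≫ (strictOf g p q h).right = g.1.v (p + 1) (q + 1) (by lia) ≫ Y.termπ q :=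
  cokernel.π_desc _ _ _

/-- On the left components this rests on the multiplicativity of the sign `(-1)^k`. -/
theorem strictOf_comp {n m p : ℤ} (h : n + m = p) (f : homfh K X Y n) (g : homfh K Y Z m)
    (i l j : ℤ) (hl : i + n = l) (hj : l + m = j) :
    strictOf (homfhComp h f g) i j (by lia) =
      (strictOf f i l hl).comp (strictOf g l j hj) := by
  refine strictHom_ext ?_ ?_
  · have e : (homfhComp h f g).1.v i j (by lia) = f.1.v i l hl ≫ g.1.v l j hj :=
      Cochain.comp_v f.1 g.1 h i l j hl hj
    rw [strictOf_left, e, StrictHom.comp_left, Category.assoc, strictOf_left, ← h,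
      Int.negOnePow_add, Linear.comp_units_smul, ← Category.assoc (strictOf f i l hl).left,
      strictOf_left, Linear.units_smul_comp, smul_smul, mul_comm, Category.assoc]
  · have e : (homfhComp h f g).1.v (i + 1) (j + 1) (by lia) =
        f.1.v (i + 1) (l + 1) (by lia) ≫ g.1.v (l + 1) (j + 1) (by lia) :=
      Cochain.comp_v f.1 g.1 h (i + 1) (l + 1) (j + 1) (by lia) (by lia)
    rw [strictOf_right, e, StrictHom.comp_right, ← Category.assoc, strictOf_right, Category.assoc,
      Category.assoc, strictOf_right]

theorem strictOf_id (p : ℤ) : strictOf (K := K) ⟨Cochain.ofHom (𝟙 X.E), id_mem_homfh⟩ p p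
    (add_zero p) = StrictHom.id (X.term p) := by
  refine strictHom_ext ?_ ?_
  · rw [strictOf_left]; simp
  · rw [strictOf_right]; simp

theorem mk_eq_iff {k : ℤ} {g g' : homfh K X Y k} :
    QHom.mk g = QHom.mk g' ↔ g.1 - g'.1 ∈ nullHom K X Y k :=
  Submodule.Quotient.eq _

end

end Decorated

variable {t : TorsionPair A} {X Y Z : { X : Decorated A // X.IsCompatible t }}
  {K : Type w} [CommRing K] [Linear K A]

theorem tiltComplex_d (n : ℤ) : (tiltComplex X).d n (n + 1) = BHom.mk (X.1.butterfly n) :=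
  CochainComplex.of_d (tiltTerm X) (fun n => BHom.mk (X.1.butterfly n)) n

theorem tiltCochain_v {k : ℤ} (g : Decorated.homfh K X.1 Y.1 k) (p q : ℤ) (h : p + k = q) :
    (tiltCochain g).v p q h = BHom.ofStrict (Decorated.strictOf g p q h) := rfl

/-- The compatibility of `strictOf` with the differentials. -/
theorem comp_butterfly {X Y : Decorated A} {k : ℤ} (g : Decorated.homfh K X Y k) (p q : ℤ)
    (h : p + k = q) (v : StrictHom (X.term (p + 1)) (Y.term (q + 1)))
    (hl : v.left ≫ Y.termι (q + 1) = X.termι (p + 1) ≫ g.1.v (p + 1) (q + 1) (by lia))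
    (hr : X.termπ (p + 1) ≫ v.right =
      k.negOnePow • (g.1.v (p + 1 + 1) (q + 1 + 1) (by lia) ≫ Y.termπ (q + 1))) :
    BHom.comp (BHom.mk (X.butterfly p)) (BHom.ofStrict v) +
        BHom.ofStrict (Decorated.strictOf (Decorated.homfhD rfl g) p (q + 1) (by lia)) =
      BHom.comp (BHom.ofStrict (Decorated.strictOf g p q h)) (BHom.mk (Y.butterfly q)) := by
  have e₁ (i j : ℤ) (hij : i + (k + 1) = j + 1) : (Decorated.homfhD rfl g).1.v i (j + 1) hij =
      g.1.v i j (by lia) ≫ Y.E.d j (j + 1) + (k + 1).negOnePow •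
        (X.E.d i (i + 1) ≫ g.1.v (i + 1) (j + 1) (by lia)) :=
    δ_v k (k + 1) rfl g.1 i (j + 1) hij j (i + 1) (by lia) rfl
  have hk : (k + 1).negOnePow = -k.negOnePow := Int.negOnePow_succ k
  -- The component of `g` from `E^(p+1)` to `F^(q+1)` is taken as the map of middle objects. The
  -- hypotheses on `v` say that it is `(-1)^k` times the strict morphism of `g` at `p + 1`, and `dg`
  -- measures the failure of the square to commute.
  refine BHom.sound (Butterfly.comp_strict_iso_add (P := X.butterfly p) (P' := Y.butterfly q)
    _ v _ (g.1.v (p + 1) (q + 1) (by lia)) ?_ hl.symm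
    (Decorated.strictOf_right g p q h).symm ?_)
  · change (X.termι p ≫ X.E.d p (p + 1)) ≫ g.1.v (p + 1) (q + 1) _ =
      (Decorated.strictOf g p q h).left ≫ Y.termι q ≫ Y.E.d q (q + 1) +
        (Decorated.strictOf (Decorated.homfhD rfl g) p (q + 1) _).left ≫ Y.termι (q + 1)
    rw [Decorated.strictOf_left, ← Category.assoc _ (Y.termι q), Decorated.strictOf_left, e₁, hk]
    rcases Int.units_eq_one_or k.negOnePow with e | e <;> rw [e] <;> simp
  · change g.1.v (p + 1) (q + 1) _ ≫ Y.E.d (q + 1) (q + 1 + 1) ≫ Y.termπ (q + 1) =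
      (X.E.d (p + 1) (p + 1 + 1) ≫ X.termπ (p + 1)) ≫ v.right + X.termπ p ≫
        (Decorated.strictOf (Decorated.homfhD rfl g) p (q + 1) _).right
    rw [Decorated.strictOf_right, Category.assoc, hr, e₁, hk]
    rcases Int.units_eq_one_or k.negOnePow with e | e <;> rw [e] <;> simp

/-- `comp_butterfly` rearranged into the formula for the differential of a Hom complex. The morphism
`v` there is the strict morphism of `g` for even `k` and its negative for odd `k`. -/
theorem comp_butterfly_add {X Y : Decorated A} {k : ℤ} (g : Decorated.homfh K X Y k) (p q : ℤ)
    (h : p + k = q) :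
    BHom.comp (BHom.ofStrict (Decorated.strictOf g p q h)) (BHom.mk (Y.butterfly q)) +
        (k + 1).negOnePow • BHom.comp (BHom.mk (X.butterfly p))
          (BHom.ofStrict (Decorated.strictOf g (p + 1) (q + 1) (by lia))) =
      BHom.ofStrict (Decorated.strictOf (Decorated.homfhD rfl g) p (q + 1) (by lia)) := by
  have hk : (k + 1).negOnePow = -k.negOnePow := Int.negOnePow_succ k
  have hl := Decorated.strictOf_left g (p + 1) (q + 1) (by lia)
  have hr := Decorated.strictOf_right g (p + 1) (q + 1) (by lia)
  rcases Int.units_eq_one_or k.negOnePow with e | e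
  · rw [hk, e, Units.neg_smul, one_smul, ← comp_butterfly g p q h
      (Decorated.strictOf g (p + 1) (q + 1) (by lia)) (by rw [hl, e, one_smul])
      (by rw [hr, e, one_smul]), add_neg_cancel_comm]
  · rw [hk, e, neg_neg, one_smul, ← comp_butterfly g p q h
      (Decorated.strictOf g (p + 1) (q + 1) (by lia)).neg (by simp [StrictHom.neg, hl, e])
      (by simp [StrictHom.neg, hr, e]), BHom.ofStrict_neg, BHom.comp_neg, neg_add_cancel_comm]

theorem δ_tiltCochain {k m : ℤ} (hm : k + 1 = m) (g : Decorated.homfh K X.1 Y.1 k) :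
    δ k m (tiltCochain g) = tiltCochain (Decorated.homfhD hm g) := by
  subst hm
  ext p r hr
  obtain rfl : r = p + k + 1 := by lia
  rw [δ_v k (k + 1) rfl (tiltCochain g) p (p + k + 1) hr (p + k) (p + 1) (by lia) rfl,
    tiltComplex_d, tiltComplex_d]
  exact comp_butterfly_add g p (p + k) rfl

/-- The map `g ↦ tiltCochain g` on the Hom modules, as a linear map. -/
noncomputable def tiltCochainHom (k : ℤ) :
    Decorated.homfh K X.1 Y.1 k →ₗ[K] Cochain (tiltComplex X) (tiltComplex Y) k where
  toFun := tiltCochain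
  map_add' f g := by
    ext p q h
    rw [Cochain.add_v, tiltCochain_v, tiltCochain_v, tiltCochain_v]
    refine Eq.trans (congrArg BHom.ofStrict (Decorated.strictHom_ext ?_ ?_))
      (BHom.ofStrict_add _ _).symm
    · simp [Decorated.strictOf_left]
    · simp [Decorated.strictOf_right]
  map_smul' r f := by
    ext p q h
    rw [RingHom.id_apply, Cochain.smul_v, tiltCochain_v, tiltCochain_v]
    refine Eq.trans (congrArg BHom.ofStrict (Decorated.strictHom_ext ?_ ?_))
      (BHom.smul_ofStrict _ _).symm
    · simp [Decorated.strictOf_left]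
      rw [smul_comm]
    · simp [Decorated.strictOf_right]

theorem tiltCochain_eq_zero_of_mem_decHom {k : ℤ} (g : Decorated.homfh K X.1 Y.1 k)
    (hg : g.1 ∈ Decorated.decHom K X.1 Y.1 k) : tiltCochain g = 0 := by
  ext p q h
  rw [tiltCochain_v]
  refine congrArg BHom.ofStrict (Decorated.strictHom_ext ?_ ?_)
  · rw [Decorated.strictOf_left, ((Decorated.mem_decHom.1 hg) p q h).1, smul_zero]
    exact zero_comp.symm
  · obtain ⟨-, a, ha⟩ := (Decorated.mem_decHom.1 hg) (p + 1) (q + 1) (by lia)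
    rw [Decorated.strictOf_right, ← ha, Category.assoc, Decorated.termι_termπ, comp_zero]
    exact comp_zero.symm

/-- Elements of `M^k` and of `M^(k-1)` induce zero on the decorations and on the quotients. Since
`δ_tiltCochain` sends `db` to the differential of the image of `b`, elements of `dM^(k-1)` are
killed too, and the functor descends to the quotient. -/
theorem tiltCochain_eq_zero_of_mem_nullHom {k : ℤ} (g : Decorated.homfh K X.1 Y.1 k)
    (hg : g.1 ∈ Decorated.nullHom K X.1 Y.1 k) : tiltCochain g = 0 := by
  obtain ⟨a, ha, b, hb, e⟩ := Decorated.nullHom_cases hg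
  have h : g = ⟨a, Decorated.decHom_le_homfh ha⟩ +
    Decorated.homfhD (by lia) ⟨b, Decorated.decHom_le_homfh hb⟩ := Subtype.ext e
  rw [h]
  refine ((tiltCochainHom (X := X) (Y := Y) (K := K) k).map_add _ _).trans ?_
  change tiltCochain _ + tiltCochain _ = 0
  rw [← δ_tiltCochain, tiltCochain_eq_zero_of_mem_decHom _ ha,
    tiltCochain_eq_zero_of_mem_decHom _ hb, δ_zero, add_zero]

variable (K X Y) in
/-- The map on the Hom modules of `Ch(A, T, F)` that is induced by `tiltCochain`. -/
noncomputable def tiltMap (k : ℤ) :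
    Decorated.QHom K X.1 Y.1 k →ₗ[K] Cochain (tiltComplex X) (tiltComplex Y) k :=
  Submodule.liftQ _ (tiltCochainHom k) fun g hg => tiltCochain_eq_zero_of_mem_nullHom g hg

theorem tiltCochain_comp {n m p : ℤ} (h : n + m = p) (f : Decorated.homfh K X.1 Y.1 n)
    (g : Decorated.homfh K Y.1 Z.1 m) :
    tiltCochain (Decorated.homfhComp h f g) = (tiltCochain f).comp (tiltCochain g) h := by
  ext i j hij
  rw [Cochain.comp_v _ _ h i (i + n) j rfl (by lia), tiltCochain_v, tiltCochain_v, tiltCochain_v,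
    Decorated.strictOf_comp h f g i (i + n) j rfl (by lia)]
  exact (BHom.ofStrict_comp _ _).symm

theorem tiltCochain_id : tiltCochain (X := X) (Y := X) (K := K)
    ⟨Cochain.ofHom (𝟙 X.1.E), Decorated.id_mem_homfh⟩ = Cochain.ofHom (𝟙 (tiltComplex X)) := by
  ext p
  rw [tiltCochain_v, Cochain.ofHom_v, Decorated.strictOf_id]
  rfl

variable (K t) in
/-- The DG functor from `Ch(A, T, F)` to the complexes in the tilted category. -/
noncomputable def tiltFunctor :
    DGFunctor (dgDecorated K t) (dgComplexes K (Tilt t)) tiltComplex where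
  map {X Y k} := tiltMap X Y K k
  map_d {X Y n m} h f := by
    obtain ⟨f, rfl⟩ := Decorated.QHom.exists_mk f
    exact (δ_tiltCochain h f).symm
  map_comp {X Y Z n m p} h f g := by
    obtain ⟨f, rfl⟩ := Decorated.QHom.exists_mk f
    obtain ⟨g, rfl⟩ := Decorated.QHom.exists_mk g
    exact tiltCochain_comp h f g
  map_id X := tiltCochain_id

end Functor


/-! ### Injectivity and bijectivity of the functor on Hom complexes -/

section FullyFaithful

open CochainComplex.HomComplex

variable {A : Type u} [Category.{v} A] [Abelian A]

/-- The `n`-th butterfly provides data in position `n + 1` only. Every integer is of this form, but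
not definitionally; this lemma absorbs the reindexing. -/
theorem exists_forall_add_one {S : ℤ → Sort*} (f : ∀ n, S (n + 1)) :
    ∃ g : ∀ n, S n, ∀ n, g (n + 1) = f n := by
  refine ⟨Equiv.piCongrLeft S (Equiv.addRight (1 : ℤ)) f, fun n => ?_⟩
  exact Equiv.piCongrLeft_apply_apply S (Equiv.addRight (1 : ℤ)) f n

theorem exists_forall_add_one₂ {k : ℤ} {S : ∀ p q : ℤ, p + k = q → Sort*}
    (f : ∀ (p q : ℤ) (h : p + k = q), S (p + 1) (q + 1) (by lia)) :
    ∃ g : ∀ p q h, S p q h, ∀ p q h, g (p + 1) (q + 1) (by lia) = f p q h := by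
  -- Heterogeneous equality with free predecessors `i`, `j` lets substitution replace explicit
  -- transports.
  have key (p q : ℤ) (h : p + k = q) : ∃ x : S p q h, ∀ (i j : ℤ) (hij : i + k = j)
      (_ : i + 1 = p) (_ : j + 1 = q), x ≍ f i j hij := by
    obtain ⟨p, rfl⟩ : ∃ i, p = i + 1 := ⟨p - 1, by lia⟩
    obtain ⟨q, rfl⟩ : ∃ i, q = i + 1 := ⟨q - 1, by lia⟩
    refine ⟨f p q (by lia), fun i j hij hi hj => ?_⟩
    obtain rfl : p = i := by lia
    obtain rfl : q = j := by lia
    rfl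
  choose g hg using key
  exact ⟨g, fun p q h => eq_of_heq (hg _ _ _ p q h rfl rfl)⟩

variable {K : Type w} [CommRing K] [Linear K A] {X Y : Decorated A}

namespace Decorated

/-- An element of `homfh` with nullhomotopic strict morphisms is zero in the quotient. -/
theorem mem_nullHom_of_homotopy {k : ℤ} (g : homfh K X Y k)
    (c : ∀ p q : ℤ, p + k = q → ((X.term p).right ⟶ (Y.term q).left))
    (hl : ∀ (p q : ℤ) (h : p + k = q), (strictOf g p q h).left = (X.term p).d ≫ c p q h)
    (hr : ∀ (p q : ℤ) (h : p + k = q), (strictOf g p q h).right = c p q h ≫ (Y.term q).d) :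
    g.1 ∈ nullHom K X Y k := by
  have key (i j : ℤ) (hij : i + (k - 1) = j) : ∃ m : X.E.X i ⟶ Y.E.X j,
      X.termι i ≫ m = 0 ∧ (∃ a, a ≫ Y.termι j = m) ∧
      (∀ (p : ℤ) (_ : p + 1 = i) (h : p + k = j),
        X.termι p ≫ g.1.v p j h = k.negOnePow • (X.termι p ≫ X.E.d p i ≫ m)) ∧
      ∀ (q : ℤ) (_ : j + 1 = q) (h : i + k = q),
        (Y.M q).Factors (g.1.v i q h - m ≫ Y.E.d j q) := by
    obtain ⟨p, rfl⟩ : ∃ p, i = p + 1 := ⟨i - 1, by lia⟩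
    obtain rfl : p + k = j := by lia
    -- With `i = p + 1` and `j = p + k`, the homotopy becomes a map `E^i → E^i/M^i → N^j → F^j` of
    -- degree `k - 1`, which vanishes on `M^i` and has values in `N^j`.
    refine ⟨X.termπ p ≫ c p (p + k) rfl ≫ Y.termι (p + k), ?_, ⟨_, Category.assoc _ _ _⟩, ?_, ?_⟩
    · rw [← Category.assoc, termι_termπ, zero_comp]
    · intro p' hp' h
      obtain rfl : p = p' := by lia
      have e := strictOf_left g p (p + k) rfl
      rw [hl, term_d] at e
      simp only [Category.assoc] at e
      rw [e, smul_smul, Int.units_mul_self, one_smul]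
    · rintro q rfl h
      have e := strictOf_right g p (p + k) rfl
      rw [hr, term_d] at e
      rw [factors_iff_comp_termπ, Preadditive.sub_comp, ← e]
      simp
  choose m hm₁ hm₂ hm₃ hm₄ using key
  let b : Cochain X.E Y.E (k - 1) := Cochain.mk m
  have hb : b ∈ decHom K X Y (k - 1) := mem_decHom.2 fun p q h => ⟨hm₁ p q h, hm₂ p q h⟩
  have e (i j : ℤ) (hij : i + k = j) : (δ (k - 1) k b).v i j hij =
      m i (j - 1) (by omega) ≫ Y.E.d (j - 1) j +
        k.negOnePow • (X.E.d i (i + 1) ≫ m (i + 1) j (by omega)) :=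
    δ_v (k - 1) k (by omega) b i j hij (j - 1) (i + 1) rfl rfl
  -- It remains to see that `g - db` lies in `M^k`. On the decoration, only the summand of `db` that
  -- starts with the differential of `E` survives, and it equals `g` by the left homotopy equations.
  -- Modulo the decoration of the target, only the other summand survives, and it equals `g` by the
  -- right ones.
  rw [← sub_add_cancel g.1 (δ (k - 1) k b)]
  refine Submodule.add_mem _ (decHom_le_nullHom (mem_decHom.2 fun i j hij => ⟨?_, ?_⟩))
    (δ_mem_nullHom (by omega) hb)
  · rw [Cochain.sub_v, e, Preadditive.comp_sub, Preadditive.comp_add, reassoc_of% hm₁ i,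
      Linear.comp_units_smul, hm₃ (i + 1) j (by omega) i rfl hij]
    simp
  · obtain ⟨a, ha⟩ := hm₂ (i + 1) j (by omega)
    rw [← factors_iff_exists, Cochain.sub_v, e, ← sub_sub]
    refine (factoring K (Y.M j)).sub_mem (hm₄ i (j - 1) (by omega) j (by omega) hij)
      ((factors_iff_exists _).2 ⟨k.negOnePow • (X.E.d i (i + 1) ≫ a), ?_⟩)
    rw [Linear.units_smul_comp, Category.assoc, ha]

/-- The condition that every family of butterflies between the terms is induced by some family of
morphisms. -/
structure IsLifting (X Y : Decorated A) : Prop where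
  exists_strict : ∀ {p q : ℤ} (f : BHom (X.term p) (Y.term q)), ∃ s, BHom.ofStrict s = f
  exists_extension : ∀ {p q : ℤ} (a : (X.term p).left ⟶ (Y.term q).left),
    ∃ b : X.E.X p ⟶ (Y.term q).left, X.termι p ≫ b = a
  exists_lift : ∀ {p q : ℤ} (a : (X.term p).right ⟶ (Y.term q).right),
    ∃ b : (X.term p).right ⟶ Y.E.X (q + 1), b ≫ Y.termπ q = a

/-- Every family of strict morphisms between the terms comes from an element of `homfh`. -/
theorem IsLifting.exists_homfh (hXY : IsLifting X Y) {k : ℤ}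
    (s : ∀ p q : ℤ, p + k = q → StrictHom (X.term p) (Y.term q)) :
    ∃ g : homfh K X Y k, ∀ p q h, strictOf g p q h = s p q h := by
  have key (p q : ℤ) (h : p + k = q) : ∃ g : X.E.X (p + 1) ⟶ Y.E.X (q + 1),
      X.termι (p + 1) ≫ g = k.negOnePow • ((s (p + 1) (q + 1) (by lia)).left ≫ Y.termι (q + 1)) ∧
      g ≫ Y.termπ q = X.termπ p ≫ (s p q h).right := by
    obtain ⟨a, ha⟩ := hXY.exists_extension (s (p + 1) (q + 1) (by lia)).left
    obtain ⟨b, hb⟩ := hXY.exists_lift (s p q h).right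
    -- `a` extends the left component to all of `E^(p+1)`, and `b` lifts the right component to
    -- `F^(q+1)`. As `ι` followed by `π` is zero, neither summand disturbs the condition met by the
    -- other.
    refine ⟨k.negOnePow • (a ≫ Y.termι (q + 1)) + X.termπ p ≫ b, ?_, ?_⟩
    · rw [Preadditive.comp_add, Linear.comp_units_smul, ← Category.assoc, ha,
        ← Category.assoc (X.termι (p + 1)), termι_termπ]
      simp
    · rw [Preadditive.add_comp, Linear.units_smul_comp, Category.assoc, termι_termπ,
        Category.assoc, hb]
      simp
  choose g₀ hl₀ hr₀ using key
  obtain ⟨g, hg⟩ := exists_forall_add_one₂ (S := fun p q _ => X.E.X p ⟶ Y.E.X q) g₀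
  have hl (p q : ℤ) (h : p + k = q) :
      X.termι p ≫ g p q h = k.negOnePow • ((s p q h).left ≫ Y.termι q) := by
    obtain ⟨p, rfl⟩ : ∃ i, p = i + 1 := ⟨p - 1, by lia⟩
    obtain ⟨q, rfl⟩ : ∃ i, q = i + 1 := ⟨q - 1, by lia⟩
    rw [hg p q (by lia), hl₀]
  have hr (p q : ℤ) (h : p + k = q) :
      g (p + 1) (q + 1) (by lia) ≫ Y.termπ q = X.termπ p ≫ (s p q h).right := by
    rw [hg, hr₀]
  have hk : (k + 1).negOnePow = -k.negOnePow := Int.negOnePow_succ k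
  have hmem : Cochain.mk g ∈ homfh K X Y k := by
    refine (mem_homfh rfl _).2 ⟨mem_respecting.2 fun p q h => ?_, fun p q h => ?_⟩
    · rw [Cochain.mk_v, hl]
      exact ⟨k.negOnePow • (s p q h).left, Linear.units_smul_comp _ _ _⟩
    · obtain ⟨q, rfl⟩ : ∃ i, q = i + 1 := ⟨q - 1, by lia⟩
      refine (factors_iff_comp_termπ _).2 ?_
      -- That `dg` respects the decorations is precisely the commutativity of the squares `s p q`.
      have e := (s p q (by lia)).comm
      change (X.termι p ≫ _) ≫ _ = 0
      rw [term_d, term_d] at e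
      rw [δ_v k (k + 1) rfl _ p (q + 1) h q (p + 1) (by lia) rfl, Cochain.mk_v, Cochain.mk_v,
        Preadditive.comp_add, ← Category.assoc, hl, Linear.comp_units_smul, Preadditive.add_comp,
        Linear.units_smul_comp, Linear.units_smul_comp, Linear.units_smul_comp, Category.assoc,
        Category.assoc, Category.assoc, Category.assoc, hr p q (by lia), e, hk]
      simp
  refine ⟨⟨_, hmem⟩, fun p q h => strictHom_ext ?_ ?_⟩
  · rw [strictOf_left]
    change k.negOnePow • (X.termι p ≫ g p q h) = _
    rw [hl, smul_smul, Int.units_mul_self, one_smul]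
  · rw [strictOf_right]
    exact hr p q h

/-- A component of an element of `M^k` amounts to a map `c` from the right term of `X` to the left
term of `Y`. Restricting `da = 0` to the decoration of `X`, and projecting it to the quotients of
`Y`, shows that both differentials kill `c`; then `eq_zero_of_comp_d` applies. -/
theorem eq_zero_of_mem_decHom_of_δ {t : TorsionPair A} (hX : X.IsCompatible t)
    (hY : Y.IsCompatible t) {k : ℤ} {a : Cochain X.E Y.E k} (ha : a ∈ decHom K X Y k)
    (h : δ k (k + 1) a = 0) : a = 0 := by
  ext i j hij
  obtain ⟨p, rfl⟩ : ∃ p, i = p + 1 := ⟨i - 1, by lia⟩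
  rw [mem_decHom] at ha
  obtain ⟨h₁, b, hb⟩ := ha (p + 1) j hij
  have hbι : X.termι (p + 1) ≫ b = 0 := by
    rw [← cancel_mono (Y.termι j), Category.assoc, hb, h₁, zero_comp]
  let c : (X.term p).right ⟶ (Y.term j).left := cokernel.desc (X.M (p + 1)).arrow b hbι
  have hc : X.termπ p ≫ c = b := cokernel.π_desc _ _ _
  have e (p q : ℤ) (h' : p + k = q) : a.v p q h' ≫ Y.E.d q (q + 1) + (k + 1).negOnePow •
      (X.E.d p (p + 1) ≫ a.v (p + 1) (q + 1) (by lia)) = 0 := by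
    rw [← δ_v k (k + 1) rfl a p (q + 1) (by lia) q (p + 1) (by lia) rfl, h, Cochain.zero_v]
  have hc₀ : c = 0 := by
    refine eq_zero_of_comp_d (hX p).2 (hY j).1 c ?_ ?_
    · obtain ⟨j, rfl⟩ : ∃ i, j = i + 1 := ⟨j - 1, by lia⟩
      have e' := X.termι p ≫= e p j (by lia)
      rw [Preadditive.comp_add, ← Category.assoc, (ha p j (by lia)).1, zero_comp, zero_add,
        Linear.comp_units_smul, comp_zero, smul_eq_zero_iff_eq] at e'
      rw [← cancel_mono (Y.termι (j + 1)), term_d, Category.assoc, Category.assoc, Category.assoc,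
        ← Category.assoc (X.termπ p), hc, hb, e', zero_comp]
    · obtain ⟨a', ha'⟩ := (ha (p + 1 + 1) (j + 1) (by lia)).2
      have e' := e (p + 1) j hij =≫ Y.termπ j
      rw [Preadditive.add_comp, Linear.units_smul_comp, Category.assoc, Category.assoc, ← ha',
        Category.assoc, termι_termπ] at e'
      simp only [comp_zero, smul_zero, zero_comp, add_zero] at e'
      rw [← cancel_epi (X.termπ p), term_d, ← Category.assoc, hc, ← Category.assoc b, hb, e',
        comp_zero]
  rw [← hb, ← hc, hc₀]
  simp

/-- Every closed morphism of degree `0` is the class of a chain map that respects the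
decorations. -/
theorem exists_ofHom_of_isClosed {t : TorsionPair A} (hX : X.IsCompatible t)
    (hY : Y.IsCompatible t) (s : QHom K X Y 0) (hs : QHom.d (zero_add 1) s = 0) :
    ∃ (f : X.E ⟶ Y.E) (hf : RespectsHom f), s = QHom.mk ⟨Cochain.ofHom f, ofHom_mem_homfh hf⟩ := by
  obtain ⟨g, rfl⟩ := QHom.exists_mk s
  have hg : δ 0 1 g.1 ∈ nullHom K X Y 1 := (Submodule.Quotient.mk_eq_zero
    ((nullHom K X Y 1).comap (homfh K X Y 1).subtype) (x := homfhD (zero_add 1) g)).1 hs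
  obtain ⟨a, ha, b, hb, e⟩ : ∃ a ∈ decHom K X Y 1, ∃ b ∈ decHom K X Y 0,
    δ 0 1 g.1 = a + δ 0 1 b := nullHom_cases hg
  -- Applying `d` to `dg = a + db` gives `da = 0`. So `a` vanishes, and `g - b` is a chain map in
  -- the class of `g`.
  have ha₀ : a = 0 := by
    refine eq_zero_of_mem_decHom_of_δ hX hY ha ?_
    have := congrArg (δ 1 (1 + 1)) e
    rwa [δ_δ, δ_add, δ_δ, add_zero, eq_comm] at this
  have hz : δ 0 1 (g.1 - b) = 0 := by rw [δ_sub, e, ha₀]; simp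
  let f : X.E ⟶ Y.E := Cocycle.homOf (Cocycle.mk (g.1 - b) 1 (zero_add 1) hz)
  have hf₀ : Cochain.ofHom f = g.1 - b := Cocycle.cochain_ofHom_homOf_eq_coe _
  have hmem : Cochain.ofHom f ∈ homfh K X Y 0 := by
    rw [hf₀]
    exact Submodule.sub_mem _ g.2 (decHom_le_homfh hb)
  have hf : RespectsHom f := fun n => by
    have := hmem.1 n n (add_zero n)
    rwa [Cochain.ofHom_v] at this
  refine ⟨f, hf, mk_eq_iff.2 ?_⟩
  change g.1 - Cochain.ofHom f ∈ _
  rw [hf₀, sub_sub_cancel]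
  exact decHom_le_nullHom hb

theorem strictOf_ofHom (f : X.E ⟶ Y.E) (hf : RespectsHom f) (n : ℤ) :
    strictOf (K := K) ⟨Cochain.ofHom f, ofHom_mem_homfh hf⟩ n n (add_zero n) = termMap f hf n := by
  refine strictHom_ext ?_ ?_
  · rw [strictOf_left, Int.negOnePow_zero, one_smul, Cochain.ofHom_v]
    exact (Subobject.factorThru_arrow _ _ (hf n)).symm
  · rw [strictOf_right, Cochain.ofHom_v]
    exact (cokernel.π_desc _ _ _).symm

end Decorated

variable {t : TorsionPair A} {X Y : { X : Decorated A // X.IsCompatible t }}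

/-- A zero strict butterfly yields a null-homotopy of its square, and these homotopies assemble to
an element of `M^(k-1)`. No projectivity or injectivity is involved. -/
theorem tiltMap_injective (k : ℤ) : Function.Injective (tiltMap X Y K k) := by
  rw [injective_iff_map_eq_zero]
  intro x hx
  obtain ⟨g, rfl⟩ := Decorated.QHom.exists_mk x
  have h (p q : ℤ) (hpq : p + k = q) := Butterfly.exists_homotopy
    (BHom.exact (Cochain.congr_v (z₁ := tiltCochain g) (z₂ := 0) hx p q hpq))
  choose c hl hr using h
  exact (Submodule.Quotient.mk_eq_zero _).2 (Decorated.mem_nullHom_of_homotopy g c hl hr)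

/-- The components of an element of a Hom complex satisfy no relation, so strict representatives may
be chosen independently and then lifted together. -/
theorem tiltMap_bijective (h : Decorated.IsLifting X.1 Y.1) (k : ℤ) :
    Function.Bijective (tiltMap X Y K k) := by
  refine ⟨tiltMap_injective k, fun z => ?_⟩
  choose s hs using fun (p q : ℤ) (hpq : p + k = q) => h.exists_strict (z.v p q hpq)
  obtain ⟨g, hg⟩ := h.exists_homfh (K := K) s
  refine ⟨Decorated.QHom.mk g, ?_⟩
  change tiltCochain g = z
  ext p q hpq
  rw [tiltCochain_v, hg, hs]

/-- The class `S_sis` consists of the closed morphisms that become isomorphisms in the DG category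
of complexes in the tilted category. -/
theorem sis_iff_isIso (s : (dgDecorated K t).Hom X Y 0) (hs : (dgDecorated K t).IsClosed s) :
    sis K t s ↔ (dgComplexes K (Tilt t)).IsIso ((tiltFunctor t K).map s) := by
  have h (f : X.1.E ⟶ Y.1.E) (hf : Decorated.RespectsHom f)
      (e : s = Decorated.QHom.mk ⟨Cochain.ofHom f, Decorated.ofHom_mem_homfh hf⟩) :
      (dgComplexes K (Tilt t)).IsIso ((tiltFunctor t K).map s) ↔ Decorated.IsSis f hf := by
    refine (dgComplexes_isIso_iff ((tiltFunctor t K).isClosed_map hs)).trans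
      (forall_congr' fun n => ?_)
    subst e
    refine (isIso_ofStrict_iff (U := tiltTerm X n) (V := tiltTerm Y n) _).trans ?_
    rw [Decorated.strictOf_ofHom]
    rfl
  constructor
  · rintro ⟨f, hf, hf', e⟩
    exact (h f hf e).2 hf'
  · intro hs'
    -- `S_sis` is defined through chain maps, so invertibility is not enough: a chain map in the
    -- class of `s` is needed.
    obtain ⟨f, hf, e⟩ := Decorated.exists_ofHom_of_isClosed X.2 Y.2 s hs
    exact ⟨f, hf, (h f hf e).1 hs', e⟩

/-- Projective quotients split both the short exact diagonals of butterflies out of the terms and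
the sequences `M^n → E^n → E^n/M^n`. They also lift maps along the projections of the target. -/
theorem isLifting_of_isSemiProjective (hX : IsSemiProjective X) : Decorated.IsLifting X.1 Y.1 := by
  have h (p : ℤ) : Projective (X.1.term p).right := hX p
  refine ⟨fun {p q} f => ?_, fun {p q} a => ?_, fun {p q} a => ?_⟩
  · obtain ⟨P, rfl⟩ := BHom.exists_mk f
    obtain ⟨s, hs⟩ := P.exists_iso_ofStrict (Projective.factorThru (𝟙 _) P.σ)
      (Projective.factorThru_comp _ _)
    exact ⟨s, (BHom.sound hs).symm⟩
  · obtain ⟨p, rfl⟩ : ∃ i, p = i + 1 := ⟨p - 1, by lia⟩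
    let s : (X.1.term p).right ⟶ X.1.E.X (p + 1) := Projective.factorThru (𝟙 _) (X.1.termπ p)
    have hs : s ≫ X.1.termπ p = 𝟙 _ := Projective.factorThru_comp _ _
    have hr : (𝟙 _ - X.1.termπ p ≫ s) ≫ X.1.termπ p = 0 := by simp [hs]
    obtain ⟨r, hr⟩ := (Decorated.factors_iff_exists _).1 ((Decorated.factors_iff_comp_termπ _).2 hr)
    refine ⟨r ≫ a, ?_⟩
    have : X.1.termι (p + 1) ≫ r = 𝟙 _ := by
      rw [← cancel_mono (X.1.termι (p + 1)), Category.assoc, hr, Preadditive.comp_sub,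
        ← Category.assoc _ (X.1.termπ p), Decorated.termι_termπ]
      simp
    rw [← Category.assoc, this, Category.id_comp]
  · exact ⟨Projective.factorThru a (Y.1.termπ q), Projective.factorThru_comp _ _⟩

/-- Here the splittings are on the target side: injective decorations split the diagonals of
butterflies into the terms and the inclusions of the decorations of `Y`, and maps into them extend
along those of `X`. -/
theorem isLifting_of_isSemiInjective (hY : IsSemiInjective Y) : Decorated.IsLifting X.1 Y.1 := by
  have h (p : ℤ) : Injective (Y.1.term p).left := hY p
  refine ⟨fun {p q} f => ?_, fun {p q} a => ?_, fun {p q} a => ?_⟩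
  · obtain ⟨P, rfl⟩ := BHom.exists_mk f
    let r := Injective.factorThru (𝟙 _) P.ι
    have hr : P.ι ≫ r = 𝟙 _ := Injective.comp_factorThru _ _
    have := P.exact.epi_g
    let σ := ShortComplex.Splitting.ofExactOfRetraction _ P.exact.exact r hr P.exact.epi_g
    obtain ⟨s, hs⟩ := P.exists_iso_ofStrict σ.s σ.s_g
    exact ⟨s, (BHom.sound hs).symm⟩
  · exact ⟨Injective.factorThru a (X.1.termι p), Injective.comp_factorThru _ _⟩
  -- A retraction onto the decoration in position `q + 1` yields a section `s` of `termπ q`, whose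
  -- source is the quotient by that decoration.
  · let r := Injective.factorThru (𝟙 _) (Y.1.termι (q + 1))
    have hr : Y.1.termι (q + 1) ≫ r = 𝟙 _ := Injective.comp_factorThru _ _
    have hs : Y.1.termι (q + 1) ≫ (𝟙 _ - r ≫ Y.1.termι (q + 1)) = 0 := by
      rw [Preadditive.comp_sub, ← Category.assoc, hr]
      simp
    let s : (Y.1.term q).right ⟶ Y.1.E.X (q + 1) := cokernel.desc (Y.1.M (q + 1)).arrow _ hs
    have hs' : Y.1.termπ q ≫ s = 𝟙 _ - r ≫ Y.1.termι (q + 1) := cokernel.π_desc _ _ _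
    refine ⟨a ≫ s, ?_⟩
    have : s ≫ Y.1.termπ q = 𝟙 _ := by
      rw [← cancel_epi (Y.1.termπ q), ← Category.assoc, hs', Preadditive.sub_comp, Category.assoc,
        Decorated.termι_termπ]
      simp
    rw [Category.assoc, this, Category.comp_id]

end FullyFaithful


/-! ### Essential surjectivity: complexes of butterflies as decorated complexes -/

section EssSurj

variable {A : Type u} [Category.{v} A] [Abelian A]

theorem StrictHom.isQuasiIso_of_isIso {X Y : TwoTerm A} (f : StrictHom X Y) [IsIso f.left]
    [IsIso f.right] : f.IsQuasiIso :=
  ⟨(kernel.mapIso X.d Y.d (asIso f.left) (asIso f.right) f.comm.symm).isIso_hom,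
    (cokernel.mapIso X.d Y.d (asIso f.left) (asIso f.right) f.comm.symm).isIso_hom⟩

/-- `σ` is a cokernel of `j`, hence of the arrow of the subobject that `j` represents; cokernels are
unique. -/
theorem isIso_cokernel_desc_arrow {X E Y : A} {j : X ⟶ E} [Mono j] {σ : E ⟶ Y} (w : j ≫ σ = 0)
    (h : (ShortComplex.mk j σ w).ShortExact) (hσ : (Subobject.mk j).arrow ≫ σ = 0) :
    IsIso (cokernel.desc (Subobject.mk j).arrow σ hσ) := by
  have hj : j ≫ cokernel.π (Subobject.mk j).arrow = 0 :=
    (congrArg (· ≫ cokernel.π (Subobject.mk j).arrow) (Subobject.underlyingIso_arrow j)).symm.trans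
      (by simp only [Category.assoc, cokernel.condition, comp_zero])
  have hσ' : Epi σ := h.epi_g
  have : Epi (ShortComplex.mk j σ w).g := hσ'
  obtain ⟨c, hc⟩ : ∃ c : Y ⟶ cokernel (Subobject.mk j).arrow, σ ≫ c = cokernel.π _ :=
    ⟨h.exact.desc _ hj, h.exact.g_desc _ hj⟩
  refine ⟨c, ?_, ?_⟩
  · rw [← cancel_epi (cokernel.π (Subobject.mk j).arrow), ← Category.assoc, cokernel.π_desc, hc,
      Category.comp_id]
  · rw [← cancel_epi σ, ← Category.assoc, hc, cokernel.π_desc, Category.comp_id]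

/-- A complex with term `E (n + 1)` in the middle of a short exact sequence
`0 → (T (n + 1))⁻¹ → E (n + 1) → (T n)⁰ → 0`, such that the differentials induce those of the
two-term complexes `T n`. -/
structure Linkage (T : ℤ → TwoTerm A) where
  E : ℤ → A
  d : ∀ n, E n ⟶ E (n + 1)
  d_d : ∀ n, d n ≫ d (n + 1) = 0
  j : ∀ n, (T n).left ⟶ E n
  σ : ∀ n, E (n + 1) ⟶ (T n).right
  jσ : ∀ n, j (n + 1) ≫ σ n = 0
  exact : ∀ n, (ShortComplex.mk (j (n + 1)) (σ n) (jσ n)).ShortExact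
  comp_d : ∀ n, j n ≫ d n ≫ σ n = (T n).d

namespace Linkage

variable {T : ℤ → TwoTerm A} (L : Linkage T)

/-- The butterflies of a linkage. -/
def butterfly (n : ℤ) : Butterfly (T n) (T (n + 1)) where
  E := L.E (n + 1)
  κ := L.j n ≫ L.d n
  ι := L.j (n + 1)
  σ := L.σ n
  ρ := L.d (n + 1) ≫ L.σ (n + 1)
  κσ := by rw [Category.assoc, L.comp_d]
  ιρ := L.comp_d (n + 1)
  κρ := by rw [Category.assoc, ← Category.assoc (L.d n), L.d_d, zero_comp, comp_zero]
  ισ := L.jσ n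
  exact := L.exact n

instance (n : ℤ) : Mono (L.j n) := by
  obtain ⟨n, rfl⟩ : ∃ m, n = m + 1 := ⟨n - 1, by lia⟩
  exact (L.exact n).mono_f

instance (n : ℤ) : Epi (L.σ n) := (L.exact n).epi_g

/-- The decorated complex of a linkage. -/
noncomputable def decorated : Decorated A where
  E := CochainComplex.of L.E L.d L.d_d
  M n := Subobject.mk (L.j n)

theorem decorated_d (n : ℤ) : L.decorated.E.d n (n + 1) = L.d n :=
  CochainComplex.of_d L.E L.d n

theorem arrow_σ (n : ℤ) : (Subobject.mk (L.j (n + 1))).arrow ≫ L.σ n = 0 := by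
  rw [← Subobject.underlyingIso_hom_comp_eq_mk, Category.assoc, L.jσ, comp_zero]

/-- The isomorphisms from the terms of the decorated complex of a linkage. -/
noncomputable def termHom (n : ℤ) : StrictHom (L.decorated.term n) (T n) where
  left := (Subobject.underlyingIso (L.j n)).hom
  right := cokernel.desc (Subobject.mk (L.j (n + 1))).arrow (L.σ n) (L.arrow_σ n)
  comm := by
    change _ = ((Subobject.mk (L.j n)).arrow ≫ L.decorated.E.d n (n + 1) ≫
      cokernel.π (Subobject.mk (L.j (n + 1))).arrow) ≫
      cokernel.desc (Subobject.mk (L.j (n + 1))).arrow (L.σ n) (L.arrow_σ n)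
    have h : (L.d n ≫ cokernel.π (Subobject.mk (L.j (n + 1))).arrow) ≫
        cokernel.desc (Subobject.mk (L.j (n + 1))).arrow (L.σ n) (L.arrow_σ n) = L.d n ≫ L.σ n := by
      rw [Category.assoc, cokernel.π_desc]
    rw [decorated_d, Category.assoc]
    refine Eq.trans ?_ (congrArg ((Subobject.mk (L.j n)).arrow ≫ ·) h.symm)
    rw [← Subobject.underlyingIso_hom_comp_eq_mk, Category.assoc, L.comp_d]
    rfl

instance (n : ℤ) : IsIso (L.termHom n).left :=
  inferInstanceAs (IsIso (Subobject.underlyingIso (L.j n)).hom)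

instance (n : ℤ) : IsIso (L.termHom n).right :=
  isIso_cokernel_desc_arrow (L.jσ n) (L.exact n) (L.arrow_σ n)

/-- Both butterflies have middle object `L.E (n + 1)`, and its identity fills the square. So the
termwise isomorphisms form a map of complexes. -/
theorem comp_termHom (n : ℤ) :
    BHom.comp (BHom.mk (L.decorated.butterfly n)) (BHom.ofStrict (L.termHom (n + 1))) =
      BHom.comp (BHom.ofStrict (L.termHom n)) (BHom.mk (L.butterfly n)) := by
  refine BHom.sound (Butterfly.comp_strict_iso (P := L.decorated.butterfly n)
    (P' := L.butterfly n) _ _ (𝟙 (L.E (n + 1))) ?_ ?_ ?_ ?_)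
  · change ((Subobject.mk (L.j n)).arrow ≫ L.decorated.E.d n (n + 1)) ≫ 𝟙 (L.E (n + 1)) =
      (Subobject.underlyingIso (L.j n)).hom ≫ L.j n ≫ L.d n
    rw [← Category.assoc (Subobject.underlyingIso (L.j n)).hom,
      Subobject.underlyingIso_hom_comp_eq_mk, decorated_d]
    exact Category.comp_id _
  · change (Subobject.mk (L.j (n + 1))).arrow ≫ 𝟙 (L.E (n + 1)) =
      (Subobject.underlyingIso (L.j (n + 1))).hom ≫ L.j (n + 1)
    rw [Category.comp_id, Subobject.underlyingIso_hom_comp_eq_mk]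
  · change 𝟙 (L.E (n + 1)) ≫ L.σ n = cokernel.π (Subobject.mk (L.j (n + 1))).arrow ≫
      cokernel.desc (Subobject.mk (L.j (n + 1))).arrow (L.σ n) (L.arrow_σ n)
    rw [cokernel.π_desc, Category.id_comp]
  · change 𝟙 (L.E (n + 1)) ≫ L.d (n + 1) ≫ L.σ (n + 1) = (L.decorated.E.d (n + 1) (n + 1 + 1) ≫
      cokernel.π (Subobject.mk (L.j (n + 1 + 1))).arrow) ≫
      cokernel.desc (Subobject.mk (L.j (n + 1 + 1))).arrow (L.σ (n + 1)) (L.arrow_σ (n + 1))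
    rw [decorated_d, Category.id_comp]
    refine Eq.symm ((Category.assoc _ _ _).trans ?_)
    exact congrArg (L.d (n + 1) ≫ ·) (cokernel.π_desc _ _ _)

end Linkage

/-- Transports a butterfly along an equality of middle objects, so that the middle object of the
`n`-th representative can be taken to be literally `E (n + 1)`. -/
theorem Butterfly.exists_eq {X Y : TwoTerm A} (P : Butterfly X Y) {E : A} (h : E = P.E) :
    ∃ (κ : X.left ⟶ E) (ι : Y.left ⟶ E) (σ : E ⟶ X.right) (ρ : E ⟶ Y.right) (h₁ : κ ≫ σ = X.d)
      (h₂ : ι ≫ ρ = Y.d) (h₃ : κ ≫ ρ = 0) (h₄ : ι ≫ σ = 0)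
      (h₅ : (ShortComplex.mk ι σ h₄).ShortExact),
      (⟨E, κ, ι, σ, ρ, h₁, h₂, h₃, h₄, h₅⟩ : Butterfly X Y) = P := by
  subst h
  exact ⟨P.κ, P.ι, P.σ, P.ρ, P.κσ, P.ιρ, P.κρ, P.ισ, P.exact, rfl⟩

variable {t : TorsionPair A}

/-- Every complex in the tilted category comes from a linkage. -/
theorem exists_linkage (Z : CochainComplex (Tilt t) ℤ) :
    ∃ L : Linkage fun n => (Z.X n).obj, ∀ n, BHom.mk (L.butterfly n) = Z.d n (n + 1) := by
  choose P hP using fun n => BHom.exists_mk (Z.d n (n + 1))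
  obtain ⟨E, hE⟩ := exists_forall_add_one (S := fun _ => A) fun n => (P n).E
  choose κ ι σ ρ h₁ h₂ h₃ h₄ h₅ h₆ using fun n => (P n).exists_eq (hE n)
  let B (n : ℤ) : Butterfly (Z.X n).obj (Z.X (n + 1)).obj :=
    ⟨E (n + 1), κ n, ι n, σ n, ρ n, h₁ n, h₂ n, h₃ n, h₄ n, h₅ n⟩
  have hB (n : ℤ) : BHom.mk (B n) = Z.d n (n + 1) := by rw [← hP, ← h₆]
  -- Two consecutive differentials of `Z` compose to zero, so their butterflies are linked. The
  -- links will be the differentials of the complex `E`.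
  have hlink (n : ℤ) : ∃ δ : E (n + 1) ⟶ E (n + 1 + 1), ι n ≫ δ = κ (n + 1) ∧
      δ ≫ σ (n + 1) = ρ n ∧ κ n ≫ δ = 0 ∧ δ ≫ ρ (n + 1) = 0 := by
    refine Butterfly.exists_link (P := B n) (Q := B (n + 1)) (BHom.exact ?_)
    have := Z.d_comp_d n (n + 1) (n + 1 + 1)
    rw [← hB, ← hB] at this
    exact this
  choose δ hδ₁ hδ₂ hδ₃ hδ₄ using hlink
  obtain ⟨d, hd⟩ := exists_forall_add_one (S := fun n => E n ⟶ E (n + 1)) δ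
  obtain ⟨j, hj⟩ := exists_forall_add_one (S := fun n => (Z.X n).obj.left ⟶ E n) ι
  have hκ (n : ℤ) : j n ≫ d n = κ n := by
    obtain ⟨n, rfl⟩ : ∃ m, n = m + 1 := ⟨n - 1, by lia⟩
    rw [hj, hd, hδ₁]
  have hρ (n : ℤ) : d (n + 1) ≫ σ (n + 1) = ρ n := by rw [hd, hδ₂]
  -- The composite of two consecutive links kills the image of `ι` and is killed by the next `σ`. It
  -- therefore factors through a map `c` from the right term of `Z.X n` to the left term of `Z.X (n
  -- + 3)`. The other link equations make both differentials kill `c`, so the torsion pair forces it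
  -- to vanish.
  have hdd (n : ℤ) : d n ≫ d (n + 1) = 0 := by
    obtain ⟨n, rfl⟩ : ∃ m, n = m + 1 := ⟨n - 1, by lia⟩
    have e₁ : ι n ≫ d (n + 1) ≫ d (n + 1 + 1) = 0 := by
      rw [hd, hd, ← Category.assoc, hδ₁, hδ₃]
    have e₂ : (d (n + 1) ≫ d (n + 1 + 1)) ≫ σ (n + 1 + 1) = 0 := by
      rw [Category.assoc, hρ, hd, hδ₄]
    have : Epi (ShortComplex.mk (ι n) (σ n) (h₄ n)).g := (h₅ n).epi_g
    have hσ : Epi (σ n) := (h₅ n).epi_g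
    have hc : σ n ≫ (h₅ n).exact.desc _ e₁ = _ := (h₅ n).exact.g_desc _ e₁
    obtain ⟨c, hc'⟩ := (B (n + 1 + 1)).exists_ι ((h₅ n).exact.desc _ e₁) (by
      change (h₅ n).exact.desc _ e₁ ≫ σ (n + 1 + 1) = 0
      rw [← cancel_epi (σ n), ← Category.assoc, hc, e₂, comp_zero])
    change c ≫ ι (n + 1 + 1) = _ at hc'
    have hι : Mono (ι (n + 1 + 1)) := (h₅ (n + 1 + 1)).mono_f
    have hc₀ : c = 0 := by
      refine eq_zero_of_comp_d (Z.X n).cokernel_mem (Z.X (n + 1 + 1 + 1)).kernel_mem c ?_ ?_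
      · rw [← cancel_mono (ι (n + 1 + 1)), Category.assoc, hc', ← h₁, Category.assoc, hc, hd,
          ← Category.assoc, hδ₃, zero_comp, zero_comp]
      · rw [← cancel_epi (σ n), ← h₂, ← Category.assoc c, hc', ← Category.assoc, hc,
          Category.assoc, hd, hd, hδ₄, comp_zero, comp_zero]
    rw [← hc, ← hc', hc₀, zero_comp, comp_zero]
  refine ⟨⟨E, d, hdd, j, σ, fun n => by rw [hj, h₄], fun n => by simpa only [hj] using h₅ n,
    fun n => by rw [← Category.assoc, hκ, h₁]⟩, fun n => ?_⟩
  rw [← hB]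
  simp only [Linkage.butterfly, B, hκ, hρ, hj]

/-- Every complex in the tilted category is isomorphic to the complex of a compatible decorated
complex, with isomorphic terms. -/
theorem exists_isIso_tiltComplex (Z : CochainComplex (Tilt t) ℤ) :
    ∃ (X : { X : Decorated A // X.IsCompatible t }) (f : tiltComplex X ⟶ Z), IsIso f ∧
      ∀ n, Nonempty ((Z.X n).obj.left ≅ ((tiltComplex X).X n).obj.left) ∧
        Nonempty ((Z.X n).obj.right ≅ ((tiltComplex X).X n).obj.right) := by
  obtain ⟨L, hL⟩ := exists_linkage Z
  have hq (n : ℤ) : (L.termHom n).IsQuasiIso := (L.termHom n).isQuasiIso_of_isIso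
  let X : { X : Decorated A // X.IsCompatible t } := ⟨L.decorated, fun n =>
    ⟨(hq n).kernel_mem.2 (Z.X n).kernel_mem, (hq n).cokernel_mem.2 (Z.X n).cokernel_mem⟩⟩
  have hi (n : ℤ) : @IsIso (Tilt t) _ (tiltTerm X n) (Z.X n) (BHom.ofStrict (L.termHom n)) :=
    (isIso_ofStrict_iff (U := tiltTerm X n) (V := Z.X n) _).2 (hq n)
  let e : tiltComplex X ≅ Z := HomologicalComplex.Hom.isoOfComponents
    (fun n => @asIso (Tilt t) _ (tiltTerm X n) (Z.X n) (BHom.ofStrict (L.termHom n)) (hi n)) (by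
      rintro n _ rfl
      rw [tiltComplex_d, ← hL]
      exact (L.comp_termHom n).symm)
  exact ⟨X, e.hom, inferInstance, fun n =>
    ⟨⟨(asIso (L.termHom n).left).symm⟩, ⟨(asIso (L.termHom n).right).symm⟩⟩⟩

/-- A complex may be replaced by an isomorphic one, with isomorphic terms. -/
theorem exists_complex_of_iso {B : Type u₁} [Category.{v₁} B] [HasZeroMorphisms B]
    (Z : CochainComplex B ℤ) (Z' : ℤ → B) (e : ∀ n, Z' n ≅ Z.X n) :
    ∃ (W : CochainComplex B ℤ) (f : W ⟶ Z), IsIso f ∧ W.X = Z' := by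
  let W : CochainComplex B ℤ :=
    { X := Z'
      d := fun i j => (e i).hom ≫ Z.d i j ≫ (e j).inv
      shape := fun i j h => by rw [Z.shape i j h]; simp
      d_comp_d' := fun i j k _ _ => by simp }
  let f : W ≅ Z := HomologicalComplex.Hom.isoOfComponents e fun i j _ => by simp [W]
  exact ⟨W, f.hom, inferInstance, rfl⟩

/-- Each term is first replaced by a quasi-isomorphic one with projective right part, which is
isomorphic to it in `B`. The linkage construction then changes terms only by strict isomorphisms, so
projectivity survives. -/
theorem exists_isIso_semiProjective [EnoughProjectives A] (Z : CochainComplex (Tilt t) ℤ) :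
    ∃ (X : { X : Decorated A // X.IsCompatible t }) (f : tiltComplex X ⟶ Z),
      IsSemiProjective X ∧ IsIso f := by
  have h (n : ℤ) : ∃ (P : Tilt t) (_ : P ≅ Z.X n), P.SemiProjective := by
    obtain ⟨P, f, hP, hf⟩ := exists_isQuasiIso_projective (Z.X n).obj
    let P' : Tilt t := ⟨P, hf.kernel_mem.2 (Z.X n).kernel_mem,
      hf.cokernel_mem.2 (Z.X n).cokernel_mem⟩
    exact ⟨P', @asIso (Tilt t) _ P' (Z.X n) (BHom.ofStrict f)
      ((isIso_ofStrict_iff (U := P') (V := Z.X n) f).2 hf), hP⟩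
  choose P e hP using h
  obtain ⟨W, f, hf, rfl⟩ := exists_complex_of_iso Z P e
  obtain ⟨X, g, hg, hX⟩ := exists_isIso_tiltComplex W
  refine ⟨X, g ≫ f, fun n => ?_, inferInstance⟩
  have : Projective (W.X n).obj.right := hP n
  exact Projective.of_iso (hX n).2.some inferInstance

/-- The same replacement with injective left parts. The quasi-isomorphisms now start at the terms of
`Z`, and their inverses exist only in `B`, as butterflies. -/
theorem exists_isIso_semiInjective [EnoughInjectives A] (Z : CochainComplex (Tilt t) ℤ) :
    ∃ (X : { X : Decorated A // X.IsCompatible t }) (f : tiltComplex X ⟶ Z),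
      IsSemiInjective X ∧ IsIso f := by
  have h (n : ℤ) : ∃ (I : Tilt t) (_ : I ≅ Z.X n), I.SemiInjective := by
    obtain ⟨I, f, hI, hf⟩ := exists_isQuasiIso_injective (Z.X n).obj
    let I' : Tilt t := ⟨I, hf.kernel_mem.1 (Z.X n).kernel_mem,
      hf.cokernel_mem.1 (Z.X n).cokernel_mem⟩
    exact ⟨I', (@asIso (Tilt t) _ (Z.X n) I' (BHom.ofStrict f)
      ((isIso_ofStrict_iff (U := Z.X n) (V := I') f).2 hf)).symm, hI⟩
  choose I e hI using h
  obtain ⟨W, f, hf, rfl⟩ := exists_complex_of_iso Z I e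
  obtain ⟨X, g, hg, hX⟩ := exists_isIso_tiltComplex W
  refine ⟨X, g ≫ f, fun n => ?_, inferInstance⟩
  have : Injective (W.X n).obj.left := hI n
  exact Injective.of_iso (hX n).1.some inferInstance

end EssSurj

end Tilting

/-! ### The derived equivalence -/

theorem propositionP {K : Type w} [CommRing K] {A : Type u} [Category.{v} A] [Abelian A]
    [Linear K A] (t : Tilting.TorsionPair A) :
    ∃ G : Tilting.DGFunctor (Tilting.dgDecorated K t) (Tilting.dgComplexes K (Tilting.Tilt t))
        Tilting.tiltComplex,
      (∀ (X Y : (Tilting.dgDecorated K t).Obj) (k : ℤ)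
        (g : Tilting.Decorated.homfh K X.1 Y.1 k),
        G.map (X := X) (Y := Y) (Tilting.Decorated.QHom.mk g) = Tilting.tiltCochain g) ∧
      (EnoughProjectives A →
        Tilting.IsLeftDerivedEquivalence G (Tilting.sis K t) Tilting.IsSemiProjective) ∧
      (EnoughInjectives A →
        Tilting.IsRightDerivedEquivalence G (Tilting.sis K t) Tilting.IsSemiInjective) := by
  refine ⟨Tilting.tiltFunctor t K, fun X Y k g => rfl, fun _ => ?_, fun _ => ?_⟩
  · refine Tilting.IsLeftDerivedEquivalence.of_bijective
      (fun s hs => Tilting.sis_iff_isIso s hs)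
      (fun X Y n hX => Tilting.tiltMap_bijective (Tilting.isLifting_of_isSemiProjective hX) n)
      fun Z => ?_
    obtain ⟨X, f, hX, hf⟩ := Tilting.exists_isIso_semiProjective Z
    exact ⟨X, _, hX, Tilting.dgComplexes_isIso_ofHom f⟩
  · refine Tilting.IsRightDerivedEquivalence.of_bijective
      (fun s hs => Tilting.sis_iff_isIso s hs)
      (fun X Y n hY => Tilting.tiltMap_bijective (Tilting.isLifting_of_isSemiInjective hY) n)
      fun Z => ?_
    obtain ⟨X, f, hX, hf⟩ := Tilting.exists_isIso_semiInjective Z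
    exact ⟨X, _, hX, Tilting.dgComplexes_isIso_ofHom f⟩
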